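/- **Setting.** All objects are smooth. Let $Q$ be a finite-dimensional manifold and $L:TQ\to\mathbb R$ a Lagrangian whose Legendre transform $TQ\to T^*Q$, $p=\partial_{\dot q}L$, is a diffeomorphism. Write $\lambda_L=\partial_{\dot q}L\cdot dq$ for the Lagrangian one-form on $TQ$ and $E_L=\partial_{\dot q}L\cdot\dot q-L$ for the energy. A *basic scaling symmetry of degree* $\Lambda\in\mathbb R$ of $(Q,L)$ is a vector field $\mathbf D$ on $TQ$ with $$\mathbf D(L)=\Lambda L,\qquad \mathbf D(E_L)=\Lambda E_L,\qquad L_{\mathbf D}\lambda_L=\lambda_L .$$ Let $\bar{\mathbf D}$ be the vector field on $Q$ given by $\bar{\mathbf D}(q)=d\tau(\mathbf D(0_q))$, where $\tau:TQ\to Q$ is the bundle projection. A *scaling function* is a function $\rho:Q\to\mathbb R\setminus\{0\}$ with $\bar{\mathbf D}\rho=\rho$; assume $\rho>0$ or $\Lambda\in\mathbb Z$, so that $\rho^\Lambda$ is defined. Assume that the quotient manifold $\bar Q=Q/\bar{\mathbf D}$ exists, i.e. there is a surjective submersion $p:Q\to\bar Q$ whose fibres are the orbits of $\bar{\mathbf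 D}$ and have tangent spaces spanned by $\bar{\mathbf D}$. Let $H:T^*Q\to\mathbb R$ be the Hamiltonian of $L$, and let $\mathscr H:T^*\bar Q\times\mathbb R\to\mathbb R$ be the reduced Hamiltonian, $$\mathscr H(\bar q,\bar p,S)=-\rho(q)^{-\Lambda}\,H\big(q,\,-\rho\,p^*\bar p-S\,d\rho\big),\qquad p(q)=\bar q .$$ Assume that its Legendre transform $T^*\bar Q\times\mathbb R\to T\bar Q\times\mathbb R$, $\bar q'=\partial_{\bar p}\mathscr H$, is a diffeomorphism too. **Extremals.** A curve $q$ on $[a,b]$ is an *extremal of $L$* if it is a critical point of $\int_a^b L(q,\dot q)\,dt$ under smooth variations with fixed endpoints. For $\mathscr L:T\bar Q\times\mathbb R\to\mathbb R$ put $\mathscr E=\partial_{\bar q'}\mathscr L\cdot\bar q'-\mathscr L$. A curve $(\bar q,S)$ on $[c,d]$ is an *extremal of the $\Lambda$-Herglotz system $\mathscr L$* if $S'=\mathscr L+(1-\Lambda)\mathscr E$ and $\int_c^d\mathscr L(\bar q,\bar q',S)\,d\tau$ is stationary under all smooth variations of $(\bar q,S)$ that fix the endpoints of $\bar q$ and satisfy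 $\delta S=\partial_{\bar q'}\mathscr L\cdot\delta\bar q$. In coordinates this means $$\frac{d}{d\tau}\frac{\partial\mathscr L}{\partial\bar q'}=\frac{\partial\mathscr L}{\partial\bar q}+\frac{\partial\mathscr L}{\partial S}\frac{\partial\mathscr L}{\partial\bar q'},\qquad S'=\mathscr L+(1-\Lambda)\mathscr E .$$ **Theorem.** 1. $\mathbf D$ projects to $\bar{\mathbf D}$, i.e. $d\tau\circ\mathbf D=\bar{\mathbf D}\circ\tau$. 2. One has $(TQ)/\mathbf D\cong T\bar Q\times\mathbb R\ni(\bar q,\bar q',S)$: the map $\pi:TQ\to T\bar Q\times\mathbb R$, $$\pi(q,\dot q)=\Big(p(q),\ \rho^{1-\Lambda}\,dp_q(\dot q),\ S\Big),\qquad \pi^*S=-\frac{i_{\mathbf D}\lambda_L}{\rho},$$ is a smooth surjective submersion whose fibres are the orbits of $\mathbf D$, with tangent spaces spanned by $\mathbf D$. 3. There is a smooth function $\mathscr L:T\bar Q\times\mathbb R\to\mathbb R$ with $$\pi^*\mathscr L=-\frac{L+\dot\rho\,S}{\rho^\Lambda},$$ and extremals of $L$ project to extremals of the $\Lambda$-Herglotz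 system $\mathscr L$ after the change of parameter $\rho^{1-\Lambda}d\tau=dt$. That is, let $q$ be an extremal of $L$ on $[a,b]$, $a<b$. Then there is a change of parameter $t=\varphi(\tau)$ from some $[c,d]$ onto $[a,b]$ with $\varphi'=\rho(q(\varphi))^{1-\Lambda}$, and for each such $\varphi$ the curve $\tau\mapsto\pi(q(\varphi(\tau)),\dot q(\varphi(\tau)))$ has the form $(\bar q,\frac{d\bar q}{d\tau},S)$ with $(\bar q,S)$ an extremal of the $\Lambda$-Herglotz system $\mathscr L$. If $\Lambda=1$, then $(\bar q,S)$ is also an extremal of $\mathscr L$ in the classical sense of Herglotz: $S'=\mathscr L$, and $\int_c^d\mathscr L\,d\tau$ is stationary among solutions of $S'=\mathscr L(\bar q,\bar q',S)$ with fixed endpoints of $\bar q$ and fixed initial value of $S$. -/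

import Mathlib

open Set Filter Topology
open scoped Manifold ContDiff

noncomputable section

namespace ScaleReduction

/-! ### Generalities on manifolds -/

section General

variable {E : Type*} [NormedAddCommGroup E] [NormedSpace ℝ E]
  {H : Type*} [TopologicalSpace H] (I : ModelWithCorners ℝ E H)
  {M : Type*} [TopologicalSpace M] [ChartedSpace H M]
  {E' : Type*} [NormedAddCommGroup E'] [NormedSpace ℝ E']
  {H' : Type*} [TopologicalSpace H'] (I' : ModelWithCorners ℝ E' H')
  {N : Type*} [TopologicalSpace N] [ChartedSpace H' N]

/-- The derivative `df_x(v)` of a real function `f` at `x` in the direction `v`. -/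
def dirDeriv (f : M → ℝ) (x : M) (v : TangentSpace I x) : ℝ :=
  mfderiv I 𝓘(ℝ, ℝ) f x v

/-- `x` and `y` lie on a common integral curve (defined on some open interval) of the
vector field `X`. -/
def SameOrbit (X : ∀ x : M, TangentSpace I x) (x y : M) : Prop :=
  ∃ (γ : ℝ → M) (s : Set ℝ), IsOpen s ∧ IsPreconnected s ∧ IsMIntegralCurveOn γ X s ∧
    (∃ t ∈ s, γ t = x) ∧ (∃ t ∈ s, γ t = y)

/-- `π : M → N` exhibits the manifold `N` as the quotient manifold `M / X` of `M` by the orbits of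
the vector field `X`: it is a smooth surjective submersion whose fibres are the orbits of `X`,
the tangent spaces of the fibres being spanned by `X`. -/
structure IsOrbitQuotient (X : ∀ x : M, TangentSpace I x) (π : M → N) : Prop where
  smooth : ContMDiff I I' ∞ π
  surjective : Function.Surjective π
  submersion : ∀ x, Function.Surjective (mfderiv I I' π x)
  ker_eq : ∀ (x : M) (v : TangentSpace I x), mfderiv I I' π x v = 0 ↔ ∃ c : ℝ, v = c • X x
  fibre_eq : ∀ x y, π x = π y ↔ SameOrbit I X x y

variable [IsManifold I ∞ M]

/-- `L_X α = β` for one-forms `α`, `β` and a vector field `X`, where the Lie derivative is given by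
`(L_X α)(Y) = X(α(Y)) - α([X, Y])` for all (local) smooth vector fields `Y`. -/
def LieDerivOneFormEq (X : ∀ x : M, TangentSpace I x)
    (α β : ∀ x : M, TangentSpace I x →L[ℝ] ℝ) : Prop :=
  ∀ (x : M) (Y : ∀ x : M, TangentSpace I x),
    ContMDiffAt I I.tangent ∞ (fun y => (⟨y, Y y⟩ : TangentBundle I M)) x →
      dirDeriv I (fun y => α y (Y y)) x (X x) - α x (VectorField.mlieBracket I X Y x) = β x (Y x)

end General

/-! ### Legendre transforms on a vector space -/

section Legendre

variable {V : Type*} [NormedAddCommGroup V] [NormedSpace ℝ V]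

/-- The Legendre transform `v ↦ df_v`, `V → V*`, of `f : V → ℝ` is a smooth diffeomorphism. -/
def HasLegendreDiffeo (f : V → ℝ) : Prop :=
  ContDiff ℝ ∞ (fderiv ℝ f) ∧ ∃ g : (V →L[ℝ] ℝ) → V, ContDiff ℝ ∞ g ∧
    Function.LeftInverse g (fderiv ℝ f) ∧ Function.RightInverse g (fderiv ℝ f)

/-- The Legendre dual `α ↦ α(v) - f(v)`, where `v` is determined by `df_v = α`
(used when the Legendre transform is a bijection). -/
def legendreDual (f : V → ℝ) (α : V →L[ℝ] ℝ) : ℝ :=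
  α (Function.invFun (fderiv ℝ f) α) - f (Function.invFun (fderiv ℝ f) α)

end Legendre

/-! ### Lagrangian systems -/

section Lagrangian

variable {E : Type*} [NormedAddCommGroup E] [NormedSpace ℝ E]
  {Q : Type*} [TopologicalSpace Q] [ChartedSpace E Q]

/-- The restriction of `L : TQ → ℝ` to the tangent space at `q`. -/
def fibreLagrangian (L : TangentBundle 𝓘(ℝ, E) Q → ℝ) (q : Q) : E → ℝ :=
  fun v => L ⟨q, v⟩

/-- The fibre derivative `∂L/∂q̇` at `x ∈ TQ`, a covector at the base point of `x`. -/
def fibreDeriv (L : TangentBundle 𝓘(ℝ, E) Q → ℝ) (x : TangentBundle 𝓘(ℝ, E) Q) :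
    TangentSpace 𝓘(ℝ, E) x.1 →L[ℝ] ℝ :=
  (show E →L[ℝ] ℝ from fderiv ℝ (fibreLagrangian L x.1) x.2)

/-- The energy `∂L/∂q̇ · q̇ - L`, i.e. the Hamiltonian in terms of velocities. -/
def energy (L : TangentBundle 𝓘(ℝ, E) Q → ℝ) (x : TangentBundle 𝓘(ℝ, E) Q) : ℝ :=
  fibreDeriv L x x.2 - L x

variable [IsManifold 𝓘(ℝ, E) ∞ Q]

/-- The differential at `x ∈ TQ` of the bundle projection `TQ → Q`. -/
def projDeriv (x : TangentBundle 𝓘(ℝ, E) Q) :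
    TangentSpace 𝓘(ℝ, E).tangent x →L[ℝ] TangentSpace 𝓘(ℝ, E) x.1 :=
  mfderiv 𝓘(ℝ, E).tangent 𝓘(ℝ, E) (fun y : TangentBundle 𝓘(ℝ, E) Q => y.1) x

/-- The Lagrangian one-form `λ_L = ∂L/∂q̇ · dq` on `TQ`. -/
def lagrangeForm (L : TangentBundle 𝓘(ℝ, E) Q → ℝ) (x : TangentBundle 𝓘(ℝ, E) Q) :
    TangentSpace 𝓘(ℝ, E).tangent x →L[ℝ] ℝ :=
  (fibreDeriv L x).comp (projDeriv x)

/-- `D` is a basic scaling symmetry of degree `Λ` of `(Q, L)`: a smooth vector field on `TQ` under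
which the Lagrangian and its energy (Hamiltonian) are homogeneous of degree `Λ` and with
`L_D λ_L = λ_L`. -/
structure IsBasicScalingSymmetry (L : TangentBundle 𝓘(ℝ, E) Q → ℝ) (Λ : ℝ)
    (D : ∀ x : TangentBundle 𝓘(ℝ, E) Q, TangentSpace 𝓘(ℝ, E).tangent x) : Prop where
  smooth : ContMDiff 𝓘(ℝ, E).tangent 𝓘(ℝ, E).tangent.tangent ∞
    (fun x => (⟨x, D x⟩ :
      TangentBundle 𝓘(ℝ, E).tangent (TangentBundle 𝓘(ℝ, E) Q)))
  lagrangian : ∀ x, dirDeriv 𝓘(ℝ, E).tangent L x (D x) = Λ * L x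
  energy : ∀ x, dirDeriv 𝓘(ℝ, E).tangent (energy L) x (D x) = Λ * energy L x
  form : LieDerivOneFormEq 𝓘(ℝ, E).tangent D (lagrangeForm L) (lagrangeForm L)

/-- The vector field on `Q` obtained by projecting the values of `D` along the zero section. -/
def baseField (D : ∀ x : TangentBundle 𝓘(ℝ, E) Q, TangentSpace 𝓘(ℝ, E).tangent x) (q : Q) :
    TangentSpace 𝓘(ℝ, E) q :=
  projDeriv (⟨q, 0⟩ : TangentBundle 𝓘(ℝ, E) Q) (D ⟨q, 0⟩)

end Lagrangian

/-! ### Variational principles -/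

section Variational

variable {E : Type*} [NormedAddCommGroup E] [NormedSpace ℝ E]
  {Q : Type*} [TopologicalSpace Q] [ChartedSpace E Q]

/-- The curve `t ↦ (q(t), q̇(t))` in `TQ`. -/
def velocity (q : ℝ → Q) (t : ℝ) : TangentBundle 𝓘(ℝ, E) Q :=
  ⟨q t, mfderiv 𝓘(ℝ, ℝ) 𝓘(ℝ, E) q t (1 : ℝ)⟩

/-- The variation field `∂Γ/∂ε (0, t)` of a family of curves `Γ ε t`. -/
def variationField (Γ : ℝ → ℝ → Q) (t : ℝ) : TangentSpace 𝓘(ℝ, E) (Γ 0 t) :=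
  mfderiv 𝓘(ℝ, ℝ) 𝓘(ℝ, E) (fun ε => Γ ε t) 0 (1 : ℝ)

variable (E)

/-- `q` is smooth at all points of `[a, b]`. -/
def SmoothCurve (q : ℝ → Q) (a b : ℝ) : Prop :=
  ∀ t ∈ Icc a b, ContMDiffAt 𝓘(ℝ, ℝ) 𝓘(ℝ, E) ∞ q t

/-- `Γ` is a smooth variation of the curve `q` on `[a, b]`. -/
def IsVariation (q : ℝ → Q) (a b : ℝ) (Γ : ℝ → ℝ → Q) : Prop :=
  (∀ t ∈ Icc a b, ContMDiffAt 𝓘(ℝ, ℝ × ℝ) 𝓘(ℝ, E) ∞ (Function.uncurry Γ) (0, t)) ∧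
    ∀ t ∈ Icc a b, Γ 0 t = q t

/-- The variation `Γ` of `q` keeps the endpoints fixed. -/
def FixesEndpoints (q : ℝ → Q) (a b : ℝ) (Γ : ℝ → ℝ → Q) : Prop :=
  ∀ᶠ ε in 𝓝 (0 : ℝ), Γ ε a = q a ∧ Γ ε b = q b

variable {E}

/-- The smooth curve `q` on `[a, b]` is an extremal of the action `∫ L(q, q̇) dt` among curves with
the same endpoints. -/
def IsExtremal (L : TangentBundle 𝓘(ℝ, E) Q → ℝ) (q : ℝ → Q) (a b : ℝ) : Prop :=
  SmoothCurve E q a b ∧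
    ∀ Γ : ℝ → ℝ → Q, IsVariation E q a b Γ → FixesEndpoints q a b Γ →
      HasDerivAt (fun ε => ∫ t in a..b, L (velocity (Γ ε) t)) 0 0

/-- The Herglotz action `∫ ℒ(q, q', S) dτ` over `[a, b]`. -/
def herglotzAction (ℒ : TangentBundle 𝓘(ℝ, E) Q × ℝ → ℝ) (q : ℝ → Q) (S : ℝ → ℝ) (a b : ℝ) : ℝ :=
  ∫ τ in a..b, ℒ (velocity q τ, S τ)

/-- The function `ℒ + (1 - Λ) ℰ` on `TQ × ℝ`, where `ℰ = ∂ℒ/∂q' · q' - ℒ`. -/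
def actionRate (ℒ : TangentBundle 𝓘(ℝ, E) Q × ℝ → ℝ) (Λ : ℝ)
    (z : TangentBundle 𝓘(ℝ, E) Q × ℝ) : ℝ :=
  ℒ z + (1 - Λ) * energy (fun x => ℒ (x, z.2)) z.1

/-- `(q, S)` is an extremal on `[a, b]` of the `Λ`-Herglotz system `ℒ`: it is smooth, satisfies
`S' = ℒ + (1 - Λ) ℰ`, and the action `∫ ℒ(q, q', S) dτ` is stationary under all variations of
`(q, S)` which fix the endpoints of `q` and whose variation field `(δq, δS)` is annihilated by the
contact form `dS - ∂ℒ/∂q' · dq`, i.e. `δS = ∂ℒ/∂q' · δq`.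

Equivalently, in coordinates,
`d/dτ (∂ℒ/∂q') = ∂ℒ/∂q + ∂ℒ/∂S ∂ℒ/∂q'` and `S' = ℒ + (1 - Λ) ℰ`. -/
def IsLambdaHerglotzExtremal (ℒ : TangentBundle 𝓘(ℝ, E) Q × ℝ → ℝ) (Λ : ℝ) (q : ℝ → Q) (S : ℝ → ℝ)
    (a b : ℝ) : Prop :=
  SmoothCurve E q a b ∧ SmoothCurve ℝ S a b ∧
  (∀ τ ∈ Icc a b, HasDerivAt S (actionRate ℒ Λ (velocity q τ, S τ)) τ) ∧
  ∀ (Γ : ℝ → ℝ → Q) (T : ℝ → ℝ → ℝ), IsVariation E q a b Γ → IsVariation ℝ S a b T →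
    FixesEndpoints q a b Γ →
    (∀ τ ∈ Icc a b, HasDerivAt (fun ε => T ε τ)
      (fibreDeriv (fun x => ℒ (x, T 0 τ)) (velocity (Γ 0) τ) (variationField Γ τ)) 0) →
    HasDerivAt (fun ε => herglotzAction ℒ (Γ ε) (T ε) a b) 0 0

/-- `(q, S)` is an extremal on `[a, b]` of the (classical) Herglotz Lagrangian system `ℒ`: it is
smooth, `S' = ℒ(q, q', S)`, and the action `∫ ℒ(q, q', S) dτ` is stationary among the solutions of
`S' = ℒ(q, q', S)` with the same endpoints of `q` and the same initial value of `S`. -/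
def IsHerglotzExtremal (ℒ : TangentBundle 𝓘(ℝ, E) Q × ℝ → ℝ) (q : ℝ → Q) (S : ℝ → ℝ)
    (a b : ℝ) : Prop :=
  SmoothCurve E q a b ∧ SmoothCurve ℝ S a b ∧
  (∀ τ ∈ Icc a b, HasDerivAt S (ℒ (velocity q τ, S τ)) τ) ∧
  ∀ (Γ : ℝ → ℝ → Q) (T : ℝ → ℝ → ℝ), IsVariation E q a b Γ → IsVariation ℝ S a b T →
    FixesEndpoints q a b Γ →
    (∀ᶠ ε in 𝓝 (0 : ℝ), T ε a = S a ∧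
      ∀ τ ∈ Icc a b, HasDerivAt (T ε) (ℒ (velocity (Γ ε) τ, T ε τ)) τ) →
    HasDerivAt (fun ε => herglotzAction ℒ (Γ ε) (T ε) a b) 0 0

end Variational

/-! ### Scale reduction of a Lagrangian system -/

section Reduction

variable {E : Type*} [NormedAddCommGroup E] [NormedSpace ℝ E]
  {F : Type*} [NormedAddCommGroup F] [NormedSpace ℝ F]
  {Q : Type*} [TopologicalSpace Q] [ChartedSpace E Q]
  {B : Type*} [TopologicalSpace B] [ChartedSpace F B]

/-- The covector `- ρ P∘dp - S dρ` at `q`; the cotangent reduction `T*Q → T*B × ℝ` sends it to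
`(P, S)`. -/
def liftCovector (ρ : Q → ℝ) (p : Q → B) (q : Q) (S : ℝ) (P : F →L[ℝ] ℝ) : E →L[ℝ] ℝ :=
  -(ρ q • P.comp (show E →L[ℝ] F from mfderiv 𝓘(ℝ, E) 𝓘(ℝ, F) p q)) -
    S • (show E →L[ℝ] ℝ from mfderiv 𝓘(ℝ, E) 𝓘(ℝ, ℝ) ρ q)

/-- The reduced contact Hamiltonian `ℋ(q̄, P, S)`, for `q̄ = p(q)` and `P ∈ T*_q̄ B`, defined by
`π*ℋ = - H / ρ^Λ`, where `H : T*Q → ℝ` is the Hamiltonian of `L` and `π : T*Q → T*B × ℝ` is the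
cotangent reduction. -/
def reducedHamiltonian (L : TangentBundle 𝓘(ℝ, E) Q → ℝ) (Λ : ℝ) (ρ : Q → ℝ) (p : Q → B)
    (q : Q) (S : ℝ) (P : F →L[ℝ] ℝ) : ℝ :=
  -(legendreDual (fibreLagrangian L q) (liftCovector ρ p q S P)) / ρ q ^ Λ

/-- `ρ̇` as a function on `TQ`. -/
def rhoDot (ρ : Q → ℝ) (x : TangentBundle 𝓘(ℝ, E) Q) : ℝ :=
  dirDeriv 𝓘(ℝ, E) ρ x.1 x.2

/-- `φ` is the change of parameter `t = φ(τ)`, from `[c, d]` onto `[a, b]`, defined by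
`dt = ρ^(1 - Λ) dτ` along the curve `q`. -/
def IsScaleTime (Λ : ℝ) (ρ : Q → ℝ) (q : ℝ → Q) (a b c d : ℝ) (φ : ℝ → ℝ) : Prop :=
  (∀ τ ∈ Icc c d, ContDiffAt ℝ ∞ φ τ ∧ HasDerivAt φ (ρ (q (φ τ)) ^ (1 - Λ)) τ) ∧
    φ '' Icc c d = Icc a b

variable [IsManifold 𝓘(ℝ, E) ∞ Q]

/-- The function `S = - (i_D λ_L) / ρ` on `TQ`. -/
def scaleAction (L : TangentBundle 𝓘(ℝ, E) Q → ℝ)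
    (D : ∀ x : TangentBundle 𝓘(ℝ, E) Q, TangentSpace 𝓘(ℝ, E).tangent x) (ρ : Q → ℝ)
    (x : TangentBundle 𝓘(ℝ, E) Q) : ℝ :=
  - lagrangeForm L x (D x) / ρ x.1

/-- The map `TQ → TB × ℝ`, `(q, q̇) ↦ (q̄, q̄', S)`, where `q̄ = p(q)`, `S = - (i_D λ_L) / ρ`, and
`q̄'` is the velocity of `q̄` with respect to the parameter `τ` with `ρ^(1 - Λ) dτ = dt`. -/
def scaleProj (L : TangentBundle 𝓘(ℝ, E) Q → ℝ) (Λ : ℝ)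
    (D : ∀ x : TangentBundle 𝓘(ℝ, E) Q, TangentSpace 𝓘(ℝ, E).tangent x) (ρ : Q → ℝ) (p : Q → B)
    (x : TangentBundle 𝓘(ℝ, E) Q) : TangentBundle 𝓘(ℝ, F) B × ℝ :=
  (⟨p x.1, ρ x.1 ^ (1 - Λ) • mfderiv 𝓘(ℝ, E) 𝓘(ℝ, F) p x.1 x.2⟩, scaleAction L D ρ x)

end Reduction

end ScaleReduction

end

/-! Call a function on `TQ` of degree k if `D` multiplies it by k. In a chart `(u, v)` of `TQ`, the
equation `L_D λ_L = λ_L` in vertical directions says that momentum annihilates the `v`-derivative of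
the base component of `D`. Seen as a function of momentum, that component is then homogeneous of
degree zero and smooth at the origin, hence constant (`HasLegendreDiffeo.eq_const`): `D` projects to
a field A on `Q`. Together with `D(E_L) = Λ E_L`, nondegeneracy forces the velocity component to be
`(Λ - 1) v + dA(v)` (`velocity_component`). So `dp(v)` has degree Λ - 1, `ρ̇` has degree Λ, and `S`
has degree 0, which makes π and `-(L + ρ̇ S) / ρ^Λ` invariant.

On one fibre, every covector is `-ρ P∘dp - S dρ` for a unique pair `(P, S)`. The `P`-derivative of
the reduced Hamiltonian is the reduced velocity `ρ^(1-Λ) dp(v)`. Its Legendre transform being a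
diffeomorphism for each fixed `S`, the map π is a bijection from the fibre to the pairs `(q̄', S)`,
with injective differential (`fibre_reduction_bijective`, `fibre_reduction_fderiv_injective`). Hence
the kernel of dπ is spanned by `D`. An orbit of A lifts uniquely to a curve on which π is constant,
and that curve is an orbit of `D` (`sameOrbit_of_scaleProj_eq`). The pair `(p, ρ)` is injective and
a local diffeomorphism, so `ρ` serves as coordinate along the orbits and ℒ is smooth.

For the dynamics, write `L = -ρ^Λ ℒ(q̄, ρ^(1-Λ) dq̄/dt, S) - ρ̇ S`. Moving `v` along A shows `∂ℒ/∂S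
= -ρ̇ / ρ^Λ` (`hasDerivAt_reducedLagrangian_snd`). Thus `L` is stationary in `S`, and in a first
variation `S` may be frozen while `q̄` and `ρ` are varied independently
(`integral_deriv_reduced_eq_zero`). Varying `ρ` gives `S' = ℒ + (1 - Λ) ℰ` in the new time
(`deriv_action`). Varying `q̄` by `k δq̄` gives `∫ ρ (k δℒ + k' ∂ℒ/∂q̄'·δq̄) dτ = 0`, where δℒ is
the variation of ℒ at fixed `S` (`integral_partialLag_eq_zero`). In the new time `ρ' = -ρ ∂ℒ/∂S`.
Therefore `k = 1/ρ` yields stationarity under contact variations. The choice `k = 1` yields the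
classical Herglotz principle for Λ = 1, with `ρ` as integrating factor of the linearised equation
for δS. -/

set_option linter.unusedSectionVars false

noncomputable section

namespace ScaleReduction

/-! ### Tangent maps, local inverses and locally constant curves on manifolds. -/

section Manifolds

variable {E : Type*} [NormedAddCommGroup E] [NormedSpace ℝ E]
  {H : Type*} [TopologicalSpace H] {I : ModelWithCorners ℝ E H}
  {M : Type*} [TopologicalSpace M] [ChartedSpace H M]
  {E' : Type*} [NormedAddCommGroup E'] [NormedSpace ℝ E']
  {H' : Type*} [TopologicalSpace H'] {I' : ModelWithCorners ℝ E' H'}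
  {N : Type*} [TopologicalSpace N] [ChartedSpace H' N]
  {V : Type*} [NormedAddCommGroup V] [NormedSpace ℝ V]

/-- Smoothness of infinite order at a point gives, for each finite order, only a neighbourhood
depending on that order. So orders are treated one at a time: C^(n+1) at the point holds on a
neighbourhood, where the tangent map is then C^n. -/
theorem contMDiffAt_tangentMap [IsManifold I ∞ M] [IsManifold I' ∞ N] {f : M → N}
    {x : TangentBundle I M} (hf : ContMDiffAt I I' ∞ f x.1) :
    ContMDiffAt I.tangent I'.tangent ∞ (tangentMap I I' f) x := by
  have : IsManifold I 1 M := IsManifold.of_le (n := ∞) (by simp)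
  have : IsManifold I' 1 N := IsManifold.of_le (n := ∞) (by simp)
  rw [contMDiffAt_infty]
  intro n
  have : IsManifold I (n + 1 : ℕ) M := IsManifold.of_le (n := ∞) (by exact_mod_cast le_top)
  have : IsManifold I' (n + 1 : ℕ) N := IsManifold.of_le (n := ∞) (by exact_mod_cast le_top)
  have h1 : ContMDiffAt I I' ((n + 1 : ℕ) : ℕ∞) f x.1 := hf.of_le (by exact_mod_cast le_top)
  obtain ⟨u, hu, hfu⟩ := (contMDiffAt_iff_contMDiffOn_nhds (by simp)).1 h1
  obtain ⟨w, hwu, hwo, hxw⟩ := mem_nhds_iff.1 hu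
  have h2 := (hfu.mono hwu).contMDiffOn_tangentMapWithin (m := n) (by norm_cast) hwo.uniqueMDiffOn
  have hopen : IsOpen (Bundle.TotalSpace.proj ⁻¹' w : Set (TangentBundle I M)) :=
    hwo.preimage (FiberBundle.continuous_proj E _)
  have h3 := (h2 x hxw).contMDiffAt (hopen.mem_nhds hxw)
  refine h3.congr_of_eventuallyEq ?_
  filter_upwards [hopen.mem_nhds hxw] with y hy
  exact (tangentMapWithin_eq_tangentMap (hwo.uniqueMDiffOn _ hy)
    (((hfu.mono hwu) y.1 hy).contMDiffAt (hwo.mem_nhds hy)|>.mdifferentiableAt (by simp))).symm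

/-- The joint smoothness of `(z, w) ↦ dG_z(w)` for a map `G` on a vector space. -/
theorem contMDiffAt_pushforward [IsManifold I ∞ M] {G : V → M} {z w : V}
    (hG : ContMDiffAt 𝓘(ℝ, V) I ∞ G z) :
    ContMDiffAt 𝓘(ℝ, V × V) I.tangent ∞
      (fun y : V × V => (⟨G y.1, mfderiv 𝓘(ℝ, V) I G y.1 y.2⟩ : TangentBundle I M)) (z, w) := by
  have h1 : ContMDiffAt 𝓘(ℝ, V).tangent I.tangent ∞ (tangentMap 𝓘(ℝ, V) I G) ⟨z, w⟩ :=
    contMDiffAt_tangentMap hG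
  have h2 : ContMDiff 𝓘(ℝ, V × V) 𝓘(ℝ, V).tangent ∞
      (fun y : V × V => (⟨y.1, y.2⟩ : TangentBundle 𝓘(ℝ, V) V)) := by
    have := contMDiff_tangentBundleModelSpaceHomeomorph_symm (I := 𝓘(ℝ, V)) (n := ∞)
    rw [modelWithCornersSelf_prod]
    exact this
  exact h1.comp (z, w) h2.contMDiffAt

/-- Inverse function theorem. -/
theorem exists_local_inverse [CompleteSpace E] [I.Boundaryless] [I'.Boundaryless]
    [IsManifold I ∞ M] [IsManifold I' ∞ N] [FiniteDimensional ℝ E] {f : M → N} {x : M}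
    (hf : ContMDiffAt I I' ∞ f x) (hbij : Function.Bijective (mfderiv I I' f x)) :
    ∃ g : N → M, ContMDiffAt I' I ∞ g (f x) ∧ g (f x) = x ∧
      (∀ᶠ y in 𝓝 (f x), f (g y) = y) ∧ ∀ᶠ x' in 𝓝 x, g (f x') = x' := by
  set F := writtenInExtChartAt I I' x f with hF
  have hFs : ContDiffAt ℝ ∞ F (extChartAt I x x) := by
    have := (contMDiffAt_iff.1 hf).2
    rwa [I.range_eq_univ, contDiffWithinAt_univ] at this
  have hd : mfderiv I I' f x = fderiv ℝ F (extChartAt I x x) := by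
    refine (hf.mdifferentiableAt (by simp)).mfderiv.trans ?_
    rw [I.range_eq_univ, fderivWithin_univ]
  have hlin : Function.Bijective (fderiv ℝ F (extChartAt I x x)) := by
    rw [← hd]; exact hbij
  let e : E ≃L[ℝ] E' := LinearEquiv.toContinuousLinearEquiv
    (LinearEquiv.ofBijective (fderiv ℝ F (extChartAt I x x)).toLinearMap hlin)
  have he : HasFDerivAt F (e : E →L[ℝ] E') (extChartAt I x x) := by
    have : (e : E →L[ℝ] E') = fderiv ℝ F (extChartAt I x x) := by ext v; rfl
    rw [this]
    exact (hFs.differentiableAt (by simp)).hasFDerivAt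
  have hFx : F (extChartAt I x x) = extChartAt I' (f x) (f x) := by
    simp [hF, writtenInExtChartAt]
  let Φ := hFs.toOpenPartialHomeomorph F he (by simp)
  have hΦsrc : extChartAt I x x ∈ Φ.source := hFs.mem_toOpenPartialHomeomorph_source he (by simp)
  have hΦc : (Φ : E → E') = F := hFs.toOpenPartialHomeomorph_coe he (by simp)
  have hloc : ContDiffAt ℝ ∞ Φ.symm (F (extChartAt I x x)) := hFs.to_localInverse he (by simp)
  have hΦx : Φ.symm (F (extChartAt I x x)) = extChartAt I x x := by
    rw [← hΦc]; exact Φ.left_inv hΦsrc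
  refine ⟨fun y => (extChartAt I x).symm (Φ.symm (extChartAt I' (f x) y)), ?_, ?_, ?_, ?_⟩
  · have h1 : ContMDiffAt I' 𝓘(ℝ, E') ∞ (extChartAt I' (f x)) (f x) := contMDiffAt_extChartAt
    have h2 : ContMDiffAt 𝓘(ℝ, E) I ∞ (extChartAt I x).symm (extChartAt I x x) :=
      (contMDiffOn_extChartAt_symm x).contMDiffAt (extChartAt_target_mem_nhds x)
    have h3 : ContMDiffAt 𝓘(ℝ, E') 𝓘(ℝ, E) ∞ Φ.symm (extChartAt I' (f x) (f x)) := by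
      rw [← hFx]; exact hloc.contMDiffAt
    refine ContMDiffAt.comp (f x) (g := (extChartAt I x).symm) ?_ (h3.comp (f x) h1)
    rw [← hFx, hΦx]
    exact h2
  · simp only [← hFx, hΦx, extChartAt_to_inv]
  · have c1 : ContinuousAt (extChartAt I' (f x)) (f x) := continuousAt_extChartAt _
    have c2 : ContinuousAt Φ.symm (extChartAt I' (f x) (f x)) := by
      rw [← hFx]; exact hloc.continuousAt
    have c3 : ContinuousAt (fun y => Φ.symm (extChartAt I' (f x) y)) (f x) :=
      ContinuousAt.comp (g := Φ.symm) c2 c1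
    have c4 : ContinuousAt (fun y => (extChartAt I x).symm (Φ.symm (extChartAt I' (f x) y))) (f x) := by
      refine ContinuousAt.comp (g := (extChartAt I x).symm) ?_ c3
      rw [← hFx, hΦx]
      exact continuousAt_extChartAt_symm x
    have c5 : ContinuousAt (fun y => f ((extChartAt I x).symm (Φ.symm (extChartAt I' (f x) y))))
        (f x) := by
      refine ContinuousAt.comp (g := f) ?_ c4
      rw [← hFx, hΦx, extChartAt_to_inv]
      exact hf.continuousAt
    have e5 : f ((extChartAt I x).symm (Φ.symm (extChartAt I' (f x) (f x)))) = f x := by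
      rw [← hFx, hΦx, extChartAt_to_inv]
    have t1 : ∀ᶠ y in 𝓝 (f x), extChartAt I' (f x) y ∈ Φ.target := by
      refine c1.eventually_mem (Φ.open_target.mem_nhds ?_)
      rw [← hFx, ← hΦc]; exact Φ.map_source hΦsrc
    have t2 := c5.eventually_mem (by rw [e5]; exact extChartAt_source_mem_nhds (I := I') (f x))
    filter_upwards [t1, t2, extChartAt_source_mem_nhds (I := I') (f x)] with y h1 h2 h3
    have h4 : F (Φ.symm (extChartAt I' (f x) y)) = extChartAt I' (f x) y := by
      rw [← hΦc]; exact Φ.right_inv h1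
    exact (extChartAt I' (f x)).injOn h2 h3 h4
  · have c1 : ContinuousAt (extChartAt I x) x := continuousAt_extChartAt _
    filter_upwards [c1.eventually_mem (Φ.open_source.mem_nhds hΦsrc),
      extChartAt_source_mem_nhds (I := I) x] with y h1 h2
    have h3 := Φ.left_inv h1
    rw [hΦc, hF] at h3
    simp only [writtenInExtChartAt, Function.comp_apply, (extChartAt I x).left_inv h2] at h3
    simp only [h3, (extChartAt I x).left_inv h2]

/-- A curve whose derivative vanishes on an open preconnected set is constant there. -/
theorem eq_of_mfderiv_zero {γ : ℝ → M} {s : Set ℝ} (hs : IsOpen s) (hc : IsPreconnected s)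
    (h : ∀ t ∈ s, HasMFDerivAt 𝓘(ℝ, ℝ) I γ t 0) {t₁ t₂ : ℝ} (h₁ : t₁ ∈ s) (h₂ : t₂ ∈ s) 
    [I.Boundaryless] [IsManifold I ∞ M] :
    γ t₁ = γ t₂ := by
  have : IsManifold I 1 M := IsManifold.of_le (n := ∞) (by simp)
  have hloc : ∀ t ∈ s, ∀ᶠ t' in 𝓝 t, γ t' = γ t := by
    intro t ht
    have hcont : ContinuousAt γ t := (h t ht).continuousAt
    have hev := hcont.eventually_mem (extChartAt_source_mem_nhds (I := I) (γ t))
    obtain ⟨ε, hε, hball⟩ := Metric.eventually_nhds_iff_ball.1 (hev.and (hs.mem_nhds ht))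
    rw [Metric.eventually_nhds_iff_ball]
    refine ⟨ε, hε, fun t' ht' => ?_⟩
    have hd : ∀ u ∈ Metric.ball t ε,
        HasFDerivWithinAt (fun u => extChartAt I (γ t) (γ u)) (0 : ℝ →L[ℝ] E) (Metric.ball t ε) u := by
      intro u hu
      have h1 := h u (hball u hu).2
      have h2 : MDifferentiableAt I 𝓘(ℝ, E) (extChartAt I (γ t)) (γ u) :=
        mdifferentiableAt_extChartAt (by simpa using (hball u hu).1)
      have h3 := h2.hasMFDerivAt.comp u h1
      rw [ContinuousLinearMap.comp_zero] at h3
      exact h3.hasFDerivAt.hasFDerivWithinAt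
    have := (convex_ball t ε).is_const_of_fderivWithin_eq_zero (𝕜 := ℝ)
      (fun u hu => (hd u hu).differentiableWithinAt)
      (fun u hu => (hd u hu).fderivWithin (Metric.isOpen_ball.uniqueDiffWithinAt hu))
      ht' (Metric.mem_ball_self hε)
    exact (extChartAt I (γ t)).injOn (hball t' ht').1 (hball t (Metric.mem_ball_self hε)).1 this
  -- By local constancy, the sets where `γ` equals and differs from `γ t₂` are both open; a
  -- preconnected `s` cannot meet both.
  by_contra hne
  have ho1 : IsOpen {t | t ∈ s ∧ γ t = γ t₂} := by
    rw [isOpen_iff_mem_nhds]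
    rintro t ⟨ht, hte⟩
    filter_upwards [hloc t ht, hs.mem_nhds ht] with u hu hus
    exact ⟨hus, hu.trans hte⟩
  have ho2 : IsOpen {t | t ∈ s ∧ γ t ≠ γ t₂} := by
    rw [isOpen_iff_mem_nhds]
    rintro t ⟨ht, hte⟩
    filter_upwards [hloc t ht, hs.mem_nhds ht] with u hu hus
    exact ⟨hus, by rwa [hu]⟩
  obtain ⟨t, -, h3, h4⟩ := hc _ _ ho1 ho2 (fun t ht => by
    by_cases h : γ t = γ t₂
    exacts [Or.inl ⟨ht, h⟩, Or.inr ⟨ht, h⟩]) ⟨t₂, h₂, h₂, rfl⟩ ⟨t₁, h₁, h₁, hne⟩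
  exact h4.2 h3.2

end Manifolds

/-! ### Vector fields and the equation `L_X α = β` in a chart. -/

section FieldsInCharts

variable {E : Type*} [NormedAddCommGroup E] [NormedSpace ℝ E]
  {H : Type*} [TopologicalSpace H] {I : ModelWithCorners ℝ E H}
  {M : Type*} [TopologicalSpace M] [ChartedSpace H M] [I.Boundaryless]
  {W : Type*} [NormedAddCommGroup W] [NormedSpace ℝ W]

theorem mfderiv_eq_fderiv_comp_symm {f : M → W} {x : M} (hf : MDifferentiableAt I 𝓘(ℝ, W) f x)
    (v : E) :
    mfderiv I 𝓘(ℝ, W) f x v = fderiv ℝ (f ∘ (extChartAt I x).symm) (extChartAt I x x) v := by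
  have h := hf.mfderiv
  rw [I.range_eq_univ, fderivWithin_univ] at h
  exact DFunLike.congr_fun h v

/-- The vector field `X` in the chart at `x`. -/
def chartField (X : ∀ y : M, TangentSpace I y) (x : M) (z : E) : E :=
  mfderiv I 𝓘(ℝ, E) (extChartAt I x) ((extChartAt I x).symm z) (X ((extChartAt I x).symm z))

/-- The vector field with constant value `c` in the chart at `x`. -/
def constField (I : ModelWithCorners ℝ E H) (x : M) (c : E) (y : M) : TangentSpace I y :=
  (mfderiv I 𝓘(ℝ, E) (extChartAt I x) y).inverse c

variable [IsManifold I ∞ M]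

theorem mfderiv_extChartAt_self_apply (x : M) (v : E) :
    mfderiv I 𝓘(ℝ, E) (extChartAt I x) x v = v := by
  have : IsManifold I 1 M := IsManifold.of_le (n := ∞) (by simp)
  exact DFunLike.congr_fun (mfderiv_extChartAt_self (I := I) (x := x)) v

theorem chartField_self (X : ∀ y : M, TangentSpace I y) (x : M) :
    chartField X x (extChartAt I x x) = (show E from X x) := by
  unfold chartField
  rw [extChartAt_to_inv]
  exact mfderiv_extChartAt_self_apply (I := I) (E := E) x (X x)

variable [CompleteSpace E]

theorem mfderiv_constField {x y : M} (hy : y ∈ (extChartAt I x).source) (c : E) :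
    mfderiv I 𝓘(ℝ, E) (extChartAt I x) y (constField I x c y) = c := by
  have : IsManifold I 1 M := IsManifold.of_le (n := ∞) (by simp)
  have h := isInvertible_mfderiv_extChartAt (I := I) hy
  exact h.self_apply_inverse c

theorem constField_self (x : M) (c : E) : constField I x c x = c := by
  exact (mfderiv_extChartAt_self_apply (I := I) x (constField I x c x)).symm.trans
    (mfderiv_constField (mem_extChartAt_source (I := I) x) c)

/-- The differentials of the chart and of its inverse are mutually inverse. This identifies the
concrete chart expression with the pullback field for which smoothness and Lie brackets are known.
-/
theorem chartField_eventuallyEq (X : ∀ y : M, TangentSpace I y) (x : M) :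
    chartField X x =ᶠ[𝓝 (extChartAt I x x)]
      VectorField.mpullbackWithin 𝓘(ℝ, E) I (extChartAt I x).symm X (range I) := by
  have : IsManifold I 1 M := IsManifold.of_le (n := ∞) (by simp)
  filter_upwards [extChartAt_target_mem_nhds (I := I) x] with z hz
  have h1 := isInvertible_mfderivWithin_extChartAt_symm (I := I) hz
  have h2 := mfderiv_extChartAt_comp_mfderivWithin_extChartAt_symm (I := I) hz
  have h3 := h1.self_apply_inverse (X ((extChartAt I x).symm z))
  unfold chartField
  rw [VectorField.mpullbackWithin_apply, ← h3]
  exact (DFunLike.congr_fun h2 _).trans (by rw [h3]; rfl)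

theorem contDiffAt_chartField {X : ∀ y : M, TangentSpace I y} {x : M}
    (hX : ContMDiffAt I I.tangent ∞ (fun y => (⟨y, X y⟩ : TangentBundle I M)) x) :
    ContDiffAt ℝ ∞ (chartField X x) (extChartAt I x x) := by
  have : IsManifold I (∞ + 1) M := ‹IsManifold I ∞ M›
  have h := VectorField.contMDiffWithinAt_mpullbackWithin_extChartAt_symm (n := ∞) (m := ∞)
    (s := univ) (contMDiffWithinAt_univ.2 hX) uniqueMDiffOn_univ (mem_univ x) (by simp)
  have h' := (contMDiffWithinAt_vectorSpace_iff_contDiffWithinAt.1 h).contDiffAt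
    (by simpa using extChartAt_target_mem_nhds (I := I) x)
  exact h'.congr_of_eventuallyEq (chartField_eventuallyEq X x)

theorem contMDiffAt_constField (x : M) (c : E) :
    ContMDiffAt I I.tangent ∞ (fun y => (⟨y, constField I x c y⟩ : TangentBundle I M)) x := by
  have : IsManifold I (∞ + 1) M := ‹IsManifold I ∞ M›
  have h1 : IsManifold I 1 M := IsManifold.of_le (n := ∞) (by simp)
  have hV : ContMDiffAt 𝓘(ℝ, E) 𝓘(ℝ, E).tangent ∞
      (fun z => (⟨z, c⟩ : TangentBundle 𝓘(ℝ, E) E)) (extChartAt I x x) :=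
    contMDiffAt_vectorSpace_iff_contDiffAt.2 contDiffAt_const
  exact hV.mpullback_vectorField_preimage (n := ∞) contMDiffAt_extChartAt
    (isInvertible_mfderiv_extChartAt (mem_extChartAt_source x)) (by simp)

/-- In the chart the bracket is `dc(X) - dX(c)`, and the first term vanishes for constant `c`.
Constant fields are the only test fields needed to extract the components of `L_D λ_L = λ_L`. -/
theorem mlieBracket_constField {X : ∀ y : M, TangentSpace I y} (x : M) (c : E) :
    VectorField.mlieBracket I X (constField I x c) x =
      -(fderiv ℝ (chartField X x) (extChartAt I x x) c : E) := by
  have h1 : IsManifold I 1 M := IsManifold.of_le (n := ∞) (by simp)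
  have h2 : VectorField.mpullbackWithin 𝓘(ℝ, E) I (extChartAt I x).symm (constField I x c) (range I)
      =ᶠ[𝓝 (extChartAt I x x)] fun _ => c := by
    refine (chartField_eventuallyEq (constField I x c) x).symm.trans ?_
    filter_upwards [extChartAt_target_mem_nhds (I := I) x] with z hz
    exact mfderiv_constField ((extChartAt I x).map_target hz) c
  have h3 : ∀ (A C : E → E) (s : Set E), s = univ → A =ᶠ[𝓝 (extChartAt I x x)] chartField X x →
      C =ᶠ[𝓝 (extChartAt I x x)] (fun _ => c) →
      VectorField.lieBracketWithin ℝ A C s (extChartAt I x x) =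
        -(fderiv ℝ (chartField X x) (extChartAt I x x) c) := by
    rintro A C s rfl hA hC
    rw [VectorField.lieBracketWithin_univ, hA.lieBracket_vectorField_eq hC]
    simp [VectorField.lieBracket]
  have h4 := h3 _ _ ((extChartAt I x).symm ⁻¹' univ ∩ range I) (by simp [I.range_eq_univ])
    (chartField_eventuallyEq X x).symm h2
  exact (congrArg (fun w => (mfderiv I 𝓘(ℝ, E) (extChartAt I x) x).inverse w) h4).trans
    (constField_self x _)

/-- The equation `L_X α = β`, evaluated on fields that are constant in the chart. -/
theorem LieDerivOneFormEq.apply_const {X : ∀ y : M, TangentSpace I y}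
    {α β : ∀ y : M, TangentSpace I y →L[ℝ] ℝ} (h : LieDerivOneFormEq I X α β) (x : M) (c : E)
    (hd : MDifferentiableAt I 𝓘(ℝ, ℝ) (fun y => α y (constField I x c y)) x) :
    fderiv ℝ ((fun y => α y (constField I x c y)) ∘ (extChartAt I x).symm) (extChartAt I x x) (X x)
      + α x (fderiv ℝ (chartField X x) (extChartAt I x x) c : E) = β x c := by
  have h1 := h x (constField I x c) (contMDiffAt_constField x c)
  rw [mlieBracket_constField, constField_self] at h1
  have h2 : α x (-(fderiv ℝ (chartField X x) (extChartAt I x x) c : E)) =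
    - α x (fderiv ℝ (chartField X x) (extChartAt I x x) c : E) := (α x).map_neg _
  rw [h2, sub_neg_eq_add] at h1
  rw [← h1]
  exact congrArg (· + _) (mfderiv_eq_fderiv_comp_symm hd (X x)).symm

end FieldsInCharts

/-! ### Charts of `TQ`; fibre derivative, Lagrangian one-form and energy in them. -/

section TangentCharts

variable {E : Type*} [NormedAddCommGroup E] [NormedSpace ℝ E]
  {Q : Type*} [TopologicalSpace Q] [ChartedSpace E Q] [IsManifold 𝓘(ℝ, E) ∞ Q]
  {W : Type*} [NormedAddCommGroup W] [NormedSpace ℝ W]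

theorem contMDiff_fibreInclusion (q : Q) :
    ContMDiff 𝓘(ℝ, E) 𝓘(ℝ, E).tangent ∞ (fun v : E => (⟨q, v⟩ : TangentBundle 𝓘(ℝ, E) Q)) := by
  intro v
  rw [Bundle.contMDiffAt_totalSpace]
  refine ⟨contMDiffAt_const, ?_⟩
  have h := (TangentBundle.continuousLinearMapAt_trivializationAt_eq_core (I := 𝓘(ℝ, E))
    (mem_chart_source E q))
  refine (contMDiffAt_id (x := v)).congr_of_eventuallyEq (Eventually.of_forall fun w => ?_)
  exact (tangentBundleCore 𝓘(ℝ, E) Q).coordChange_self (achart E q) q (mem_chart_source E q) w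

theorem contDiff_fibreLagrangian {L : TangentBundle 𝓘(ℝ, E) Q → ℝ}
    (hL : ContMDiff 𝓘(ℝ, E).tangent 𝓘(ℝ, ℝ) ∞ L) (q : Q) : ContDiff ℝ ∞ (fibreLagrangian L q) :=
  (hL.comp (contMDiff_fibreInclusion q)).contDiff

theorem extChartAt_tangentBundle_apply {x y : TangentBundle 𝓘(ℝ, E) Q}
    (hy : y.1 ∈ (extChartAt 𝓘(ℝ, E) x.1).source) :
    extChartAt 𝓘(ℝ, E).tangent x y =
      Prod.mk (β := E) (extChartAt 𝓘(ℝ, E) x.1 y.1)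
        (mfderiv 𝓘(ℝ, E) 𝓘(ℝ, E) (extChartAt 𝓘(ℝ, E) x.1) y.1 y.2) := by
  rw [extChartAt_source] at hy
  have h := mfderiv_chartAt_eq_tangentCoordChange (I := 𝓘(ℝ, E)) hy
  refine Prod.ext rfl ?_
  exact (DFunLike.congr_fun h y.2).symm

theorem extChartAt_tangentBundle_self (x : TangentBundle 𝓘(ℝ, E) Q) :
    extChartAt 𝓘(ℝ, E).tangent x x = Prod.mk (β := E) (extChartAt 𝓘(ℝ, E) x.1 x.1) x.2 := by
  rw [extChartAt_tangentBundle_apply (mem_extChartAt_source x.1)]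
  exact Prod.ext rfl (mfderiv_extChartAt_self_apply (I := 𝓘(ℝ, E)) (E := E) x.1 x.2)

theorem mem_extChartAt_tangentBundle_source {x y : TangentBundle 𝓘(ℝ, E) Q} :
    y ∈ (extChartAt 𝓘(ℝ, E).tangent x).source ↔ y.1 ∈ (extChartAt 𝓘(ℝ, E) x.1).source := by
  simp

theorem mfderiv_proj (x y : TangentBundle 𝓘(ℝ, E) Q)
    (hy : y.1 ∈ (extChartAt 𝓘(ℝ, E) x.1).source) (w : TangentSpace 𝓘(ℝ, E).tangent y) :
    mfderiv 𝓘(ℝ, E) 𝓘(ℝ, E) (extChartAt 𝓘(ℝ, E) x.1) y.1 (projDeriv y w) =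
      Prod.fst (α := E) (β := E)
        (mfderiv 𝓘(ℝ, E).tangent 𝓘(ℝ, E × E) (extChartAt 𝓘(ℝ, E).tangent x) y w) := by
  have h1 : HasMFDerivAt 𝓘(ℝ, E).tangent 𝓘(ℝ, E) (fun y : TangentBundle 𝓘(ℝ, E) Q => y.1) y
      (projDeriv y) :=
    ((Bundle.contMDiff_proj (TangentSpace 𝓘(ℝ, E)) (n := ∞)).mdifferentiableAt
      (by simp)).hasMFDerivAt
  have h2 : MDifferentiableAt 𝓘(ℝ, E) 𝓘(ℝ, E) (extChartAt 𝓘(ℝ, E) x.1) y.1 :=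
    mdifferentiableAt_extChartAt (by simpa using hy)
  have h3 := h2.hasMFDerivAt.comp y h1
  have h4 : MDifferentiableAt 𝓘(ℝ, E).tangent 𝓘(ℝ, E × E) (extChartAt 𝓘(ℝ, E).tangent x) y :=
    mdifferentiableAt_extChartAt (by simpa using hy)
  have h5 : HasMFDerivAt 𝓘(ℝ, E × E) 𝓘(ℝ, E) (Prod.fst : E × E → E)
      (extChartAt 𝓘(ℝ, E).tangent x y) (ContinuousLinearMap.fst ℝ E E) :=
    (hasFDerivAt_fst (𝕜 := ℝ) (E := E) (F := E)).hasMFDerivAt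
  have h6 := h5.comp y h4.hasMFDerivAt
  have h7 := hasMFDerivAt_unique h3 h6
  exact DFunLike.congr_fun h7 w

/-- The chart centred at `x` has the identity as differential at `x`, so a tangent vector to `TQ` at
`x` is literally a pair (base part, velocity part). -/
theorem projDeriv_apply (x : TangentBundle 𝓘(ℝ, E) Q) (w : TangentSpace 𝓘(ℝ, E).tangent x) :
    projDeriv x w = Prod.fst (α := E) (β := E) w := by
  have h := mfderiv_proj x x (mem_extChartAt_source x.1) w
  refine (mfderiv_extChartAt_self_apply (I := 𝓘(ℝ, E)) (E := E) x.1 (projDeriv x w)).symm.trans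
    (h.trans (congrArg Prod.fst ?_))
  exact mfderiv_extChartAt_self_apply (I := 𝓘(ℝ, E).tangent) (E := E × E) x w

variable {L : TangentBundle 𝓘(ℝ, E) Q → ℝ} (hL : ContMDiff 𝓘(ℝ, E).tangent 𝓘(ℝ, ℝ) ∞ L)
include hL

theorem contDiffAt_comp_extChartAt_symm {x : TangentBundle 𝓘(ℝ, E) Q} {z : E × E}
    (hz : z ∈ (extChartAt 𝓘(ℝ, E).tangent x).target) :
    ContDiffAt ℝ ∞ (L ∘ (extChartAt 𝓘(ℝ, E).tangent x).symm) z := by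
  have h2 : ContMDiffAt 𝓘(ℝ, E × E) 𝓘(ℝ, E).tangent ∞ (extChartAt 𝓘(ℝ, E).tangent x).symm z :=
    (contMDiffOn_extChartAt_symm x).contMDiffAt (extChartAt_target_mem_nhds' hz)
  exact (hL.contMDiffAt.comp z h2).contDiffAt

omit hL in
theorem fibreLagrangian_eq {x : TangentBundle 𝓘(ℝ, E) Q} {q : Q}
    (hq : q ∈ (extChartAt 𝓘(ℝ, E) x.1).source) (v : E) :
    fibreLagrangian L q v = (L ∘ (extChartAt 𝓘(ℝ, E).tangent x).symm)
      (extChartAt 𝓘(ℝ, E) x.1 q, mfderiv 𝓘(ℝ, E) 𝓘(ℝ, E) (extChartAt 𝓘(ℝ, E) x.1) q v) := by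
  have h := extChartAt_tangentBundle_apply (x := x) (y := ⟨q, v⟩) hq
  rw [Function.comp_apply]
  erw [← h]
  rw [(extChartAt 𝓘(ℝ, E).tangent x).left_inv (mem_extChartAt_tangentBundle_source.2 hq)]
  rfl

theorem fibreDeriv_eq {x y : TangentBundle 𝓘(ℝ, E) Q}
    (hy : y.1 ∈ (extChartAt 𝓘(ℝ, E) x.1).source) (η : TangentSpace 𝓘(ℝ, E) y.1) :
    fibreDeriv L y η = fderiv ℝ (L ∘ (extChartAt 𝓘(ℝ, E).tangent x).symm)
      (extChartAt 𝓘(ℝ, E).tangent x y)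
      ((0 : E), (mfderiv 𝓘(ℝ, E) 𝓘(ℝ, E) (extChartAt 𝓘(ℝ, E) x.1) y.1 η : E)) := by
  let d : E →L[ℝ] E := mfderiv 𝓘(ℝ, E) 𝓘(ℝ, E) (extChartAt 𝓘(ℝ, E) x.1) y.1
  have hz : extChartAt 𝓘(ℝ, E).tangent x y ∈ (extChartAt 𝓘(ℝ, E).tangent x).target :=
    (extChartAt 𝓘(ℝ, E).tangent x).map_source (mem_extChartAt_tangentBundle_source.2 hy)
  have h1 := ((contDiffAt_comp_extChartAt_symm hL hz).differentiableAt (by simp)).hasFDerivAt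
  rw [extChartAt_tangentBundle_apply hy] at h1 ⊢
  have h2 : HasFDerivAt (fun v : E => (extChartAt 𝓘(ℝ, E) x.1 y.1, d v))
      ((0 : E →L[ℝ] E).prod d) y.2 := (hasFDerivAt_const _ _).prodMk d.hasFDerivAt
  have h3 := HasFDerivAt.comp (f := fun v : E => (extChartAt 𝓘(ℝ, E) x.1 y.1, d v)) y.2 h1 h2
  have h4 : HasFDerivAt (fibreLagrangian L y.1) _ y.2 :=
    h3.congr_of_eventuallyEq (Eventually.of_forall fun v => fibreLagrangian_eq hy v)
  exact DFunLike.congr_fun h4.fderiv η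

theorem lagrangeForm_eq {x y : TangentBundle 𝓘(ℝ, E) Q}
    (hy : y.1 ∈ (extChartAt 𝓘(ℝ, E) x.1).source) (w : TangentSpace 𝓘(ℝ, E).tangent y) :
    lagrangeForm L y w = fderiv ℝ (L ∘ (extChartAt 𝓘(ℝ, E).tangent x).symm)
      (extChartAt 𝓘(ℝ, E).tangent x y) ((0 : E), Prod.fst (α := E) (β := E)
        (mfderiv 𝓘(ℝ, E).tangent 𝓘(ℝ, E × E) (extChartAt 𝓘(ℝ, E).tangent x) y w)) := by
  refine (fibreDeriv_eq hL hy (projDeriv y w)).trans ?_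
  exact congrArg (fun η : E => fderiv ℝ (L ∘ (extChartAt 𝓘(ℝ, E).tangent x).symm)
      (extChartAt 𝓘(ℝ, E).tangent x y) ((0 : E), η)) (mfderiv_proj x y hy w)

theorem energy_eq {x y : TangentBundle 𝓘(ℝ, E) Q}
    (hy : y.1 ∈ (extChartAt 𝓘(ℝ, E) x.1).source) :
    energy L y = fderiv ℝ (L ∘ (extChartAt 𝓘(ℝ, E).tangent x).symm)
      (extChartAt 𝓘(ℝ, E).tangent x y) ((0 : E), (extChartAt 𝓘(ℝ, E).tangent x y).2) -
        (L ∘ (extChartAt 𝓘(ℝ, E).tangent x).symm) (extChartAt 𝓘(ℝ, E).tangent x y) := by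
  have h1 := fibreDeriv_eq hL hy y.2
  have h2 : (L ∘ (extChartAt 𝓘(ℝ, E).tangent x).symm) (extChartAt 𝓘(ℝ, E).tangent x y) = L y := by
    rw [Function.comp_apply, 
      (extChartAt 𝓘(ℝ, E).tangent x).left_inv (mem_extChartAt_tangentBundle_source.2 hy)]
  rw [energy, h1, h2]
  congr 3
  rw [extChartAt_tangentBundle_apply hy]

end TangentCharts

/-! ### Consequences of an invertible Legendre transform on a vector space. -/

section LegendreLemmas

variable {V : Type*} [NormedAddCommGroup V] [NormedSpace ℝ V]
  {W : Type*} [NormedAddCommGroup W] [NormedSpace ℝ W]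

/-- The derivative of an invertible Legendre transform is injective. -/
theorem HasLegendreDiffeo.hessian_injective {f : V → ℝ} (hf : HasLegendreDiffeo f) (v : V) {w : V}
    (hw : fderiv ℝ (fderiv ℝ f) v w = 0) : w = 0 := by
  obtain ⟨hs, g, hg, hl, -⟩ := hf
  have h1 := (hs.differentiable (by simp) v).hasFDerivAt
  have h2 := (hg.differentiable (by simp) (fderiv ℝ f v)).hasFDerivAt
  have h3 := h2.comp v h1
  have h4 : g ∘ fderiv ℝ f = id := funext hl
  rw [h4] at h3
  have h5 := DFunLike.congr_fun (h3.unique (hasFDerivAt_id v)) w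
  simpa [hw] using h5.symm

theorem HasLegendreDiffeo.bijective {f : V → ℝ} (hf : HasLegendreDiffeo f) :
    Function.Bijective (fderiv ℝ f) := by
  obtain ⟨hs, g, hg, hl, hr⟩ := hf
  exact ⟨hl.injective, hr.surjective⟩

/-- A vector valued function whose derivative takes values in the kernel of an invertible
Legendre transform is constant. -/
theorem HasLegendreDiffeo.eq_const {f : V → ℝ} (hf : HasLegendreDiffeo f)
    {a : V → V} (ha : ContDiff ℝ ∞ a) (hfa : ∀ v η, fderiv ℝ f v (fderiv ℝ a v η) = 0) (v w : V) :
    a v = a w := by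
  obtain ⟨hs, g, hg, hl, hr⟩ := hf
  -- Momentum is taken as the independent variable: the hypothesis becomes `α (db_α β) = 0`.
  let b : (V →L[ℝ] ℝ) → V := a ∘ g
  have hb : ContDiff ℝ ∞ b := ha.comp hg
  have hbd : ∀ α, HasFDerivAt b (fderiv ℝ b α) α := fun α =>
    (hb.differentiable (by simp) α).hasFDerivAt
  have h1 : ∀ α β : V →L[ℝ] ℝ, α (fderiv ℝ b α β) = 0 := by
    intro α β
    have h2 := ((ha.differentiable (by simp) (g α)).hasFDerivAt.comp α
      (hg.differentiable (by simp) α).hasFDerivAt).fderiv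
    have h3 := hfa (g α) (fderiv ℝ g α β)
    rw [hr α] at h3
    change α (fderiv ℝ (a ∘ g) α β) = 0
    rw [h2]
    exact h3
  -- In the derivative of `h` the term with `db` vanishes, so the gradient of `h` is `b` and its
  -- Hessian is `db`. Symmetry of the Hessian turns `α (db_α β) = 0` into `β (db_α α) = 0` for all
  -- β, which is Euler's equation for degree zero.
  let h : (V →L[ℝ] ℝ) → ℝ := fun α => α (b α)
  have hh : ContDiff ℝ ∞ h := contDiff_id.clm_apply hb
  have h2 : ∀ α β, fderiv ℝ h α β = β (b α) := by
    intro α β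
    refine (DFunLike.congr_fun ((hasFDerivAt_id α).clm_apply (hbd α)).fderiv β).trans ?_
    simp [h1]
  have h3 : ∀ α, fderiv ℝ b α α = 0 := by
    intro α
    have h4 : ∀ γ β, fderiv ℝ (fderiv ℝ h) α γ β = β (fderiv ℝ b α γ) := by
      intro γ β
      have h5 : DifferentiableAt ℝ (fderiv ℝ h) α :=
        ((hh.fderiv_right (m := 1) (by norm_num; exact ENat.LEInfty.out)).differentiable
          (by simp)) α
      have h6 := (h5.hasFDerivAt.clm_apply (hasFDerivAt_const β α)).congr_of_eventuallyEq
        (f₁ := fun α => β (b α)) (Eventually.of_forall fun α => (h2 α β).symm)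
      have h7 := DFunLike.congr_fun (h6.unique (β.hasFDerivAt.comp α (hbd α))) γ
      simpa using h7
    refine SeparatingDual.eq_zero_of_forall_dual_eq_zero (R := ℝ) fun β => ?_
    have h5 : IsSymmSndFDerivAt ℝ h α :=
      hh.contDiffAt.isSymmSndFDerivAt (by simp; exact ENat.LEInfty.out)
    have h6 := h5 α β
    rw [h4, h4] at h6
    rw [h6, h1]
  have h4 : ∀ α, b α = b 0 := by
    intro α
    have h5 : ∀ s : ℝ, HasDerivAt (fun s : ℝ => b (s • α)) (fderiv ℝ b (s • α) α) s := by
      intro s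
      have h6 : HasDerivAt (fun s : ℝ => s • α) α s := by
        simpa using (hasDerivAt_id s).smul_const α
      exact (hbd (s • α)).comp_hasDerivAt s h6
    have h6 : ∀ s : ℝ, s ≠ 0 → fderiv ℝ b (s • α) α = 0 := by
      intro s hs0
      have := h3 (s • α)
      rw [map_smul] at this
      exact (smul_eq_zero.1 this).resolve_left hs0
    have h7 : Continuous fun s : ℝ => fderiv ℝ b (s • α) α :=
      ((hb.continuous_fderiv (by simp)).comp (continuous_id.smul continuous_const)).clm_apply
        continuous_const
    -- Continuity extends the vanishing to `s = 0`. Regularity at zero momentum is essential: a map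
    -- homogeneous of degree zero need not be constant without it.
    have h8 : ∀ s : ℝ, fderiv ℝ b (s • α) α = 0 := by
      have h9 : Dense {s : ℝ | s ≠ 0} := dense_compl_singleton 0
      exact congrFun (h7.ext_on h9 continuous_const fun s hs0 => h6 s hs0)
    have h9 := is_const_of_deriv_eq_zero (fun s => (h5 s).differentiableAt)
      (fun s => by rw [(h5 s).deriv, h8 s]) 1 0
    simpa using h9
  have h5 : ∀ v, a v = b 0 := fun v => by
    rw [← h4 (fderiv ℝ f v)]
    simp [b, hl v]
  rw [h5, h5]

/-- The velocity component of a basic scaling symmetry in a chart, as a consequence of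
`L_D λ_L = λ_L` and `D(E_L) = Λ E_L`. -/
theorem velocity_component {ℓ : V × V → ℝ} {X : V × V → V × V} {A : V → V} {u : V} {Λ : ℝ}
    (hℓ : ∀ v, ContDiffAt ℝ ∞ ℓ (u, v)) (hX : ∀ v, DifferentiableAt ℝ X (u, v))
    (hA : ∀ v, (fun z => (X z).1) =ᶠ[𝓝 (u, v)] fun z => A z.1) (hAd : DifferentiableAt ℝ A u)
    (hform : ∀ v c, fderiv ℝ (fun z => fderiv ℝ ℓ z (0, c.1)) (u, v) (X (u, v)) +
      fderiv ℝ ℓ (u, v) (0, (fderiv ℝ X (u, v) c).1) = fderiv ℝ ℓ (u, v) (0, c.1))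
    (hen : ∀ v, fderiv ℝ (fun z => fderiv ℝ ℓ z (0, z.2) - ℓ z) (u, v) (X (u, v)) =
      Λ * (fderiv ℝ ℓ (u, v) (0, v) - ℓ (u, v)))
    (hleg : HasLegendreDiffeo fun v => ℓ (u, v)) (v : V) :
    (X (u, v)).2 = (Λ - 1) • v + fderiv ℝ A u v := by
  have d1 : ∀ v, HasFDerivAt ℓ (fderiv ℝ ℓ (u, v)) (u, v) := fun v =>
    ((hℓ v).differentiableAt (by simp)).hasFDerivAt
  have d2 : ∀ v, HasFDerivAt (fderiv ℝ ℓ) (fderiv ℝ (fderiv ℝ ℓ) (u, v)) (u, v) := fun v =>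
    (((hℓ v).fderiv_right (m := 1) (by norm_num; exact ENat.LEInfty.out)).differentiableAt (by simp)).hasFDerivAt
  have hsymm : ∀ v c c', fderiv ℝ (fderiv ℝ ℓ) (u, v) c c' = fderiv ℝ (fderiv ℝ ℓ) (u, v) c' c :=
    fun v c c' => ((hℓ v).isSymmSndFDerivAt (by simp; exact ENat.LEInfty.out)) c c'
  have hX1 : ∀ v c, (fderiv ℝ X (u, v) c).1 = fderiv ℝ A u c.1 := by
    intro v c
    have h1 : HasFDerivAt (fun z => (X z).1) ((ContinuousLinearMap.fst ℝ V V).comp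
        (fderiv ℝ X (u, v))) (u, v) := hasFDerivAt_fst.comp (u, v) (hX v).hasFDerivAt
    have h2 : HasFDerivAt (fun z : V × V => A z.1) ((fderiv ℝ A u).comp
        (ContinuousLinearMap.fst ℝ V V)) (u, v) :=
      HasFDerivAt.comp (g := A) (u, v) hAd.hasFDerivAt hasFDerivAt_fst
    exact DFunLike.congr_fun ((h1.congr_of_eventuallyEq (hA v).symm).unique h2) c
  have hXu : ∀ v, (X (u, v)).1 = A u := fun v => (hA v).self_of_nhds
  have hXe : ∀ v, X (u, v) = (A u, 0) + (0, (X (u, v)).2) := fun v => by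
    ext <;> simp [hXu v]
  have form : ∀ v c, fderiv ℝ (fderiv ℝ ℓ) (u, v) (X (u, v)) (0, c) +
      fderiv ℝ ℓ (u, v) (0, fderiv ℝ A u c) = fderiv ℝ ℓ (u, v) (0, c) := by
    intro v c
    have h := hform v (c, 0)
    rw [hX1] at h
    rw [← h]
    congr 1
    have h1 := (d2 v).clm_apply (hasFDerivAt_const ((0 : V), c) (u, v))
    rw [h1.fderiv]
    simp
  -- In the derivative of the energy along `X`, the two terms with `∂ℓ/∂v` applied to the velocity
  -- component of `X` cancel. Using `form` with `c = v` then removes the second derivatives, and `X`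
  -- survives only through `A`.
  have en : ∀ v, fderiv ℝ ℓ (u, v) (0, v) - fderiv ℝ ℓ (u, v) (0, fderiv ℝ A u v) -
      fderiv ℝ ℓ (u, v) (A u, 0) = Λ * (fderiv ℝ ℓ (u, v) (0, v) - ℓ (u, v)) := by
    intro v
    rw [← hen v, ← form v v]
    have h0 : HasFDerivAt (fun z : V × V => ((0 : V), z.2))
        ((0 : V × V →L[ℝ] V).prod (ContinuousLinearMap.snd ℝ V V)) (u, v) :=
      (hasFDerivAt_const _ _).prodMk hasFDerivAt_snd
    have h1 := ((d2 v).clm_apply h0).fun_sub (d1 v)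
    rw [h1.fderiv]
    have h2 : fderiv ℝ ℓ (u, v) (X (u, v)) =
        fderiv ℝ ℓ (u, v) (A u, 0) + fderiv ℝ ℓ (u, v) (0, (X (u, v)).2) := by
      rw [← map_add, ← hXe]
    simp [h2]
    ring
  have dv : ∀ v, HasFDerivAt (fun v : V => (u, v)) (ContinuousLinearMap.inr ℝ V V) v := fun v =>
    (hasFDerivAt_const u v).prodMk (hasFDerivAt_id v)
  have e1 : ∀ v, HasFDerivAt (fun v => ℓ (u, v))
      ((fderiv ℝ ℓ (u, v)).comp (ContinuousLinearMap.inr ℝ V V)) v := fun v =>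
    HasFDerivAt.comp (g := ℓ) v (d1 v) (dv v)
  have e2 : ∀ v, HasFDerivAt (fun v => fderiv ℝ ℓ (u, v))
      ((fderiv ℝ (fderiv ℝ ℓ) (u, v)).comp (ContinuousLinearMap.inr ℝ V V)) v := fun v =>
    HasFDerivAt.comp (g := fderiv ℝ ℓ) v (d2 v) (dv v)
  -- Differentiating `en` in `v` along η and inserting `form` with `c = η` determines the Hessian
  -- paired with the velocity component; injectivity of the Hessian then determines that component.
  have key : ∀ η, fderiv ℝ (fderiv ℝ ℓ) (u, v) (0, η) (0, (X (u, v)).2) =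
      fderiv ℝ (fderiv ℝ ℓ) (u, v) (0, η) (0, (Λ - 1) • v + fderiv ℝ A u v) := by
    intro η
    have k2 := (e2 v).clm_apply ((hasFDerivAt_const (0 : V) v).prodMk (fderiv ℝ A u).hasFDerivAt)
    have k3 := (e2 v).clm_apply (hasFDerivAt_const (A u, (0 : V)) v)
    have k1' := (e2 v).clm_apply ((hasFDerivAt_const (0 : V) v).prodMk (hasFDerivAt_id v))
    have k4 := (k1'.fun_sub k2).fun_sub k3
    have k5 := (k1'.fun_sub (e1 v)).const_mul Λ
    have k6 := DFunLike.congr_fun (k4.unique (k5.congr_of_eventuallyEq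
      (Eventually.of_forall en))) η
    simp at k6
    have f1 := form v η
    rw [hsymm, hXe v, map_add] at f1
    have s1 : ((0 : V), (Λ - 1) • v + fderiv ℝ A u v) =
      (Λ - 1) • ((0 : V), v) + (0, fderiv ℝ A u v) := by simp
    rw [s1, map_add, map_smul, smul_eq_mul]
    linarith
  have hess : ∀ η ξ, fderiv ℝ (fderiv ℝ fun v => ℓ (u, v)) v η ξ =
      fderiv ℝ (fderiv ℝ ℓ) (u, v) (0, η) (0, ξ) := by
    intro η ξ
    have h1 : fderiv ℝ (fun v => ℓ (u, v)) =
        fun v => (fderiv ℝ ℓ (u, v)).comp (ContinuousLinearMap.inr ℝ V V) :=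
      funext fun v => (e1 v).fderiv
    rw [h1, ((e2 v).clm_comp (hasFDerivAt_const (ContinuousLinearMap.inr ℝ V V) v)).fderiv]
    simp
  rw [← sub_eq_zero]
  refine hleg.hessian_injective v (ContinuousLinearMap.ext fun η => ?_)
  rw [hess, hsymm]
  have s2 : ((0 : V), (X (u, v)).2 - ((Λ - 1) • v + fderiv ℝ A u v)) =
    (0, (X (u, v)).2) - (0, (Λ - 1) • v + fderiv ℝ A u v) := by simp
  rw [s2, map_sub, key]
  simp

end LegendreLemmas

/-! ### The components of a basic scaling symmetry in a chart of `TQ`. -/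

section ChartKinematics

variable {E : Type*} [NormedAddCommGroup E] [NormedSpace ℝ E]
  {Q : Type*} [TopologicalSpace Q] [ChartedSpace E Q] [IsManifold 𝓘(ℝ, E) ∞ Q]

variable {L : TangentBundle 𝓘(ℝ, E) Q → ℝ} (hL : ContMDiff 𝓘(ℝ, E).tangent 𝓘(ℝ, ℝ) ∞ L)
  {Λ : ℝ} {D : ∀ x : TangentBundle 𝓘(ℝ, E) Q, TangentSpace 𝓘(ℝ, E).tangent x}

include hL

theorem contDiffAt_fderiv_comp_symm (x : TangentBundle 𝓘(ℝ, E) Q) :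
    ContDiffAt ℝ ∞ (fderiv ℝ (L ∘ (extChartAt 𝓘(ℝ, E).tangent x).symm))
      (extChartAt 𝓘(ℝ, E).tangent x x) :=
  (contDiffAt_comp_extChartAt_symm hL (mem_extChartAt_target x)).fderiv_right (by simp)

theorem energy_comp_symm_eventuallyEq (x : TangentBundle 𝓘(ℝ, E) Q) :
    energy L ∘ (extChartAt 𝓘(ℝ, E).tangent x).symm =ᶠ[𝓝 (extChartAt 𝓘(ℝ, E).tangent x x)]
      fun z => fderiv ℝ (L ∘ (extChartAt 𝓘(ℝ, E).tangent x).symm) z ((0 : E), z.2) -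
        (L ∘ (extChartAt 𝓘(ℝ, E).tangent x).symm) z := by
  filter_upwards [extChartAt_target_mem_nhds (I := 𝓘(ℝ, E).tangent) x] with z hz
  have h1 := (extChartAt 𝓘(ℝ, E).tangent x).map_target hz
  have h2 := energy_eq hL (mem_extChartAt_tangentBundle_source.1 h1)
  rw [(extChartAt 𝓘(ℝ, E).tangent x).right_inv hz] at h2
  exact h2

theorem contMDiff_energy : ContMDiff 𝓘(ℝ, E).tangent 𝓘(ℝ, ℝ) ∞ (energy L) := by
  intro x
  have h1 : ContDiffAt ℝ ∞ (fun z : E × E =>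
      fderiv ℝ (L ∘ (extChartAt 𝓘(ℝ, E).tangent x).symm) z ((0 : E), z.2) -
        (L ∘ (extChartAt 𝓘(ℝ, E).tangent x).symm) z) (extChartAt 𝓘(ℝ, E).tangent x x) :=
    ((contDiffAt_fderiv_comp_symm hL x).clm_apply (contDiffAt_const.prodMk contDiffAt_snd)).sub
      (contDiffAt_comp_extChartAt_symm hL (mem_extChartAt_target x))
  refine (h1.contMDiffAt.comp x contMDiffAt_extChartAt).congr_of_eventuallyEq ?_
  filter_upwards [extChartAt_source_mem_nhds (I := 𝓘(ℝ, E).tangent) x] with y hy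
  exact energy_eq hL (mem_extChartAt_tangentBundle_source.1 hy)

variable [CompleteSpace E]

theorem lagrangeForm_constField {x y : TangentBundle 𝓘(ℝ, E) Q}
    (hy : y ∈ (extChartAt 𝓘(ℝ, E).tangent x).source) (c : E × E) :
    lagrangeForm L y (constField 𝓘(ℝ, E).tangent x c y) =
      fderiv ℝ (L ∘ (extChartAt 𝓘(ℝ, E).tangent x).symm)
      (extChartAt 𝓘(ℝ, E).tangent x y) ((0 : E), c.1) := by
  refine (lagrangeForm_eq hL (mem_extChartAt_tangentBundle_source.1 hy) _).trans ?_
  exact congrArg (fun w : E × E => fderiv ℝ (L ∘ (extChartAt 𝓘(ℝ, E).tangent x).symm)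
      (extChartAt 𝓘(ℝ, E).tangent x y) ((0 : E), w.1)) (mfderiv_constField hy c)

theorem lagrangeForm_self (x : TangentBundle 𝓘(ℝ, E) Q) (w : TangentSpace 𝓘(ℝ, E).tangent x) :
    lagrangeForm L x w = fderiv ℝ (L ∘ (extChartAt 𝓘(ℝ, E).tangent x).symm)
      (extChartAt 𝓘(ℝ, E).tangent x x) ((0 : E), Prod.fst (α := E) (β := E) w) := by
  refine (lagrangeForm_eq hL (mem_extChartAt_source x.1) w).trans ?_
  exact congrArg (fun w : E × E => fderiv ℝ (L ∘ (extChartAt 𝓘(ℝ, E).tangent x).symm)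
      (extChartAt 𝓘(ℝ, E).tangent x x) ((0 : E), w.1))
      (mfderiv_extChartAt_self_apply (I := 𝓘(ℝ, E).tangent) (E := E × E) x w)

variable (hD : IsBasicScalingSymmetry L Λ D)
include hD

theorem IsBasicScalingSymmetry.form_chart (x : TangentBundle 𝓘(ℝ, E) Q) (c : E × E) :
    fderiv ℝ (fun z => fderiv ℝ (L ∘ (extChartAt 𝓘(ℝ, E).tangent x).symm) z ((0 : E), c.1))
        (extChartAt 𝓘(ℝ, E).tangent x x) (chartField D x (extChartAt 𝓘(ℝ, E).tangent x x)) +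
      fderiv ℝ (L ∘ (extChartAt 𝓘(ℝ, E).tangent x).symm) (extChartAt 𝓘(ℝ, E).tangent x x)
        ((0 : E), (fderiv ℝ (chartField D x) (extChartAt 𝓘(ℝ, E).tangent x x) c).1) =
      fderiv ℝ (L ∘ (extChartAt 𝓘(ℝ, E).tangent x).symm) (extChartAt 𝓘(ℝ, E).tangent x x)
        ((0 : E), c.1) := by
  have h0 : ContDiffAt ℝ ∞
      (fun z => fderiv ℝ (L ∘ (extChartAt 𝓘(ℝ, E).tangent x).symm) z ((0 : E), c.1))
      (extChartAt 𝓘(ℝ, E).tangent x x) :=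
    (contDiffAt_fderiv_comp_symm hL x).clm_apply contDiffAt_const
  have h1 : MDifferentiableAt 𝓘(ℝ, E).tangent 𝓘(ℝ, ℝ)
      (fun y => lagrangeForm L y (constField 𝓘(ℝ, E).tangent x c y)) x := by
    refine ((h0.contMDiffAt.comp x contMDiffAt_extChartAt).congr_of_eventuallyEq
      ?_).mdifferentiableAt (by simp)
    filter_upwards [extChartAt_source_mem_nhds (I := 𝓘(ℝ, E).tangent) x] with y hy
    exact lagrangeForm_constField hL hy c
  have h2 := hD.form.apply_const x c h1
  rw [chartField_self]
  refine Eq.trans (congrArg₂ (· + ·) ?_ (lagrangeForm_self hL x _).symm)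
    (h2.trans (lagrangeForm_self hL x c))
  refine congrArg (fun T : E × E →L[ℝ] ℝ => T (show E × E from D x))
    (Filter.EventuallyEq.fderiv_eq ?_)
  filter_upwards [extChartAt_target_mem_nhds (I := 𝓘(ℝ, E).tangent) x] with z hz
  have h3 := lagrangeForm_constField hL ((extChartAt 𝓘(ℝ, E).tangent x).map_target hz) c
  rw [(extChartAt 𝓘(ℝ, E).tangent x).right_inv hz] at h3
  exact h3.symm

theorem IsBasicScalingSymmetry.energy_chart (x : TangentBundle 𝓘(ℝ, E) Q) :
    fderiv ℝ (fun z => fderiv ℝ (L ∘ (extChartAt 𝓘(ℝ, E).tangent x).symm) z ((0 : E), z.2) -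
        (L ∘ (extChartAt 𝓘(ℝ, E).tangent x).symm) z)
        (extChartAt 𝓘(ℝ, E).tangent x x) (chartField D x (extChartAt 𝓘(ℝ, E).tangent x x)) =
      Λ * (fderiv ℝ (L ∘ (extChartAt 𝓘(ℝ, E).tangent x).symm) (extChartAt 𝓘(ℝ, E).tangent x x)
        ((0 : E), (extChartAt 𝓘(ℝ, E).tangent x x).2) -
        (L ∘ (extChartAt 𝓘(ℝ, E).tangent x).symm) (extChartAt 𝓘(ℝ, E).tangent x x)) := by
  have h1 := mfderiv_eq_fderiv_comp_symm (E := E × E)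
    ((contMDiff_energy hL).contMDiffAt.mdifferentiableAt (x := x) (by simp)) (D x)
  have h2 := hD.energy x
  rw [energy_eq hL (mem_extChartAt_source x.1)] at h2
  rw [← h2, chartField_self, ← (energy_comp_symm_eventuallyEq hL x).fderiv_eq]
  exact h1.symm

variable (hLeg : ∀ q : Q, HasLegendreDiffeo (fibreLagrangian L q))

omit hL hD in
theorem fibreLagrangian_self (x : TangentBundle 𝓘(ℝ, E) Q) :
    fibreLagrangian L x.1 = fun v => (L ∘ (extChartAt 𝓘(ℝ, E).tangent x).symm)
      (extChartAt 𝓘(ℝ, E) x.1 x.1, v) := by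
  funext v
  rw [fibreLagrangian_eq (mem_extChartAt_source x.1)]
  exact congrArg (fun w : E => (L ∘ (extChartAt 𝓘(ℝ, E).tangent x).symm)
      (extChartAt 𝓘(ℝ, E) x.1 x.1, w))
      (mfderiv_extChartAt_self_apply (I := 𝓘(ℝ, E)) (E := E) x.1 v)

include hLeg

/-- A basic scaling symmetry projects to the base. -/
theorem IsBasicScalingSymmetry.projDeriv_eq (x : TangentBundle 𝓘(ℝ, E) Q) :
    projDeriv x (D x) = baseField D x.1 := by
  set f : E → ℝ := fibreLagrangian L x.1 with hf
  set u := extChartAt 𝓘(ℝ, E) x.1 x.1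
  set X : E × E → E × E := chartField D x with hXdef
  have hz : ∀ v : E, extChartAt 𝓘(ℝ, E).tangent (⟨x.1, v⟩ : TangentBundle 𝓘(ℝ, E) Q) ⟨x.1, v⟩ =
      (u, v) := fun v => extChartAt_tangentBundle_self ⟨x.1, v⟩
  have hXs : ∀ v, ContDiffAt ℝ ∞ X (u, v) := by
    intro v
    have h := contDiffAt_chartField (hD.smooth.contMDiffAt (x := ⟨x.1, v⟩))
    rwa [hz] at h
  have hv : ∀ v : E, projDeriv (⟨x.1, v⟩ : TangentBundle 𝓘(ℝ, E) Q) (D ⟨x.1, v⟩) = (X (u, v)).1 := by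
    intro v
    have h1 := chartField_self D (⟨x.1, v⟩ : TangentBundle 𝓘(ℝ, E) Q)
    rw [hz] at h1
    refine (projDeriv_apply (⟨x.1, v⟩ : TangentBundle 𝓘(ℝ, E) Q) _).trans ?_
    exact congrArg Prod.fst h1.symm
  have dv : ∀ v, HasFDerivAt (fun v : E => (u, v)) (ContinuousLinearMap.inr ℝ E E) v := fun v =>
    (hasFDerivAt_const u v).prodMk (hasFDerivAt_id v)
  have ha : ContDiff ℝ ∞ fun v => (X (u, v)).1 := by
    rw [contDiff_iff_contDiffAt]
    intro v
    exact contDiffAt_fst.comp v ((hXs v).comp v (contDiffAt_const.prodMk contDiffAt_id))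
  have hL1 : ∀ v, HasFDerivAt f ((fderiv ℝ (L ∘ (extChartAt 𝓘(ℝ, E).tangent x).symm) (u, v)).comp
      (ContinuousLinearMap.inr ℝ E E)) v := by
    intro v
    have h1 := contDiffAt_comp_extChartAt_symm hL (mem_extChartAt_target
      (I := 𝓘(ℝ, E).tangent) (⟨x.1, v⟩ : TangentBundle 𝓘(ℝ, E) Q))
    rw [hz] at h1
    have h2 := HasFDerivAt.comp v (h1.differentiableAt (by simp)).hasFDerivAt (dv v)
    rw [hf, fibreLagrangian_self]
    exact h2
  have hX1 : ∀ v, HasFDerivAt (fun v => (X (u, v)).1)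
      ((ContinuousLinearMap.fst ℝ E E).comp ((fderiv ℝ X (u, v)).comp
        (ContinuousLinearMap.inr ℝ E E))) v := fun v =>
    HasFDerivAt.comp v hasFDerivAt_fst
      (HasFDerivAt.comp v ((hXs v).differentiableAt (by simp)).hasFDerivAt (dv v))
  -- Tested on the vertical direction `(0, η)`, the form equation loses its first term and its right
  -- side. What remains says that momentum kills the vertical derivative of the base component.
  have key := (hLeg x.1).eq_const ha (fun v η => by
    have h1 := hD.form_chart hL (⟨x.1, v⟩ : TangentBundle 𝓘(ℝ, E) Q) (0, η)
    rw [hz] at h1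
    rw [← hf, (hL1 v).fderiv, (hX1 v).fderiv]
    have h2 : ((0 : E), (0 : E)) = 0 := rfl
    simp only [h2, map_zero, fderiv_fun_const, Pi.zero_apply, zero_apply,
      zero_add] at h1
    exact h1)
  exact (hv x.2).trans ((key x.2 0).trans (hv 0).symm)

theorem IsBasicScalingSymmetry.chartField_fst (x : TangentBundle 𝓘(ℝ, E) Q) :
    (fun z => (chartField D x z).1) =ᶠ[𝓝 (extChartAt 𝓘(ℝ, E).tangent x x)]
      fun z => chartField (baseField D) x.1 z.1 := by
  filter_upwards [extChartAt_target_mem_nhds (I := 𝓘(ℝ, E).tangent) x] with z hz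
  have h1 := (extChartAt 𝓘(ℝ, E).tangent x).map_target hz
  have h2 := mfderiv_proj x _ (mem_extChartAt_tangentBundle_source.1 h1)
    (D ((extChartAt 𝓘(ℝ, E).tangent x).symm z))
  rw [hD.projDeriv_eq hL hLeg] at h2
  exact h2.symm

theorem IsBasicScalingSymmetry.contDiffAt_baseField (q : Q) :
    ContDiffAt ℝ ∞ (chartField (baseField D) q) (extChartAt 𝓘(ℝ, E) q q) := by
  set x : TangentBundle 𝓘(ℝ, E) Q := ⟨q, 0⟩
  have h1 := contDiffAt_chartField (hD.smooth.contMDiffAt (x := x))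
  have h2 := (contDiffAt_fst.comp _ h1).congr_of_eventuallyEq
    (hD.chartField_fst hL hLeg x).symm
  rw [extChartAt_tangentBundle_self] at h2
  exact ContDiffAt.comp (g := fun z : E × E => chartField (baseField D) q z.1)
    (f := fun w : E => (w, (0 : E))) (extChartAt 𝓘(ℝ, E) q q) h2
    (contDiffAt_id.prodMk contDiffAt_const)

/-- The components of a basic scaling symmetry in a chart. -/
theorem IsBasicScalingSymmetry.chart_eq (x : TangentBundle 𝓘(ℝ, E) Q) :
    D x = ((chartField (baseField D) x.1 (extChartAt 𝓘(ℝ, E) x.1 x.1),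
      (Λ - 1) • (show E from x.2) + fderiv ℝ (chartField (baseField D) x.1)
        (extChartAt 𝓘(ℝ, E) x.1 x.1) x.2) : E × E) := by
  have hz : ∀ v : E, extChartAt 𝓘(ℝ, E).tangent (⟨x.1, v⟩ : TangentBundle 𝓘(ℝ, E) Q) ⟨x.1, v⟩ =
      (extChartAt 𝓘(ℝ, E) x.1 x.1, v) := fun v => extChartAt_tangentBundle_self ⟨x.1, v⟩
  have h := velocity_component (ℓ := L ∘ (extChartAt 𝓘(ℝ, E).tangent x).symm)
    (X := chartField D x) (A := chartField (baseField D) x.1)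
    (u := extChartAt 𝓘(ℝ, E) x.1 x.1) (Λ := Λ)
    (fun v => by
      have h1 := contDiffAt_comp_extChartAt_symm hL (mem_extChartAt_target
        (I := 𝓘(ℝ, E).tangent) (⟨x.1, v⟩ : TangentBundle 𝓘(ℝ, E) Q))
      rw [hz] at h1
      exact h1)
    (fun v => by
      have h := contDiffAt_chartField (hD.smooth.contMDiffAt (x := ⟨x.1, v⟩))
      rw [hz] at h
      exact h.differentiableAt (by simp))
    (fun v => by
      have h := hD.chartField_fst hL hLeg ⟨x.1, v⟩
      rw [hz] at h
      exact h)
    ((hD.contDiffAt_baseField hL hLeg x.1).differentiableAt (by simp))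
    (fun v c => by
      have h := hD.form_chart hL ⟨x.1, v⟩ c
      rw [hz] at h
      exact h)
    (fun v => by
      have h := hD.energy_chart hL ⟨x.1, v⟩
      rw [hz] at h
      exact h)
    (by
      have h := hLeg x.1
      rw [fibreLagrangian_self] at h
      exact h) x.2
  have h1 := chartField_self D x
  have h2 := (hD.chartField_fst hL hLeg x).self_of_nhds
  rw [extChartAt_tangentBundle_self] at h1 h2
  exact h1.symm.trans (Prod.ext h2 h)

end ChartKinematics

/-! ### Derivatives of `df(v)` along the scaling field. -/

theorem hasFDerivAt_tangent {V G : Type*} [NormedAddCommGroup V] [NormedSpace ℝ V]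
    [NormedAddCommGroup G] [NormedSpace ℝ G] {f : V → G} {u : V} (hf : ContDiffAt ℝ ∞ f u) (v : V) :
    HasFDerivAt (fun z : V × V => fderiv ℝ f z.1 z.2)
      ((fderiv ℝ f u).comp (ContinuousLinearMap.snd ℝ V V) +
        ((fderiv ℝ (fderiv ℝ f) u).comp (ContinuousLinearMap.fst ℝ V V)).flip v) (u, v) := by
  have h1 : HasFDerivAt (fderiv ℝ f) (fderiv ℝ (fderiv ℝ f) u) u :=
    ((hf.fderiv_right (m := 1) (by norm_num; exact ENat.LEInfty.out)).differentiableAt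
      (by simp)).hasFDerivAt
  exact (HasFDerivAt.comp (g := fderiv ℝ f) (u, v) h1 hasFDerivAt_fst).clm_apply hasFDerivAt_snd

/-- By symmetry of the second derivative, the tangent lift `(A, dA(v))` sends `df(v)` to the
differential of `df(A)`; the additional vertical field `(Λ - 1) v` multiplies `df(v)` by Λ - 1. It
is used for `f = ρ`, where `g = ρ`, and for `f = p`, where `g = 0`. -/
theorem fderiv_tangent_scaling {V G : Type*} [NormedAddCommGroup V] [NormedSpace ℝ V]
    [NormedAddCommGroup G] [NormedSpace ℝ G] {f g : V → G} {A : V → V} {u : V} {Λ : ℝ}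
    (hf : ContDiffAt ℝ ∞ f u) (hA : DifferentiableAt ℝ A u)
    (hg : (fun u' => fderiv ℝ f u' (A u')) =ᶠ[𝓝 u] g) (v : V) :
    fderiv ℝ (fun z : V × V => fderiv ℝ f z.1 z.2) (u, v) (A u, (Λ - 1) • v + fderiv ℝ A u v) =
      fderiv ℝ g u v + (Λ - 1) • fderiv ℝ f u v := by
  have h1 : HasFDerivAt (fderiv ℝ f) (fderiv ℝ (fderiv ℝ f) u) u :=
    ((hf.fderiv_right (m := 1) (by norm_num; exact ENat.LEInfty.out)).differentiableAt
      (by simp)).hasFDerivAt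
  have h2 := h1.clm_apply hA.hasFDerivAt
  have h3 : IsSymmSndFDerivAt ℝ f u :=
    hf.isSymmSndFDerivAt (by simp; exact ENat.LEInfty.out)
  rw [← hg.fderiv_eq, h2.fderiv, (hasFDerivAt_tangent hf v).fderiv]
  simp [h3 (A u) v]
  abel

/-! ### Tangent maps rescaled by a function. -/

section TangentMaps

variable {E : Type*} [NormedAddCommGroup E] [NormedSpace ℝ E]
  {F : Type*} [NormedAddCommGroup F] [NormedSpace ℝ F]
  {Q : Type*} [TopologicalSpace Q] [ChartedSpace E Q] [IsManifold 𝓘(ℝ, E) ∞ Q]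
  {B : Type*} [TopologicalSpace B] [ChartedSpace F B] [IsManifold 𝓘(ℝ, F) ∞ B]

/-- The map `(q, v) ↦ (f(q), s(q) df_q(v))`. -/
def scaledTangentMap (s : Q → ℝ) (f : Q → B) (x : TangentBundle 𝓘(ℝ, E) Q) :
    TangentBundle 𝓘(ℝ, F) B :=
  ⟨f x.1, s x.1 • mfderiv 𝓘(ℝ, E) 𝓘(ℝ, F) f x.1 x.2⟩

theorem mfderiv_chart_comp {f : Q → B} {q₀ q : Q} (hf : MDifferentiableAt 𝓘(ℝ, E) 𝓘(ℝ, F) f q)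
    (hq : q ∈ (extChartAt 𝓘(ℝ, E) q₀).source) (hfq : f q ∈ (extChartAt 𝓘(ℝ, F) (f q₀)).source)
    (w : E) :
    mfderiv 𝓘(ℝ, F) 𝓘(ℝ, F) (extChartAt 𝓘(ℝ, F) (f q₀)) (f q)
        (mfderiv 𝓘(ℝ, E) 𝓘(ℝ, F) f q w) =
      fderiv ℝ (extChartAt 𝓘(ℝ, F) (f q₀) ∘ f ∘ (extChartAt 𝓘(ℝ, E) q₀).symm)
        (extChartAt 𝓘(ℝ, E) q₀ q) (mfderiv 𝓘(ℝ, E) 𝓘(ℝ, E) (extChartAt 𝓘(ℝ, E) q₀) q w) := by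
  have h1 : MDifferentiableAt 𝓘(ℝ, F) 𝓘(ℝ, F) (extChartAt 𝓘(ℝ, F) (f q₀)) (f q) :=
    mdifferentiableAt_extChartAt (by simpa using hfq)
  have h2 : MDifferentiableAt 𝓘(ℝ, E) 𝓘(ℝ, E) (extChartAt 𝓘(ℝ, E) q₀) q :=
    mdifferentiableAt_extChartAt (by simpa using hq)
  have h3 : MDifferentiableAt 𝓘(ℝ, E) 𝓘(ℝ, E) (extChartAt 𝓘(ℝ, E) q₀).symm
      (extChartAt 𝓘(ℝ, E) q₀ q) :=
    ((contMDiffOn_extChartAt_symm (n := ∞) q₀).contMDiffAt (extChartAt_target_mem_nhds'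
      ((extChartAt 𝓘(ℝ, E) q₀).map_source hq))).mdifferentiableAt (by simp)
  have e : (extChartAt 𝓘(ℝ, E) q₀).symm (extChartAt 𝓘(ℝ, E) q₀ q) = q :=
    (extChartAt 𝓘(ℝ, E) q₀).left_inv hq
  have h4 : MDifferentiableAt 𝓘(ℝ, E) 𝓘(ℝ, F)
      (extChartAt 𝓘(ℝ, F) (f q₀) ∘ f ∘ (extChartAt 𝓘(ℝ, E) q₀).symm)
      (extChartAt 𝓘(ℝ, E) q₀ q) := by
    refine MDifferentiableAt.comp (I' := 𝓘(ℝ, F)) _ ?_ (MDifferentiableAt.comp (I' := 𝓘(ℝ, E)) _ ?_ h3)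
    · rw [Function.comp_apply, e]; exact h1
    · rw [e]; exact hf
  have h5 := h4.hasMFDerivAt.comp q h2.hasMFDerivAt
  have h6 := h1.hasMFDerivAt.comp q hf.hasMFDerivAt
  have h7 := h6.congr_of_eventuallyEq
    (f₁ := (extChartAt 𝓘(ℝ, F) (f q₀) ∘ f ∘ (extChartAt 𝓘(ℝ, E) q₀).symm) ∘
      extChartAt 𝓘(ℝ, E) q₀) (by
    filter_upwards [extChartAt_source_mem_nhds' (I := 𝓘(ℝ, E)) hq] with y hy
    simp only [Function.comp_apply, (extChartAt 𝓘(ℝ, E) q₀).left_inv hy])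
  have h8 := hasMFDerivAt_unique h7 h5
  refine (DFunLike.congr_fun h8 w).trans ?_
  exact congrArg (fun T : E →L[ℝ] F => T _) (mfderiv_eq_fderiv (f :=
    extChartAt 𝓘(ℝ, F) (f q₀) ∘ f ∘ (extChartAt 𝓘(ℝ, E) q₀).symm))

theorem contMDiff_scaledTangentMap {s : Q → ℝ} {f : Q → B} (hs : ContMDiff 𝓘(ℝ, E) 𝓘(ℝ, ℝ) ∞ s)
    (hf : ContMDiff 𝓘(ℝ, E) 𝓘(ℝ, F) ∞ f) :
    ContMDiff 𝓘(ℝ, E).tangent 𝓘(ℝ, F).tangent ∞ (scaledTangentMap (E := E) (F := F) s f) := by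
  intro x
  have hproj : ContMDiff 𝓘(ℝ, E).tangent 𝓘(ℝ, E) ∞ (fun y : TangentBundle 𝓘(ℝ, E) Q => y.1) :=
    Bundle.contMDiff_proj (TangentSpace 𝓘(ℝ, E))
  have h1 : ContMDiffAt 𝓘(ℝ, E).tangent 𝓘(ℝ, F).tangent ∞ (tangentMap 𝓘(ℝ, E) 𝓘(ℝ, F) f) x :=
    contMDiffAt_tangentMap hf.contMDiffAt
  rw [Bundle.contMDiffAt_totalSpace] at h1 ⊢
  refine ⟨h1.1, ?_⟩
  refine ((hs.comp hproj).contMDiffAt.smul h1.2).congr_of_eventuallyEq ?_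
  have hmem := ((hf.comp hproj).continuous.continuousAt (x := x)).eventually_mem
    ((trivializationAt F (TangentSpace 𝓘(ℝ, F)) (f x.1)).open_baseSet.mem_nhds
      (FiberBundle.mem_baseSet_trivializationAt F (TangentSpace 𝓘(ℝ, F)) (f x.1)))
  filter_upwards [hmem] with y hy
  exact ((trivializationAt F (TangentSpace 𝓘(ℝ, F)) (f x.1)).linear ℝ hy).map_smul (s y.1)
    (mfderiv 𝓘(ℝ, E) 𝓘(ℝ, F) f y.1 y.2)

theorem scaledTangentMap_chart {s : Q → ℝ} {f : Q → B} (hf : ContMDiff 𝓘(ℝ, E) 𝓘(ℝ, F) ∞ f)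
    (x : TangentBundle 𝓘(ℝ, E) Q) :
    extChartAt 𝓘(ℝ, F).tangent (scaledTangentMap (E := E) (F := F) s f x) ∘ scaledTangentMap (E := E) (F := F) s f ∘
        (extChartAt 𝓘(ℝ, E).tangent x).symm =ᶠ[𝓝 (extChartAt 𝓘(ℝ, E).tangent x x)]
      fun z => ((extChartAt 𝓘(ℝ, F) (f x.1) ∘ f ∘ (extChartAt 𝓘(ℝ, E) x.1).symm) z.1,
        s ((extChartAt 𝓘(ℝ, E) x.1).symm z.1) • fderiv ℝ (extChartAt 𝓘(ℝ, F) (f x.1) ∘ f ∘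
          (extChartAt 𝓘(ℝ, E) x.1).symm) z.1 z.2) := by
  have hc : ContinuousAt (fun z => f ((extChartAt 𝓘(ℝ, E).tangent x).symm z).1)
      (extChartAt 𝓘(ℝ, E).tangent x x) := by
    have h1 := continuousAt_extChartAt_symm (I := 𝓘(ℝ, E).tangent) x
    have h2 : Continuous fun y : TangentBundle 𝓘(ℝ, E) Q => f y.1 :=
      hf.continuous.comp (FiberBundle.continuous_proj E _)
    exact h2.continuousAt.comp h1
  have hmem := hc.eventually_mem (s := (extChartAt 𝓘(ℝ, F) (f x.1)).source) (by
    rw [extChartAt_to_inv]; exact extChartAt_source_mem_nhds (f x.1))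
  filter_upwards [extChartAt_target_mem_nhds (I := 𝓘(ℝ, E).tangent) x, hmem] with z hz hfz
  set y := (extChartAt 𝓘(ℝ, E).tangent x).symm z with hy
  have hys := (extChartAt 𝓘(ℝ, E).tangent x).map_target hz
  have hq := mem_extChartAt_tangentBundle_source.1 hys
  have hez : extChartAt 𝓘(ℝ, E).tangent x y = z := (extChartAt 𝓘(ℝ, E).tangent x).right_inv hz
  rw [extChartAt_tangentBundle_apply hq] at hez
  have h1 : extChartAt 𝓘(ℝ, E) x.1 y.1 = z.1 := congrArg Prod.fst hez
  have h2 : mfderiv 𝓘(ℝ, E) 𝓘(ℝ, E) (extChartAt 𝓘(ℝ, E) x.1) y.1 y.2 = z.2 :=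
    congrArg Prod.snd hez
  have h3 : (extChartAt 𝓘(ℝ, E) x.1).symm z.1 = y.1 := by
    rw [← h1, (extChartAt 𝓘(ℝ, E) x.1).left_inv hq]
  have h4 := mfderiv_chart_comp (hf.mdifferentiable (by simp) y.1) hq hfz y.2
  refine (extChartAt_tangentBundle_apply (x := scaledTangentMap (E := E) (F := F) s f x)
    (y := scaledTangentMap (E := E) (F := F) s f y) hfz).trans (Prod.ext ?_ ?_)
  · change extChartAt 𝓘(ℝ, F) (f x.1) (f y.1) = extChartAt 𝓘(ℝ, F) (f x.1) (f _)
    rw [h3]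
  · refine (map_smul (mfderiv 𝓘(ℝ, F) 𝓘(ℝ, F) (extChartAt 𝓘(ℝ, F) (f x.1)) (f y.1)) (s y.1)
      (mfderiv 𝓘(ℝ, E) 𝓘(ℝ, F) f y.1 y.2)).trans ?_
    refine congrArg₂ (fun (a : ℝ) (b : F) => a • b) (congrArg s h3.symm) ?_
    rw [h1] at h4
    exact h4.trans (congrArg _ h2)

end TangentMaps

/-! ### Rules for directional derivatives. -/

section DirectionalDerivatives

variable {E : Type*} [NormedAddCommGroup E] [NormedSpace ℝ E]
  {H : Type*} [TopologicalSpace H] {I : ModelWithCorners ℝ E H}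
  {M : Type*} [TopologicalSpace M] [ChartedSpace H M]
  {E' : Type*} [NormedAddCommGroup E'] [NormedSpace ℝ E']
  {H' : Type*} [TopologicalSpace H'] {I' : ModelWithCorners ℝ E' H'}
  {N : Type*} [TopologicalSpace N] [ChartedSpace H' N]
  {f g : M → ℝ} {x : M}

theorem dirDeriv_comp_map {g : N → ℝ} {f : M → N} (hg : MDifferentiableAt I' 𝓘(ℝ, ℝ) g (f x))
    (hf : MDifferentiableAt I I' f x) (w : TangentSpace I x) :
    dirDeriv I (fun y => g (f y)) x w = dirDeriv I' g (f x) (mfderiv I I' f x w) :=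
  DFunLike.congr_fun (mfderiv_comp x hg hf) w

theorem dirDeriv_comp_real {φ : ℝ → ℝ} {φ' : ℝ} (hφ : HasDerivAt φ φ' (f x))
    (hf : MDifferentiableAt I 𝓘(ℝ, ℝ) f x) (w : TangentSpace I x) :
    dirDeriv I (fun y => φ (f y)) x w = φ' * dirDeriv I f x w := by
  have h := (hφ.hasFDerivAt.hasMFDerivAt.comp x hf.hasMFDerivAt).mfderiv
  refine (DFunLike.congr_fun h w).trans ?_
  change dirDeriv I f x w * φ' = _
  ring

theorem dirDeriv_mul (hf : MDifferentiableAt I 𝓘(ℝ, ℝ) f x) (hg : MDifferentiableAt I 𝓘(ℝ, ℝ) g x)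
    (w : TangentSpace I x) :
    dirDeriv I (fun y => f y * g y) x w = dirDeriv I f x w * g x + f x * dirDeriv I g x w := by
  have h := (hf.hasMFDerivAt.mul' hg.hasMFDerivAt).mfderiv
  refine (DFunLike.congr_fun h w).trans ?_
  change f x * dirDeriv I g x w + (dirDeriv I f x w) * g x = _
  ring

theorem dirDeriv_add (hf : MDifferentiableAt I 𝓘(ℝ, ℝ) f x) (hg : MDifferentiableAt I 𝓘(ℝ, ℝ) g x)
    (w : TangentSpace I x) :
    dirDeriv I (fun y => f y + g y) x w = dirDeriv I f x w + dirDeriv I g x w :=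
  DFunLike.congr_fun (hf.hasMFDerivAt.add hg.hasMFDerivAt).mfderiv w

end DirectionalDerivatives

/-! ### The standing hypotheses. -/

section Setting

variable {E : Type*} [NormedAddCommGroup E] [NormedSpace ℝ E]
  {Q : Type*} [TopologicalSpace Q] [ChartedSpace E Q] [IsManifold 𝓘(ℝ, E) ∞ Q]
  (F : Type*) [NormedAddCommGroup F] [NormedSpace ℝ F]
  {B : Type*} [TopologicalSpace B] [ChartedSpace F B]

/-- A Lagrangian system with a basic scaling symmetry, a scaling function and a quotient of the
configuration space, the Legendre transforms being diffeomorphisms. -/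
structure IsScalingSystem (L : TangentBundle 𝓘(ℝ, E) Q → ℝ) (Λ : ℝ)
    (D : ∀ x : TangentBundle 𝓘(ℝ, E) Q, TangentSpace 𝓘(ℝ, E).tangent x) (ρ : Q → ℝ)
    (p : Q → B) : Prop where
  smooth : ContMDiff 𝓘(ℝ, E).tangent 𝓘(ℝ, ℝ) ∞ L
  legendre : ∀ q : Q, HasLegendreDiffeo (fibreLagrangian L q)
  symm : IsBasicScalingSymmetry L Λ D
  smooth_rho : ContMDiff 𝓘(ℝ, E) 𝓘(ℝ, ℝ) ∞ ρ
  rho_ne : ∀ q, ρ q ≠ 0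
  rho_scaling : ∀ q, dirDeriv 𝓘(ℝ, E) ρ q (baseField D q) = ρ q
  pow : (∀ q, 0 < ρ q) ∨ ∃ n : ℤ, Λ = n
  quot : IsOrbitQuotient 𝓘(ℝ, E) 𝓘(ℝ, F) (baseField D) p
  legendre_red : ∀ (q : Q) (S : ℝ), HasLegendreDiffeo (reducedHamiltonian (F := F) L Λ ρ p q S)

end Setting

/-! ### Degrees of `ρ̇`, of the reduced velocity and of the action under `D`. -/

section Invariance

variable {E : Type*} [NormedAddCommGroup E] [NormedSpace ℝ E] [CompleteSpace E]
  {Q : Type*} [TopologicalSpace Q] [ChartedSpace E Q] [IsManifold 𝓘(ℝ, E) ∞ Q]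
  {F : Type*} [NormedAddCommGroup F] [NormedSpace ℝ F]
  {B : Type*} [TopologicalSpace B] [ChartedSpace F B] [IsManifold 𝓘(ℝ, F) ∞ B]
  {L : TangentBundle 𝓘(ℝ, E) Q → ℝ} {Λ : ℝ}
  {D : ∀ x : TangentBundle 𝓘(ℝ, E) Q, TangentSpace 𝓘(ℝ, E).tangent x} {ρ : Q → ℝ} {p : Q → B}

theorem contMDiff_bundleProj : ContMDiff 𝓘(ℝ, E).tangent 𝓘(ℝ, E) ∞
    (fun y : TangentBundle 𝓘(ℝ, E) Q => y.1) :=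
  Bundle.contMDiff_proj (TangentSpace 𝓘(ℝ, E))

theorem contMDiff_rhoDot (hρ : ContMDiff 𝓘(ℝ, E) 𝓘(ℝ, ℝ) ∞ ρ) :
    ContMDiff 𝓘(ℝ, E).tangent 𝓘(ℝ, ℝ) ∞ (rhoDot (E := E) ρ) :=
  (contMDiff_snd_tangentBundle_modelSpace ℝ 𝓘(ℝ, ℝ)).comp
    (hρ.contMDiff_tangentMap (m := ∞) (by simp))

theorem contMDiff_lagrangeForm_apply (hL : ContMDiff 𝓘(ℝ, E).tangent 𝓘(ℝ, ℝ) ∞ L)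
    (hD : IsBasicScalingSymmetry L Λ D) :
    ContMDiff 𝓘(ℝ, E).tangent 𝓘(ℝ, ℝ) ∞ (fun y => lagrangeForm L y (D y)) := by
  intro x
  have h1 : ContDiffAt ℝ ∞ (fun z => fderiv ℝ (L ∘ (extChartAt 𝓘(ℝ, E).tangent x).symm) z
      ((0 : E), (chartField D x z).1)) (extChartAt 𝓘(ℝ, E).tangent x x) :=
    (contDiffAt_fderiv_comp_symm hL x).clm_apply (contDiffAt_const.prodMk
      (contDiffAt_fst.comp _ (contDiffAt_chartField hD.smooth.contMDiffAt)))
  refine (h1.contMDiffAt.comp x contMDiffAt_extChartAt).congr_of_eventuallyEq ?_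
  filter_upwards [extChartAt_source_mem_nhds (I := 𝓘(ℝ, E).tangent) x] with y hy
  refine (lagrangeForm_eq hL (mem_extChartAt_tangentBundle_source.1 hy) (D y)).trans ?_
  simp only [Function.comp_apply, chartField]
  rw [(extChartAt 𝓘(ℝ, E).tangent x).left_inv hy]

/-- The derivative of a function along a field, in charts. -/
theorem fderiv_chartField_eventuallyEq {f : Q → B} (hf : ContMDiff 𝓘(ℝ, E) 𝓘(ℝ, F) ∞ f)
    (X : ∀ y : Q, TangentSpace 𝓘(ℝ, E) y) (q₀ : Q) :
    (fun u => fderiv ℝ (extChartAt 𝓘(ℝ, F) (f q₀) ∘ f ∘ (extChartAt 𝓘(ℝ, E) q₀).symm) u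
        (chartField X q₀ u)) =ᶠ[𝓝 (extChartAt 𝓘(ℝ, E) q₀ q₀)]
      fun u => mfderiv 𝓘(ℝ, F) 𝓘(ℝ, F) (extChartAt 𝓘(ℝ, F) (f q₀))
        (f ((extChartAt 𝓘(ℝ, E) q₀).symm u)) (mfderiv 𝓘(ℝ, E) 𝓘(ℝ, F) f
          ((extChartAt 𝓘(ℝ, E) q₀).symm u) (X ((extChartAt 𝓘(ℝ, E) q₀).symm u))) := by
  have hc : ContinuousAt (fun u => f ((extChartAt 𝓘(ℝ, E) q₀).symm u))
      (extChartAt 𝓘(ℝ, E) q₀ q₀) :=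
    hf.continuous.continuousAt.comp (continuousAt_extChartAt_symm q₀)
  have hmem := hc.eventually_mem (s := (extChartAt 𝓘(ℝ, F) (f q₀)).source) (by
    rw [extChartAt_to_inv]; exact extChartAt_source_mem_nhds (f q₀))
  filter_upwards [extChartAt_target_mem_nhds (I := 𝓘(ℝ, E)) q₀, hmem] with u hu hfu
  have hq := (extChartAt 𝓘(ℝ, E) q₀).map_target hu
  have h1 := mfderiv_chart_comp (hf.mdifferentiable (by simp) _) hq hfu
    (X ((extChartAt 𝓘(ℝ, E) q₀).symm u))
  rw [(extChartAt 𝓘(ℝ, E) q₀).right_inv hu] at h1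
  exact h1.symm

theorem contDiffAt_chart_comp {f : Q → B} (hf : ContMDiff 𝓘(ℝ, E) 𝓘(ℝ, F) ∞ f) (q₀ : Q) :
    ContDiffAt ℝ ∞ (extChartAt 𝓘(ℝ, F) (f q₀) ∘ f ∘ (extChartAt 𝓘(ℝ, E) q₀).symm)
      (extChartAt 𝓘(ℝ, E) q₀ q₀) := by
  have := (contMDiffAt_iff.1 (hf.contMDiffAt (x := q₀))).2
  rwa [ModelWithCorners.range_eq_univ, contDiffWithinAt_univ] at this

variable (h : IsScalingSystem F L Λ D ρ p)
include h

-- The real power `x ^ r` is smooth at every nonzero `x`, negative ones included.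
omit [CompleteSpace E] [IsManifold 𝓘(ℝ, F) ∞ B] in
theorem IsScalingSystem.contMDiff_rho_rpow (r : ℝ) :
    ContMDiff 𝓘(ℝ, E) 𝓘(ℝ, ℝ) ∞ (fun q => ρ q ^ r) := fun q =>
  ContMDiffAt.comp (g := fun x : ℝ => x ^ r) q
    (Real.contDiffAt_rpow_const_of_ne (h.rho_ne q)).contMDiffAt h.smooth_rho.contMDiffAt

omit [CompleteSpace E] [IsManifold 𝓘(ℝ, F) ∞ B] in
theorem IsScalingSystem.baseField_ne (q : Q) : baseField D q ≠ 0 := by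
  intro h0
  have h1 := h.rho_scaling q
  rw [h0] at h1
  exact h.rho_ne q (h1.symm.trans (map_zero (mfderiv 𝓘(ℝ, E) 𝓘(ℝ, ℝ) ρ q)))

omit [CompleteSpace E] [IsManifold 𝓘(ℝ, F) ∞ B] in
theorem IsScalingSystem.mfderiv_p_baseField (q : Q) :
    mfderiv 𝓘(ℝ, E) 𝓘(ℝ, F) p q (baseField D q) = 0 :=
  (h.quot.ker_eq q _).2 ⟨1, (one_smul _ _).symm⟩

omit [IsManifold 𝓘(ℝ, F) ∞ B] in
theorem IsScalingSystem.dirDeriv_rho (x : TangentBundle 𝓘(ℝ, E) Q) :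
    dirDeriv 𝓘(ℝ, E).tangent (fun y : TangentBundle 𝓘(ℝ, E) Q => ρ y.1) x (D x) = ρ x.1 := by
  rw [dirDeriv_comp_map (h.smooth_rho.mdifferentiable (by simp) _)
    (contMDiff_bundleProj.mdifferentiable (by simp) x), ← h.rho_scaling]
  exact congrArg (fun v => dirDeriv 𝓘(ℝ, E) ρ x.1 v)
    (h.symm.projDeriv_eq h.smooth h.legendre x)

-- Since `ρ` is reproduced by the base field, `fderiv_tangent_scaling` gives the degree 1 + (Λ - 1)
-- = Λ.
omit [IsManifold 𝓘(ℝ, F) ∞ B] in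
theorem IsScalingSystem.dirDeriv_rhoDot (x : TangentBundle 𝓘(ℝ, E) Q) :
    dirDeriv 𝓘(ℝ, E).tangent (rhoDot ρ) x (D x) = Λ * rhoDot ρ x := by
  set u := extChartAt 𝓘(ℝ, E) x.1 x.1 with hu
  set f : E → ℝ := extChartAt 𝓘(ℝ, ℝ) (ρ x.1) ∘ ρ ∘ (extChartAt 𝓘(ℝ, E) x.1).symm with hf
  have hfs : ContDiffAt ℝ ∞ f u := contDiffAt_chart_comp h.smooth_rho x.1
  have hmf : ∀ (r s v : ℝ), mfderiv 𝓘(ℝ, ℝ) 𝓘(ℝ, ℝ) (extChartAt 𝓘(ℝ, ℝ) r) s v = v := by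
    intro r s v
    have : (extChartAt 𝓘(ℝ, ℝ) r : ℝ → ℝ) = id := by rw [extChartAt_model_space_eq_id]; rfl
    rw [this]
    exact DFunLike.congr_fun (mfderiv_id (I := 𝓘(ℝ, ℝ))) v
  have h1 : rhoDot ρ ∘ (extChartAt 𝓘(ℝ, E).tangent x).symm =ᶠ[𝓝 (Prod.mk (β := E) u x.2)]
      fun z => fderiv ℝ f z.1 z.2 := by
    have hx := extChartAt_target_mem_nhds (I := 𝓘(ℝ, E).tangent) x
    rw [extChartAt_tangentBundle_self] at hx
    filter_upwards [hx] with z hz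
    have hys := (extChartAt 𝓘(ℝ, E).tangent x).map_target hz
    have hq := mem_extChartAt_tangentBundle_source.1 hys
    have hez := (extChartAt 𝓘(ℝ, E).tangent x).right_inv hz
    rw [extChartAt_tangentBundle_apply hq] at hez
    have h2 := mfderiv_chart_comp (h.smooth_rho.mdifferentiable (by simp) _) hq (by
        rw [extChartAt_model_space_eq_id]; exact mem_univ _)
      ((extChartAt 𝓘(ℝ, E).tangent x).symm z).2
    have h3 := (hmf _ _ _).symm.trans h2
    refine h3.trans ?_
    exact congrArg (fun w : E × E => fderiv ℝ f w.1 w.2) hez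
  have h2 := mfderiv_eq_fderiv_comp_symm (E := E × E)
    ((contMDiff_rhoDot h.smooth_rho).mdifferentiable (by simp) x) (D x)
  rw [extChartAt_tangentBundle_self, h1.fderiv_eq] at h2
  replace h2 := h2.trans (congrArg (fun w : E × E => fderiv ℝ (fun z : E × E => fderiv ℝ f z.1 z.2)
    (Prod.mk (β := E) u x.2) w) (h.symm.chart_eq h.smooth h.legendre x))
  have h3 : (fun u' => fderiv ℝ f u' (chartField (baseField D) x.1 u')) =ᶠ[𝓝 u] f := by
    filter_upwards [fderiv_chartField_eventuallyEq h.smooth_rho (baseField D) x.1] with u' hu'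
    refine hu'.trans ((hmf _ _ _).trans ((h.rho_scaling _).trans ?_))
    rw [hf, extChartAt_model_space_eq_id]
    rfl
  have h4 := fderiv_tangent_scaling (Λ := Λ) hfs
    ((h.symm.contDiffAt_baseField h.smooth h.legendre x.1).differentiableAt (by simp)) h3 x.2
  have h5 : fderiv ℝ f u x.2 = rhoDot ρ x := by
    have h6 := h1.self_of_nhds
    refine h6.symm.trans ?_
    rw [Function.comp_apply, ← extChartAt_tangentBundle_self, extChartAt_to_inv]
  have h7 := h2.trans h4
  have h8 : ∀ r : ℝ, r + (Λ - 1) • r = Λ * r := by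
    intro r
    rw [smul_eq_mul]
    ring
  exact h7.trans ((congrArg (fun r : ℝ => r + (Λ - 1) • r) h5).trans (h8 _))

/-- The velocity component of the projection is invariant under the scaling symmetry. -/
theorem IsScalingSystem.mfderiv_scaledTangentMap (x : TangentBundle 𝓘(ℝ, E) Q) :
    mfderiv 𝓘(ℝ, E).tangent 𝓘(ℝ, F).tangent
      (scaledTangentMap (E := E) (F := F) (fun q => ρ q ^ (1 - Λ)) p) x (D x) = 0 := by
  set s : Q → ℝ := fun q => ρ q ^ (1 - Λ) with hs
  have hss : ContMDiff 𝓘(ℝ, E) 𝓘(ℝ, ℝ) ∞ s := h.contMDiff_rho_rpow _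
  set u := extChartAt 𝓘(ℝ, E) x.1 x.1 with hu
  set f : E → F := extChartAt 𝓘(ℝ, F) (p x.1) ∘ p ∘ (extChartAt 𝓘(ℝ, E) x.1).symm with hf
  set σ : E → ℝ := s ∘ (extChartAt 𝓘(ℝ, E) x.1).symm with hσ
  set A := chartField (baseField D) x.1 with hA
  have hfs : ContDiffAt ℝ ∞ f u := contDiffAt_chart_comp h.quot.smooth x.1
  have hσs : ContDiffAt ℝ ∞ σ u := by
    have := contDiffAt_chart_comp hss x.1
    rw [extChartAt_model_space_eq_id] at this
    exact this
  have h1 := (((contMDiff_scaledTangentMap hss h.quot.smooth).mdifferentiable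
    (by simp)) x).mfderiv
  have h2 := scaledTangentMap_chart (s := s) h.quot.smooth x
  rw [extChartAt_tangentBundle_self] at h2
  have hrange : range 𝓘(ℝ, E).tangent = univ := ModelWithCorners.range_eq_univ _
  rw [hrange, fderivWithin_univ, extChartAt_tangentBundle_self] at h1
  have h3 := h1.trans h2.fderiv_eq
  refine (DFunLike.congr_fun h3 (D x)).trans ?_
  have hAd : DifferentiableAt ℝ A u :=
    (h.symm.contDiffAt_baseField h.smooth h.legendre x.1).differentiableAt (by simp)
  -- The base field spans the kernel of `dp`, so `dp(v)` has degree Λ - 1. The factor `ρ^(1-Λ)` has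
  -- degree 1 - Λ by `hσ'`, and the two contributions cancel.
  have h4 : (fun u' => fderiv ℝ f u' (A u')) =ᶠ[𝓝 u] fun _ => 0 := by
    filter_upwards [fderiv_chartField_eventuallyEq h.quot.smooth (baseField D) x.1] with u' hu'
    refine hu'.trans ?_
    rw [h.mfderiv_p_baseField]
    exact map_zero (mfderiv 𝓘(ℝ, F) 𝓘(ℝ, F) (extChartAt 𝓘(ℝ, F) (p x.1)) _)
  have h5 := fderiv_tangent_scaling (Λ := Λ) hfs hAd h4 x.2
  have hσ' : fderiv ℝ σ u (A u) = (1 - Λ) * σ u := by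
    have e1 := mfderiv_eq_fderiv_comp_symm (hss.mdifferentiable (by simp) x.1) (baseField D x.1)
    have e2 := dirDeriv_comp_real (φ := fun r => r ^ (1 - Λ))
      (Real.hasDerivAt_rpow_const (Or.inl (h.rho_ne x.1)))
      (h.smooth_rho.mdifferentiable (by simp) x.1) (baseField D x.1)
    rw [h.rho_scaling, Real.rpow_sub_one (h.rho_ne x.1)] at e2
    have e3 : σ u = ρ x.1 ^ (1 - Λ) := by
      simp only [hσ, hs, Function.comp_apply, hu, extChartAt_to_inv]
    have e4 : A u = baseField D x.1 := chartField_self (baseField D) x.1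
    rw [e3, e4]
    refine e1.symm.trans (e2.trans ?_)
    field_simp [h.rho_ne x.1]
  have hd1 : HasFDerivAt (fun z : E × E => f z.1) ((fderiv ℝ f u).comp
      (ContinuousLinearMap.fst ℝ E E)) (Prod.mk (β := E) u x.2) :=
    HasFDerivAt.comp (g := f) (Prod.mk (β := E) u x.2) (hfs.differentiableAt (by simp)).hasFDerivAt
      hasFDerivAt_fst
  have hd2 : HasFDerivAt (fun z : E × E => σ z.1) ((fderiv ℝ σ u).comp
      (ContinuousLinearMap.fst ℝ E E)) (Prod.mk (β := E) u x.2) :=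
    HasFDerivAt.comp (g := σ) (Prod.mk (β := E) u x.2) (hσs.differentiableAt (by simp)).hasFDerivAt
      hasFDerivAt_fst
  have hd3 := hasFDerivAt_tangent hfs x.2
  have hd4 := (hd1.prodMk (hd2.smul hd3)).fderiv
  rw [h.symm.chart_eq h.smooth h.legendre x]
  refine (DFunLike.congr_fun hd4 _).trans ?_
  rw [hd3.fderiv] at h5
  refine Prod.ext h4.self_of_nhds ?_
  change σ u • (_ : F) + (fderiv ℝ σ u (A u)) • (fderiv ℝ f u x.2) = 0
  rw [hσ']
  refine (congrArg (fun w : F => σ u • w + _) h5).trans ?_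
  have h6 : ∀ (T : E →L[ℝ] F) (v : E) (r : ℝ) (w : F), T = 0 →
      r • (T v + (Λ - 1) • w) + ((1 - Λ) * r) • w = 0 := by
    rintro T v r w rfl
    simp only [zero_apply, zero_add, smul_smul, ← add_smul]
    rw [show r * (Λ - 1) + (1 - Λ) * r = 0 by ring, zero_smul]
  exact h6 _ _ _ _ (by simp)

theorem IsScalingSystem.contMDiff_scaleAction :
    ContMDiff 𝓘(ℝ, E).tangent 𝓘(ℝ, ℝ) ∞ (scaleAction L D ρ) := by
  have h1 := contMDiff_lagrangeForm_apply h.smooth h.symm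
  have h2 : ContMDiff 𝓘(ℝ, E).tangent 𝓘(ℝ, ℝ) ∞ (fun y : TangentBundle 𝓘(ℝ, E) Q => (ρ y.1)⁻¹) :=
    fun x => ContMDiffAt.comp (g := fun r : ℝ => r⁻¹) x
      (contDiffAt_inv ℝ (h.rho_ne x.1)).contMDiffAt
      (h.smooth_rho.comp contMDiff_bundleProj).contMDiffAt
  have h3 := h1.neg.mul h2
  exact h3.congr fun x => div_eq_mul_inv _ _

/-- Evaluating `L_D λ_L = λ_L` on `D` itself kills the bracket, so `λ_L(D)` has degree one, like
`ρ`; their quotient has degree zero. -/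
theorem IsScalingSystem.dirDeriv_scaleAction (x : TangentBundle 𝓘(ℝ, E) Q) :
    dirDeriv 𝓘(ℝ, E).tangent (scaleAction L D ρ) x (D x) = 0 := by
  have h1 := h.symm.form x D h.symm.smooth.contMDiffAt
  rw [VectorField.mlieBracket_self, Pi.zero_apply, map_zero, sub_zero] at h1
  have hm : MDifferentiableAt 𝓘(ℝ, E).tangent 𝓘(ℝ, ℝ) (fun y => lagrangeForm L y (D y)) x :=
    (contMDiff_lagrangeForm_apply h.smooth h.symm).mdifferentiable (by simp) x
  have hr : MDifferentiableAt 𝓘(ℝ, E).tangent 𝓘(ℝ, ℝ)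
      (fun y : TangentBundle 𝓘(ℝ, E) Q => ρ y.1) x :=
    (h.smooth_rho.comp contMDiff_bundleProj).mdifferentiable (by simp) x
  have hS : MDifferentiableAt 𝓘(ℝ, E).tangent 𝓘(ℝ, ℝ) (scaleAction L D ρ) x :=
    h.contMDiff_scaleAction.mdifferentiable (by simp) x
  have h2 := dirDeriv_mul hS hr (D x)
  have h3 : (fun y : TangentBundle 𝓘(ℝ, E) Q => scaleAction L D ρ y * ρ y.1) =
      fun y => (-1 : ℝ) * lagrangeForm L y (D y) := by
    funext y
    rw [scaleAction, div_mul_cancel₀ _ (h.rho_ne y.1), neg_one_mul]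
  have h4 : dirDeriv 𝓘(ℝ, E).tangent (fun y => (-1 : ℝ) * lagrangeForm L y (D y)) x (D x) =
      -1 * dirDeriv 𝓘(ℝ, E).tangent (fun y => lagrangeForm L y (D y)) x (D x) :=
    dirDeriv_comp_real (φ := fun r => -1 * r) (by simpa using (hasDerivAt_id _).const_mul (-1 : ℝ))
      hm _
  rw [h3, h4, h1, h.dirDeriv_rho, scaleAction] at h2
  have h5 : dirDeriv 𝓘(ℝ, E).tangent (scaleAction L D ρ) x (D x) * ρ x.1 = 0 := by
    have := h.rho_ne x.1
    field_simp at h2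
    linarith
  exact (mul_eq_zero.1 h5).resolve_right (h.rho_ne x.1)

end Invariance

/-! ### Legendre duality between the reduced Hamiltonian and the reduced velocity. -/

section LegendreDuality

variable {E : Type*} [NormedAddCommGroup E] [NormedSpace ℝ E]
  {F : Type*} [NormedAddCommGroup F] [NormedSpace ℝ F]

theorem HasLegendreDiffeo.contDiff_invFun {f : E → ℝ} (hf : HasLegendreDiffeo f) :
    ContDiff ℝ ∞ (Function.invFun (fderiv ℝ f)) := by
  have hb := hf.bijective
  obtain ⟨hs, g, hg, hl, hr⟩ := hf
  have : Function.invFun (fderiv ℝ f) = g := by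
    funext α
    apply hb.1
    rw [hr α, Function.rightInverse_invFun hb.2 α]
  rwa [this]

/-- Envelope property: the motion of the point `v` with `df_v = α` contributes `α(δv) - df_v(δv) =
0`. -/
theorem HasLegendreDiffeo.hasFDerivAt_legendreDual {f : E → ℝ} (hf : HasLegendreDiffeo f)
    (hd : Differentiable ℝ f) (α : E →L[ℝ] ℝ) :
    HasFDerivAt (legendreDual f)
      (ContinuousLinearMap.apply ℝ ℝ (Function.invFun (fderiv ℝ f) α)) α := by
  have h1 := (hf.contDiff_invFun.differentiable (by simp) α).hasFDerivAt
  have h2 := (hasFDerivAt_id (𝕜 := ℝ) α).clm_apply h1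
  have h3 := (hd (Function.invFun (fderiv ℝ f) α)).hasFDerivAt.comp α h1
  rw [Function.rightInverse_invFun hf.bijective.2 α] at h3
  refine (h2.sub h3).congr_fderiv ?_
  ext β
  simp

variable {f : E → ℝ} (hf : HasLegendreDiffeo f) (hd : Differentiable ℝ f)
  {m : E →L[ℝ] F} {η : E →L[ℝ] ℝ} {A : E} {r μ : ℝ} (hr : r ≠ 0)
  (hm : Function.Surjective m) (hker : ∀ v, m v = 0 ↔ ∃ c : ℝ, v = c • A) (hη : η A = r)
  (hred : ∀ S : ℝ, HasLegendreDiffeo fun P : F →L[ℝ] ℝ =>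
    -(legendreDual f (-(r • P.comp m) - S • η)) / μ)

-- As `m A = 0` and `η A = r`, evaluation on `A` fixes the coefficient of `η`. The remainder
-- vanishes on the kernel of `m`, the line through `A`, and so factors through `m`.
include hm hker hη hr in
theorem exists_covector_eq [FiniteDimensional ℝ F] (α : E →L[ℝ] ℝ) :
    ∃ P : F →L[ℝ] ℝ, α = -(r • P.comp m) - (-(α A) / r) • η := by
  obtain ⟨s, hs⟩ := (m : E →ₗ[ℝ] F).exists_rightInverse_of_surjective
    (LinearMap.range_eq_top.2 hm)
  have hs' : ∀ w, m (s w) = w := fun w => DFunLike.congr_fun hs w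
  let β : E →L[ℝ] ℝ := α - (α A / r) • η
  have hβ : β A = 0 := by
    simp [β, hη]
    field_simp
    ring
  refine ⟨LinearMap.toContinuousLinearMap (-(1 / r) • (β : E →ₗ[ℝ] ℝ).comp s), ?_⟩
  ext v
  obtain ⟨c, hc⟩ := (hker (v - s (m v))).1 (by rw [map_sub, hs', sub_self])
  have h1 : β v = β (s (m v)) := by
    have := congrArg β hc
    rw [map_sub, map_smul, hβ, smul_zero, sub_eq_zero] at this
    exact this
  have h2 : β v = α v - α A / r * η v := by simp [β]
  simp only [sub_apply, neg_apply, smul_apply, smul_eq_mul, ContinuousLinearMap.comp_apply,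
    LinearMap.coe_toContinuousLinearMap', LinearMap.smul_apply, LinearMap.comp_apply,
    ContinuousLinearMap.coe_coe]
  rw [← h1, h2]
  field_simp
  ring

-- With `r = ρ` and `μ = ρ^Λ`, the vector on the right is the reduced velocity of the `v` whose
-- momentum corresponds to `(P, S)`. This is what makes the Legendre transform of the reduced
-- Hamiltonian relevant to π.
include hf hd in
theorem fderiv_reduced (S : ℝ) (P P' : F →L[ℝ] ℝ) :
    fderiv ℝ (fun P : F →L[ℝ] ℝ => -(legendreDual f (-(r • P.comp m) - S • η)) / μ) P P' =
      P' ((r / μ) • m (Function.invFun (fderiv ℝ f) (-(r • P.comp m) - S • η))) := by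
  have h1 : HasFDerivAt (fun P : F →L[ℝ] ℝ => -(r • P.comp m) - S • η)
      (-(r • (ContinuousLinearMap.compL ℝ E F ℝ).flip m)) P :=
    (((((ContinuousLinearMap.compL ℝ E F ℝ).flip m).hasFDerivAt).const_smul r).neg).sub_const _
  have h2 := ((hf.hasFDerivAt_legendreDual hd _).comp P h1).neg.mul_const μ⁻¹
  simp only [div_eq_mul_inv]
  refine (DFunLike.congr_fun h2.fderiv P').trans ?_
  simp [ContinuousLinearMap.compL_apply]
  ring

include hf hd hred in
/-- The velocity component of the reduction, on the level sets of the action. -/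
theorem reduced_velocity_bijective [FiniteDimensional ℝ F] (S : ℝ) :
    Function.Bijective fun P : F →L[ℝ] ℝ =>
      (r / μ) • m (Function.invFun (fderiv ℝ f) (-(r • P.comp m) - S • η)) := by
  have hb := (hred S).bijective
  constructor
  · intro P₁ P₂ h12
    apply hb.1
    ext P'
    rw [fderiv_reduced hf hd, fderiv_reduced hf hd]
    exact congrArg P' h12
  · intro w
    obtain ⟨P, hP⟩ := hb.2 (ContinuousLinearMap.apply ℝ ℝ w)
    refine ⟨P, ?_⟩
    by_contra hne
    obtain ⟨P', hP'⟩ := SeparatingDual.exists_separating_of_ne (R := ℝ) hne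
    apply hP'
    have := DFunLike.congr_fun hP P'
    rw [fderiv_reduced hf hd] at this
    exact this

-- Momentum is equivalent to `(P, S)` by `exists_covector_eq`, with `S` the second component. At
-- fixed `S`, the reduced Legendre transform exchanges `P` for the first component.
include hf hd hr hm hker hη hred in
theorem fibre_reduction_bijective [FiniteDimensional ℝ F] :
    Function.Bijective fun v : E => ((r / μ) • m v, -(fderiv ℝ f v A) / r) := by
  have hmA : m A = 0 := (hker A).2 ⟨1, (one_smul _ _).symm⟩
  constructor
  · intro v₁ v₂ h12
    obtain ⟨hm12, hS⟩ := Prod.ext_iff.1 h12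
    obtain ⟨P₁, h1⟩ := exists_covector_eq hr hm hker hη (fderiv ℝ f v₁)
    obtain ⟨P₂, h2⟩ := exists_covector_eq hr hm hker hη (fderiv ℝ f v₂)
    have hinv : ∀ v, Function.invFun (fderiv ℝ f) (fderiv ℝ f v) = v :=
      Function.leftInverse_invFun hf.bijective.1
    dsimp only at hm12 hS
    rw [← hS] at h2
    have h3 : P₁ = P₂ := by
      apply (reduced_velocity_bijective hf hd hred (-(fderiv ℝ f v₁ A) / r)).1
      dsimp only
      rw [← h1, ← h2, hinv, hinv]
      exact hm12
    apply hf.bijective.1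
    rw [h1, h2, h3]
  · rintro ⟨w, S⟩
    obtain ⟨P, hP⟩ := (reduced_velocity_bijective hf hd hred S).2 w
    refine ⟨Function.invFun (fderiv ℝ f) (-(r • P.comp m) - S • η), Prod.ext hP ?_⟩
    change -(fderiv ℝ f _ A) / r = S
    rw [Function.rightInverse_invFun hf.bijective.2]
    simp [hmA, hη, hr]

-- Infinitesimal form of the same argument. A direction `β` that changes neither component changes
-- the momentum only through some `P'`, and `P'` lies in the kernel of the Hessian of the reduced
-- Hamiltonian. So `P' = 0`, the momentum does not change, and `β = 0`.
include hf hd hr hm hker hη hred in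
theorem fibre_reduction_fderiv_injective [FiniteDimensional ℝ F] (v : E) {β : E} (h1 : m β = 0)
    (h2 : fderiv ℝ (fderiv ℝ f) v β A = 0) : β = 0 := by
  obtain ⟨P, hP⟩ := exists_covector_eq hr hm hker hη (fderiv ℝ f v)
  obtain ⟨P', hP'⟩ := exists_covector_eq hr hm hker hη (fderiv ℝ (fderiv ℝ f) v β)
  set S := -(fderiv ℝ f v A) / r
  rw [h2, neg_zero, zero_div, zero_smul, sub_zero] at hP'
  have hinv : ∀ v, Function.invFun (fderiv ℝ f) (fderiv ℝ f v) = v :=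
    Function.leftInverse_invFun hf.bijective.1
  have hfd := (hf.1.differentiable (by simp) v).hasFDerivAt
  have hgd := (hf.contDiff_invFun.differentiable (by simp) (fderiv ℝ f v)).hasFDerivAt
  have h3 : fderiv ℝ (Function.invFun (fderiv ℝ f)) (fderiv ℝ f v)
      (fderiv ℝ (fderiv ℝ f) v β) = β := by
    have h4 := hgd.comp v hfd
    rw [show Function.invFun (fderiv ℝ f) ∘ fderiv ℝ f = id from funext hinv] at h4
    exact DFunLike.congr_fun (h4.unique (hasFDerivAt_id v)) β
  have h5 : HasFDerivAt (fun P : F →L[ℝ] ℝ => -(r • P.comp m) - S • η)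
      (-(r • (ContinuousLinearMap.compL ℝ E F ℝ).flip m)) P :=
    (((((ContinuousLinearMap.compL ℝ E F ℝ).flip m).hasFDerivAt).const_smul r).neg).sub_const _
  rw [hP] at hgd h3
  have h6 := hgd.comp P h5
  have h7 : P' = 0 := by
    apply (hred S).hessian_injective P
    ext P''
    have h8 : (fun P₁ => fderiv ℝ (fun P : F →L[ℝ] ℝ =>
        -(legendreDual f (-(r • P.comp m) - S • η)) / μ) P₁ P'') = fun P₁ =>
        P'' ((r / μ) • m (Function.invFun (fderiv ℝ f) (-(r • P₁.comp m) - S • η))) :=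
      funext fun P₁ => fderiv_reduced hf hd S P₁ P''
    have h9 := ((P''.comp ((r / μ) • m)).hasFDerivAt.comp P h6).fderiv
    have h10 := ((hred S).1.differentiable (by simp) P).hasFDerivAt.clm_apply
      (hasFDerivAt_const P'' P)
    have h11 := h10.fderiv
    rw [h8] at h11
    have h12 := DFunLike.congr_fun (h11.symm.trans h9) P'
    have h13 : (P''.comp ((r / μ) • m)) (fderiv ℝ (Function.invFun (fderiv ℝ f))
        (-(r • P.comp m) - S • η) (-(r • P'.comp m))) = 0 := by
      rw [← hP', h3]
      simp [h1]
    have h14 := h12.trans h13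
    simpa using h14
  rw [h7] at hP'
  apply hf.hessian_injective v
  rw [hP']
  simp

end LegendreDuality

/-! ### The reduction map on a fibre of `TQ`. -/

section Fibre

variable {E : Type*} [NormedAddCommGroup E] [NormedSpace ℝ E] [CompleteSpace E]
  {Q : Type*} [TopologicalSpace Q] [ChartedSpace E Q] [IsManifold 𝓘(ℝ, E) ∞ Q]
  {F : Type*} [NormedAddCommGroup F] [NormedSpace ℝ F] [FiniteDimensional ℝ F]
  {B : Type*} [TopologicalSpace B] [ChartedSpace F B] [IsManifold 𝓘(ℝ, F) ∞ B]
  {L : TangentBundle 𝓘(ℝ, E) Q → ℝ} {Λ : ℝ}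
  {D : ∀ x : TangentBundle 𝓘(ℝ, E) Q, TangentSpace 𝓘(ℝ, E).tangent x} {ρ : Q → ℝ} {p : Q → B}
  (h : IsScalingSystem F L Λ D ρ p)
include h

/-- A real power of a negative number carries a factor cos(πΛ), which may vanish; a positive base or
an integral exponent excludes this. -/
theorem IsScalingSystem.rho_rpow_ne (q : Q) : ρ q ^ Λ ≠ 0 := by
  rcases h.pow with hp | ⟨n, rfl⟩
  · exact (Real.rpow_pos_of_pos (hp q) _).ne'
  · rw [Real.rpow_intCast]
    exact zpow_ne_zero _ (h.rho_ne q)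

theorem IsScalingSystem.rho_div_rpow (q : Q) : ρ q / ρ q ^ Λ = ρ q ^ (1 - Λ) := by
  rcases h.pow with hp | ⟨n, rfl⟩
  · rw [Real.rpow_sub (hp q), Real.rpow_one]
  · rw [Real.rpow_sub_intCast (h.rho_ne q), Real.rpow_one, Real.rpow_intCast]

theorem IsScalingSystem.rho_rpow_one_sub_ne (q : Q) : ρ q ^ (1 - Λ) ≠ 0 := by
  rw [← h.rho_div_rpow]
  exact div_ne_zero (h.rho_ne q) (h.rho_rpow_ne q)

theorem IsScalingSystem.scaleAction_eq (x : TangentBundle 𝓘(ℝ, E) Q) :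
    scaleAction L D ρ x = -(fibreDeriv L x (baseField D x.1)) / ρ x.1 := by
  rw [scaleAction, lagrangeForm, ContinuousLinearMap.comp_apply,
    h.symm.projDeriv_eq h.smooth h.legendre]

theorem IsScalingSystem.differentiable_fibreLagrangian (q : Q) :
    Differentiable ℝ (fibreLagrangian L q) :=
  (contDiff_fibreLagrangian h.smooth q).differentiable (by simp)

theorem IsScalingSystem.fibre_bijective (q : Q) : Function.Bijective fun v : E =>
    (ρ q ^ (1 - Λ) • (show E →L[ℝ] F from mfderiv 𝓘(ℝ, E) 𝓘(ℝ, F) p q) v,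
      scaleAction L D ρ ⟨q, v⟩) := by
  have h1 := fibre_reduction_bijective (h.legendre q) (h.differentiable_fibreLagrangian q)
    (m := show E →L[ℝ] F from mfderiv 𝓘(ℝ, E) 𝓘(ℝ, F) p q)
    (η := show E →L[ℝ] ℝ from mfderiv 𝓘(ℝ, E) 𝓘(ℝ, ℝ) ρ q) (A := baseField D q)
    (h.rho_ne q) (h.quot.submersion q) (h.quot.ker_eq q) (h.rho_scaling q)
    (μ := ρ q ^ Λ) (h.legendre_red q)
  rw [h.rho_div_rpow] at h1
  convert h1 using 3
  exact h.scaleAction_eq _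

theorem IsScalingSystem.hasFDerivAt_scaleAction (q : Q) (v : E) :
    HasFDerivAt (fun v : E => scaleAction L D ρ ⟨q, v⟩)
      (-(ρ q)⁻¹ • (fderiv ℝ (fderiv ℝ (fibreLagrangian L q)) v).flip (baseField D q)) v := by
  have h1 := ((h.legendre q).1.differentiable (by simp) v).hasFDerivAt.clm_apply
    (hasFDerivAt_const (show E from baseField D q) v)
  have h2 := h1.const_smul (-(ρ q)⁻¹)
  have h3 : (fun v : E => scaleAction L D ρ ⟨q, v⟩) = fun v =>
      -(ρ q)⁻¹ • fderiv ℝ (fibreLagrangian L q) v (baseField D q) := by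
    funext v
    rw [h.scaleAction_eq, smul_eq_mul, neg_div, div_eq_inv_mul, neg_mul]
    rfl
  rw [h3]
  refine h2.congr_fderiv ?_
  simp

theorem IsScalingSystem.fibre_fderiv_injective (q : Q) (v : E) {β : E}
    (h1 : (mfderiv 𝓘(ℝ, E) 𝓘(ℝ, F) p q β : F) = 0)
    (h2 : fderiv ℝ (fun v : E => scaleAction L D ρ ⟨q, v⟩) v β = 0) : β = 0 := by
  rw [(h.hasFDerivAt_scaleAction q v).fderiv] at h2
  have h3 : fderiv ℝ (fderiv ℝ (fibreLagrangian L q)) v β (baseField D q) = 0 := by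
    have h4 : -(ρ q)⁻¹ * fderiv ℝ (fderiv ℝ (fibreLagrangian L q)) v β (baseField D q) = 0 := h2
    exact (mul_eq_zero.1 h4).resolve_left (neg_ne_zero.2 (inv_ne_zero (h.rho_ne q)))
  exact fibre_reduction_fderiv_injective (h.legendre q) (h.differentiable_fibreLagrangian q)
    (m := show E →L[ℝ] F from mfderiv 𝓘(ℝ, E) 𝓘(ℝ, F) p q)
    (η := show E →L[ℝ] ℝ from mfderiv 𝓘(ℝ, E) 𝓘(ℝ, ℝ) ρ q) (A := baseField D q)
    (h.rho_ne q) (h.quot.submersion q) (h.quot.ker_eq q) (h.rho_scaling q)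
    (μ := ρ q ^ Λ) (h.legendre_red q) v h1 h3

end Fibre

/-! ### Vertical tangent vectors. -/

section Vertical

variable {E : Type*} [NormedAddCommGroup E] [NormedSpace ℝ E]
  {Q : Type*} [TopologicalSpace Q] [ChartedSpace E Q] [IsManifold 𝓘(ℝ, E) ∞ Q]

theorem mfderiv_fibreInclusion (q : Q) (v β : E) :
    mfderiv 𝓘(ℝ, E) 𝓘(ℝ, E).tangent (fun v : E => (⟨q, v⟩ : TangentBundle 𝓘(ℝ, E) Q)) v β =
      Prod.mk (α := E) (β := E) 0 β := by
  have h1 := ((contMDiff_fibreInclusion q).mdifferentiable (by simp) v).mfderiv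
  rw [show range 𝓘(ℝ, E) = univ from ModelWithCorners.range_eq_univ _, fderivWithin_univ] at h1
  have h2 : writtenInExtChartAt 𝓘(ℝ, E) 𝓘(ℝ, E).tangent v
      (fun v : E => (⟨q, v⟩ : TangentBundle 𝓘(ℝ, E) Q)) =
      fun v' => Prod.mk (α := E) (β := E) (extChartAt 𝓘(ℝ, E) q q) v' := by
    funext v'
    have h3 : extChartAt 𝓘(ℝ, E).tangent (⟨q, v⟩ : TangentBundle 𝓘(ℝ, E) Q) ⟨q, v'⟩ =
        Prod.mk (α := E) (β := E) (extChartAt 𝓘(ℝ, E) q q) v' :=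
      (extChartAt_tangentBundle_apply (x := ⟨q, v⟩) (y := ⟨q, v'⟩)
        (mem_extChartAt_source q)).trans
        (congrArg (Prod.mk (α := E) (β := E) _) (mfderiv_extChartAt_self_apply q v'))
    simp only [writtenInExtChartAt, extChartAt_model_space_eq_id, Function.comp_apply,
      PartialEquiv.refl_symm, PartialEquiv.refl_coe, id]
    exact h3
  rw [h2] at h1
  have h3 : HasFDerivAt (fun v' : E => Prod.mk (α := E) (β := E) (extChartAt 𝓘(ℝ, E) q q) v')
      ((0 : E →L[ℝ] E).prod (ContinuousLinearMap.id ℝ E)) (extChartAt 𝓘(ℝ, E) v v) :=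
    (hasFDerivAt_const _ _).prodMk (hasFDerivAt_id _)
  rw [h3.fderiv] at h1
  exact DFunLike.congr_fun h1 β

end Vertical

/-! ### Dimension counts for linear maps whose kernel is a line. -/

section LinearAlgebra

variable {V W : Type*} [NormedAddCommGroup V] [NormedSpace ℝ V] [FiniteDimensional ℝ V]
  [NormedAddCommGroup W] [NormedSpace ℝ W] (m : V →L[ℝ] W) {a : V} (ha : a ≠ 0)
  (hker : ∀ v, m v = 0 ↔ ∃ c : ℝ, v = c • a)
include ha hker

theorem finrank_range_add_one :
    Module.finrank ℝ (LinearMap.range (m : V →ₗ[ℝ] W)) + 1 = Module.finrank ℝ V := by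
  rw [← (m : V →ₗ[ℝ] W).finrank_range_add_finrank_ker, ← finrank_span_singleton (K := ℝ) ha]
  have : LinearMap.ker (m : V →ₗ[ℝ] W) = Submodule.span ℝ {a} := by
    ext v
    rw [LinearMap.mem_ker, Submodule.mem_span_singleton]
    refine (hker v).trans ?_
    simp only [eq_comm]
  rw [this]

theorem finrank_eq_add_one (hm : Function.Surjective m) :
    Module.finrank ℝ V = Module.finrank ℝ W + 1 := by
  rw [← finrank_range_add_one m ha hker, LinearMap.range_eq_top.2 hm, finrank_top]

theorem surjective_of_finrank_eq [FiniteDimensional ℝ W]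
    (hd : Module.finrank ℝ V = Module.finrank ℝ W + 1) : Function.Surjective m := by
  apply LinearMap.range_eq_top.1
  apply Submodule.eq_top_of_finrank_eq
  have := finrank_range_add_one m ha hker
  omega

end LinearAlgebra

/-! ### Kernel, rank and injectivity properties of π. -/

section Quotient

variable {E : Type*} [NormedAddCommGroup E] [NormedSpace ℝ E] [FiniteDimensional ℝ E]
  {Q : Type*} [TopologicalSpace Q] [ChartedSpace E Q] [IsManifold 𝓘(ℝ, E) ∞ Q]
  {F : Type*} [NormedAddCommGroup F] [NormedSpace ℝ F] [FiniteDimensional ℝ F]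
  {B : Type*} [TopologicalSpace B] [ChartedSpace F B] [IsManifold 𝓘(ℝ, F) ∞ B]
  {L : TangentBundle 𝓘(ℝ, E) Q → ℝ} {Λ : ℝ}
  {D : ∀ x : TangentBundle 𝓘(ℝ, E) Q, TangentSpace 𝓘(ℝ, E).tangent x} {ρ : Q → ℝ} {p : Q → B}
  (h : IsScalingSystem F L Λ D ρ p)
include h

theorem IsScalingSystem.finrank_eq : Module.finrank ℝ E = Module.finrank ℝ F + 1 ∨ IsEmpty Q := by
  rcases isEmpty_or_nonempty Q with hQ | ⟨⟨q⟩⟩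
  · exact Or.inr hQ
  left
  exact finrank_eq_add_one (V := E) (W := F) (mfderiv 𝓘(ℝ, E) 𝓘(ℝ, F) p q)
    (h.baseField_ne q) (h.quot.ker_eq q) (h.quot.submersion q)

theorem IsScalingSystem.contMDiff_scaleProj :
    ContMDiff 𝓘(ℝ, E).tangent (𝓘(ℝ, F).tangent.prod 𝓘(ℝ, ℝ)) ∞
      (scaleProj (F := F) L Λ D ρ p) :=
  (contMDiff_scaledTangentMap (h.contMDiff_rho_rpow _) h.quot.smooth).prodMk h.contMDiff_scaleAction

theorem IsScalingSystem.mfderiv_scaleProj (x : TangentBundle 𝓘(ℝ, E) Q)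
    (w : TangentSpace 𝓘(ℝ, E).tangent x) :
    mfderiv 𝓘(ℝ, E).tangent (𝓘(ℝ, F).tangent.prod 𝓘(ℝ, ℝ)) (scaleProj (F := F) L Λ D ρ p) x w =
      Prod.mk (α := F × F) (β := ℝ) (mfderiv 𝓘(ℝ, E).tangent 𝓘(ℝ, F).tangent
        (scaledTangentMap (E := E) (F := F) (fun q => ρ q ^ (1 - Λ)) p) x w)
        (dirDeriv 𝓘(ℝ, E).tangent (scaleAction L D ρ) x w) := by
  have h1 := ((contMDiff_scaledTangentMap (h.contMDiff_rho_rpow (1 - Λ))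
    h.quot.smooth).mdifferentiable (by simp) x).hasMFDerivAt
  have h2 := (h.contMDiff_scaleAction.mdifferentiable (by simp) x).hasMFDerivAt
  exact DFunLike.congr_fun (h1.prodMk h2).mfderiv w

theorem IsScalingSystem.mfderiv_scaleProj_D (x : TangentBundle 𝓘(ℝ, E) Q) :
    mfderiv 𝓘(ℝ, E).tangent (𝓘(ℝ, F).tangent.prod 𝓘(ℝ, ℝ)) (scaleProj (F := F) L Λ D ρ p) x (D x)
      = 0 := by
  rw [h.mfderiv_scaleProj, h.mfderiv_scaledTangentMap, h.dirDeriv_scaleAction]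
  rfl

theorem IsScalingSystem.mfderiv_p_projDeriv (x : TangentBundle 𝓘(ℝ, E) Q)
    (w : TangentSpace 𝓘(ℝ, E).tangent x) :
    mfderiv 𝓘(ℝ, E) 𝓘(ℝ, F) p x.1 (projDeriv x w) =
      Prod.fst (α := F) (β := F) (Prod.fst (α := F × F) (β := ℝ)
        (mfderiv 𝓘(ℝ, E).tangent (𝓘(ℝ, F).tangent.prod 𝓘(ℝ, ℝ))
          (scaleProj (F := F) L Λ D ρ p) x w)) := by
  rw [h.mfderiv_scaleProj]
  have h1 : MDifferentiableAt 𝓘(ℝ, E).tangent 𝓘(ℝ, F).tangent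
      (scaledTangentMap (E := E) (F := F) (fun q => ρ q ^ (1 - Λ)) p) x :=
    (contMDiff_scaledTangentMap (h.contMDiff_rho_rpow (1 - Λ))
      h.quot.smooth).mdifferentiable (by simp) x
  have h2 := mfderiv_comp (g := fun y : TangentBundle 𝓘(ℝ, F) B => y.1) x
    (contMDiff_bundleProj.mdifferentiable (by simp) _) h1
  have h3 := mfderiv_comp (I'' := 𝓘(ℝ, F)) (g := p)
    (f := fun y : TangentBundle 𝓘(ℝ, E) Q => y.1) x
    (h.quot.smooth.mdifferentiable (by simp) _) (contMDiff_bundleProj.mdifferentiable (by simp) x)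
  have h4 := DFunLike.congr_fun (h3.symm.trans h2) w
  exact h4.trans (projDeriv_apply _ _)

/-- The reduction is injective on vertical vectors. -/
theorem IsScalingSystem.mfderiv_scaleProj_vertical (q : Q) (v : E) {β : E}
    (hβ : mfderiv 𝓘(ℝ, E).tangent (𝓘(ℝ, F).tangent.prod 𝓘(ℝ, ℝ)) (scaleProj (F := F) L Λ D ρ p)
      ⟨q, v⟩ (Prod.mk (α := E) (β := E) 0 β) = 0) : β = 0 := by
  have hι := (contMDiff_fibreInclusion q).mdifferentiable (by simp) v
  rw [← mfderiv_fibreInclusion q v β, h.mfderiv_scaleProj] at hβ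
  have h1 := congrArg (Prod.fst (α := F × F) (β := ℝ)) hβ
  have h2 := congrArg (Prod.snd (α := F × F) (β := ℝ)) hβ
  have h3 := mfderiv_comp (I'' := 𝓘(ℝ, F).tangent)
    (g := scaledTangentMap (E := E) (F := F) (fun q => ρ q ^ (1 - Λ)) p) v
    ((contMDiff_scaledTangentMap (h.contMDiff_rho_rpow (1 - Λ)) h.quot.smooth).mdifferentiable
      (by simp) _) hι
  have h4 := dirDeriv_comp_map (h.contMDiff_scaleAction.mdifferentiable (by simp) _) hι β
  have h5 : fderiv ℝ (fun v : E => scaleAction L D ρ ⟨q, v⟩) v β = 0 := by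
    rw [← mfderiv_eq_fderiv]
    exact h4.trans h2
  have hlin : HasFDerivAt (fun v : E => ρ q ^ (1 - Λ) •
      (show E →L[ℝ] F from mfderiv 𝓘(ℝ, E) 𝓘(ℝ, F) p q) v)
      (ρ q ^ (1 - Λ) • (show E →L[ℝ] F from mfderiv 𝓘(ℝ, E) 𝓘(ℝ, F) p q)) v :=
    (ContinuousLinearMap.hasFDerivAt _).const_smul _
  have h6 := mfderiv_comp (I := 𝓘(ℝ, E)) (I'' := 𝓘(ℝ, F).tangent)
    (g := fun w : F => (⟨p q, w⟩ : TangentBundle 𝓘(ℝ, F) B)) v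
    ((contMDiff_fibreInclusion (p q)).mdifferentiable (by simp) _)
    hlin.hasMFDerivAt.mdifferentiableAt
  have h7 := DFunLike.congr_fun (h3.symm.trans h6) β
  have h8 := (mfderiv_fibreInclusion (p q) _ _).symm.trans (h7.symm.trans h1)
  have h9 := congrArg (Prod.snd (α := F) (β := F)) h8
  rw [hlin.hasMFDerivAt.mfderiv] at h9
  have h10 := (smul_eq_zero.1 h9).resolve_left (h.rho_rpow_one_sub_ne q)
  exact h.fibre_fderiv_injective q v h10 h5

/-- A vector killed by dπ projects to some multiple `c` of the base field. Subtracting `c • D x`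
leaves a vertical vector in the kernel, which vanishes by nondegeneracy on the fibre. -/
theorem IsScalingSystem.ker_scaleProj (x : TangentBundle 𝓘(ℝ, E) Q)
    (w : TangentSpace 𝓘(ℝ, E).tangent x) :
    mfderiv 𝓘(ℝ, E).tangent (𝓘(ℝ, F).tangent.prod 𝓘(ℝ, ℝ)) (scaleProj (F := F) L Λ D ρ p) x w = 0
      ↔ ∃ c : ℝ, w = c • D x := by
  constructor
  · intro hw
    have h1 := h.mfderiv_p_projDeriv x w
    rw [hw] at h1
    obtain ⟨c, hc⟩ := (h.quot.ker_eq _ _).1 h1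
    refine ⟨c, ?_⟩
    have h2 : projDeriv x (w - c • D x) = 0 := by
      rw [map_sub, map_smul, hc, h.symm.projDeriv_eq h.smooth h.legendre, sub_self]
    have h3 : w - c • D x = Prod.mk (α := E) (β := E) 0 (Prod.snd (α := E) (β := E)
        (w - c • D x)) := by
      refine Prod.ext ?_ rfl
      exact (projDeriv_apply x _).symm.trans h2
    have h4 := h.mfderiv_scaleProj_vertical x.1 x.2
      (β := Prod.snd (α := E) (β := E) (w - c • D x)) (by
        refine (congrArg _ h3.symm).trans ?_
        refine (map_sub _ _ _).trans ?_
        refine (congrArg₂ _ hw ((map_smul _ _ _).trans (congrArg _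
          (h.mfderiv_scaleProj_D x)))).trans ?_
        rw [smul_zero, sub_zero])
    rw [h4] at h3
    exact sub_eq_zero.1 h3
  · rintro ⟨c, rfl⟩
    rw [map_smul, h.mfderiv_scaleProj_D, smul_zero]

theorem IsScalingSystem.D_ne (x : TangentBundle 𝓘(ℝ, E) Q) : D x ≠ 0 := by
  intro h0
  apply h.baseField_ne x.1
  rw [← h.symm.projDeriv_eq h.smooth h.legendre, h0, map_zero]

/-- The kernel is a line and dim E = dim F + 1, so 2 dim E = (2 dim F + 1) + 1 and the rank is full.
-/
theorem IsScalingSystem.submersion_scaleProj (x : TangentBundle 𝓘(ℝ, E) Q) :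
    Function.Surjective (mfderiv 𝓘(ℝ, E).tangent (𝓘(ℝ, F).tangent.prod 𝓘(ℝ, ℝ))
      (scaleProj (F := F) L Λ D ρ p) x) := by
  have h3 := h.finrank_eq.resolve_right (fun he => he.false x.1)
  refine surjective_of_finrank_eq (V := E × E) (W := (F × F) × ℝ)
    (mfderiv 𝓘(ℝ, E).tangent (𝓘(ℝ, F).tangent.prod 𝓘(ℝ, ℝ))
      (scaleProj (F := F) L Λ D ρ p) x) (h.D_ne x) (h.ker_scaleProj x) ?_
  rw [Module.finrank_prod, Module.finrank_prod, Module.finrank_prod, Module.finrank_self]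
  omega

theorem IsScalingSystem.exists_scaleProj_eq {q : Q} {z : TangentBundle 𝓘(ℝ, F) B × ℝ}
    (hz : p q = z.1.1) : ∃ v : E, scaleProj (F := F) L Λ D ρ p ⟨q, v⟩ = z := by
  obtain ⟨⟨b, w⟩, S⟩ := z
  dsimp only at hz
  subst hz
  obtain ⟨v, hv⟩ := (h.fibre_bijective q).2 (w, S)
  obtain ⟨h1, h2⟩ := Prod.ext_iff.1 hv
  refine ⟨v, Prod.ext ?_ h2⟩
  exact congrArg (fun w : F => (⟨p q, w⟩ : TangentBundle 𝓘(ℝ, F) B)) h1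

theorem IsScalingSystem.surjective_scaleProj :
    Function.Surjective (scaleProj (F := F) L Λ D ρ p) := by
  intro z
  obtain ⟨q, hq⟩ := h.quot.surjective z.1.1
  obtain ⟨v, hv⟩ := h.exists_scaleProj_eq hq
  exact ⟨_, hv⟩

theorem IsScalingSystem.eq_of_scaleProj_eq {q : Q} {v w : E}
    (hvw : scaleProj (F := F) L Λ D ρ p ⟨q, v⟩ = scaleProj L Λ D ρ p ⟨q, w⟩) : v = w := by
  apply (h.fibre_bijective q).1
  obtain ⟨h1, h2⟩ := Prod.ext_iff.1 hvw
  refine Prod.ext ?_ h2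
  have h3 := (Bundle.TotalSpace.mk.inj h1).2
  exact eq_of_heq h3

/-- Along an orbit of the base field `ρ' = ρ`, so `ρ` is a nonzero multiple of e^t and its value
determines the parameter. -/
theorem IsScalingSystem.eq_of_p_rho_eq {q₁ q₂ : Q} (hp : p q₁ = p q₂) (hr : ρ q₁ = ρ q₂) :
    q₁ = q₂ := by
  obtain ⟨γ, s, hs, hc, hγ, ⟨t₁, ht₁, rfl⟩, ⟨t₂, ht₂, rfl⟩⟩ := (h.quot.fibre_eq _ _).1 hp
  have h1 : ∀ t ∈ s, HasDerivAt (fun t => ρ (γ t)) (ρ (γ t)) t := by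
    intro t ht
    have h2 := (h.smooth_rho.mdifferentiable (by simp) (γ t)).hasMFDerivAt.comp t
      ((hγ t ht).hasMFDerivAt (hs.mem_nhds ht))
    have h3 : HasFDerivAt (fun t => ρ (γ t))
        ((show E →L[ℝ] ℝ from mfderiv 𝓘(ℝ, E) 𝓘(ℝ, ℝ) ρ (γ t)).comp
          ((1 : ℝ →L[ℝ] ℝ).smulRight (show E from baseField D (γ t)))) t :=
      hasMFDerivAt_iff_hasFDerivAt.1 h2
    refine h3.hasDerivAt.congr_deriv ?_
    refine Eq.trans ?_ (h.rho_scaling (γ t))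
    change mfderiv 𝓘(ℝ, E) 𝓘(ℝ, ℝ) ρ (γ t) ((1 : ℝ) • baseField D (γ t)) = _
    rw [one_smul]
    rfl
  have h2 : ∀ t ∈ s, HasMFDerivAt 𝓘(ℝ, ℝ) 𝓘(ℝ, ℝ) (fun t => ρ (γ t) * Real.exp (-t)) t 0 := by
    intro t ht
    have h3 := (h1 t ht).mul (hasDerivAt_neg t).exp
    have h4 : HasDerivAt (fun t => ρ (γ t) * Real.exp (-t)) 0 t := by
      refine h3.congr_deriv ?_
      ring
    have h5 := h4.hasFDerivAt.hasMFDerivAt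
    rwa [ContinuousLinearMap.toSpanSingleton_zero] at h5
  have h3 : ρ (γ t₁) * Real.exp (-t₁) = ρ (γ t₂) * Real.exp (-t₂) :=
    eq_of_mfderiv_zero hs hc h2 ht₁ ht₂
  rw [hr] at h3
  have h4 := Real.exp_injective (mul_left_cancel₀ (h.rho_ne _) h3)
  rw [neg_inj.1 h4]

theorem IsScalingSystem.eq_of_scaleProj_rho_eq {x y : TangentBundle 𝓘(ℝ, E) Q}
    (hxy : scaleProj (F := F) L Λ D ρ p x = scaleProj L Λ D ρ p y) (hr : ρ x.1 = ρ y.1) :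
    x = y := by
  obtain ⟨q₁, v⟩ := x
  obtain ⟨q₂, w⟩ := y
  obtain rfl : q₁ = q₂ := h.eq_of_p_rho_eq (congrArg (fun z => z.1.1) hxy) hr
  rw [h.eq_of_scaleProj_eq hxy]

end Quotient

/-! ### The scaling function as coordinate along orbits, and the fibres of π. -/

theorem bijective_prod_of_ker {V W : Type*} [NormedAddCommGroup V] [NormedSpace ℝ V]
    [NormedAddCommGroup W] [NormedSpace ℝ W] (m : V →L[ℝ] W) {a : V}
    (hker : ∀ v, m v = 0 ↔ ∃ c : ℝ, v = c • a) (hm : Function.Surjective m)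
    (η : V →L[ℝ] ℝ) (hη : η a ≠ 0) : Function.Bijective (m.prod η) := by
  constructor
  · refine (injective_iff_map_eq_zero _).2 fun v hv => ?_
    obtain ⟨h1, h2⟩ := Prod.ext_iff.1 hv
    obtain ⟨c, rfl⟩ := (hker v).1 h1
    have h3 : c * η a = 0 := by simpa using h2
    rw [(mul_eq_zero.1 h3).resolve_right hη, zero_smul]
  · rintro ⟨w, r⟩
    obtain ⟨v, rfl⟩ := hm w
    refine ⟨v + ((r - η v) / η a) • a, Prod.ext ?_ ?_⟩
    · have h1 : m a = 0 := (hker a).2 ⟨1, (one_smul _ _).symm⟩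
      simp [h1]
    · simp [hη]

section Quotient

variable {E : Type*} [NormedAddCommGroup E] [NormedSpace ℝ E] [FiniteDimensional ℝ E]
  {Q : Type*} [TopologicalSpace Q] [ChartedSpace E Q] [IsManifold 𝓘(ℝ, E) ∞ Q]
  {F : Type*} [NormedAddCommGroup F] [NormedSpace ℝ F] [FiniteDimensional ℝ F]
  {B : Type*} [TopologicalSpace B] [ChartedSpace F B] [IsManifold 𝓘(ℝ, F) ∞ B]
  {L : TangentBundle 𝓘(ℝ, E) Q → ℝ} {Λ : ℝ}
  {D : ∀ x : TangentBundle 𝓘(ℝ, E) Q, TangentSpace 𝓘(ℝ, E).tangent x} {ρ : Q → ℝ} {p : Q → B}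
  (h : IsScalingSystem F L Λ D ρ p)
include h

/-- The map `(p, ρ) : Q → B × ℝ` is a local diffeomorphism. -/
theorem IsScalingSystem.exists_inverse_p_rho (q : Q) :
    ∃ g : B × ℝ → Q, ContMDiffAt (𝓘(ℝ, F).prod 𝓘(ℝ, ℝ)) 𝓘(ℝ, E) ∞ g (p q, ρ q) ∧
      g (p q, ρ q) = q ∧ (∀ᶠ y in 𝓝 (p q, ρ q), p (g y) = y.1 ∧ ρ (g y) = y.2) ∧
      ∀ᶠ q' in 𝓝 q, g (p q', ρ q') = q' := by
  have h1 : ContMDiffAt 𝓘(ℝ, E) (𝓘(ℝ, F).prod 𝓘(ℝ, ℝ)) ∞ (fun q => (p q, ρ q)) q :=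
    (h.quot.smooth.prodMk h.smooth_rho) q
  have h2 := ((h.quot.smooth.mdifferentiable (by simp) q).hasMFDerivAt.prodMk
    (h.smooth_rho.mdifferentiable (by simp) q).hasMFDerivAt).mfderiv
  obtain ⟨g, h3, h4, h5, h6⟩ := exists_local_inverse h1 (by
    rw [h2]
    exact bijective_prod_of_ker (V := E) (W := F) (mfderiv 𝓘(ℝ, E) 𝓘(ℝ, F) p q)
      (h.quot.ker_eq q) (h.quot.submersion q) (mfderiv 𝓘(ℝ, E) 𝓘(ℝ, ℝ) ρ q)
      (fun h0 => h.rho_ne q ((h.rho_scaling q).symm.trans h0)))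
  exact ⟨g, h3, h4, h5.mono fun y hy => Prod.ext_iff.1 hy, h6⟩

/-- The map `(π, ρ ∘ τ) : TQ → (TB × ℝ) × ℝ` is a local diffeomorphism. -/
theorem IsScalingSystem.exists_inverse_scaleProj_rho (x : TangentBundle 𝓘(ℝ, E) Q) :
    ∃ g : (TangentBundle 𝓘(ℝ, F) B × ℝ) × ℝ → TangentBundle 𝓘(ℝ, E) Q,
      ContMDiffAt ((𝓘(ℝ, F).tangent.prod 𝓘(ℝ, ℝ)).prod 𝓘(ℝ, ℝ)) 𝓘(ℝ, E).tangent ∞ g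
        (scaleProj L Λ D ρ p x, ρ x.1) ∧
      g (scaleProj L Λ D ρ p x, ρ x.1) = x ∧
      ∀ᶠ y in 𝓝 ((scaleProj (F := F) L Λ D ρ p x, ρ x.1)),
        scaleProj L Λ D ρ p (g y) = y.1 ∧ ρ (g y).1 = y.2 := by
  have hr := h.smooth_rho.comp (contMDiff_bundleProj (E := E) (Q := Q))
  have h1 : ContMDiffAt 𝓘(ℝ, E).tangent ((𝓘(ℝ, F).tangent.prod 𝓘(ℝ, ℝ)).prod 𝓘(ℝ, ℝ)) ∞
      (fun y : TangentBundle 𝓘(ℝ, E) Q => (scaleProj (F := F) L Λ D ρ p y, ρ y.1)) x :=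
    (h.contMDiff_scaleProj.prodMk hr) x
  have h2 := ((h.contMDiff_scaleProj.mdifferentiable (by simp) x).hasMFDerivAt.prodMk
    (hr.mdifferentiable (by simp) x).hasMFDerivAt).mfderiv
  obtain ⟨g, h3, h4, h5, -⟩ := exists_local_inverse h1 (by
    have h6 := bijective_prod_of_ker (V := E × E) (W := (F × F) × ℝ)
      (mfderiv 𝓘(ℝ, E).tangent (𝓘(ℝ, F).tangent.prod 𝓘(ℝ, ℝ)) (scaleProj (F := F) L Λ D ρ p) x)
      (h.ker_scaleProj x) (h.submersion_scaleProj x)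
      (mfderiv 𝓘(ℝ, E).tangent 𝓘(ℝ, ℝ) (fun y : TangentBundle 𝓘(ℝ, E) Q => ρ y.1) x)
      (fun h0 => h.rho_ne x.1 ((h.dirDeriv_rho x).symm.trans h0))
    exact (congrArg (fun T : TangentSpace 𝓘(ℝ, E).tangent x →L[ℝ] _ => Function.Bijective T)
      h2).mpr h6)
  exact ⟨g, h3, h4, h5.mono fun y hy => Prod.ext_iff.1 hy⟩

/-- Functions that are constant along the scaling symmetry are constant on its orbits. -/
theorem IsScalingSystem.eq_of_sameOrbit {E' : Type*} [NormedAddCommGroup E'] [NormedSpace ℝ E']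
    {H' : Type*} [TopologicalSpace H'] {I' : ModelWithCorners ℝ E' H'} [I'.Boundaryless]
    {N : Type*} [TopologicalSpace N] [ChartedSpace H' N] [IsManifold I' ∞ N]
    {f : TangentBundle 𝓘(ℝ, E) Q → N} (hf : MDifferentiable 𝓘(ℝ, E).tangent I' f)
    (hfD : ∀ x, mfderiv 𝓘(ℝ, E).tangent I' f x (D x) = 0) {x y : TangentBundle 𝓘(ℝ, E) Q}
    (hxy : SameOrbit 𝓘(ℝ, E).tangent D x y) : f x = f y := by
  obtain ⟨γ, s, hs, hc, hγ, ⟨t₁, ht₁, rfl⟩, ⟨t₂, ht₂, rfl⟩⟩ := hxy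
  refine eq_of_mfderiv_zero (I := I') (γ := f ∘ γ) hs hc (fun t ht => ?_) ht₁ ht₂
  have h1 := (hf (γ t)).hasMFDerivAt.comp t ((hγ t ht).hasMFDerivAt (hs.mem_nhds ht))
  have h2 : (mfderiv 𝓘(ℝ, E).tangent I' f (γ t)).comp
      ((1 : ℝ →L[ℝ] ℝ).smulRight (D (γ t))) = 0 := by
    refine ContinuousLinearMap.ext fun r => ?_
    change mfderiv 𝓘(ℝ, E).tangent I' f (γ t) (r • D (γ t)) = 0
    rw [map_smul, hfD, smul_zero]
  exact h1.congr_mfderiv h2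

/-- The base points lie on an orbit `γ` of the base field. Above each point of `γ` exactly one
velocity gives the prescribed value of π. The lifted curve has velocity in the kernel of dπ, a
multiple of `D`; comparison with the base curve shows the factor is 1. -/
theorem IsScalingSystem.sameOrbit_of_scaleProj_eq {x y : TangentBundle 𝓘(ℝ, E) Q}
    (hxy : scaleProj (F := F) L Λ D ρ p x = scaleProj L Λ D ρ p y) :
    SameOrbit 𝓘(ℝ, E).tangent D x y := by
  obtain ⟨γ, s, hs, hc, hγ, ⟨t₁, ht₁, hx⟩, ⟨t₂, ht₂, hy⟩⟩ :=
    (h.quot.fibre_eq x.1 y.1).1 (congrArg (fun z => z.1.1) hxy)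
  have hpγ : ∀ t ∈ s, p (γ t) = (scaleProj (F := F) L Λ D ρ p x).1.1 := by
    intro t ht
    change p (γ t) = p x.1
    rw [← hx]
    exact (h.quot.fibre_eq _ _).2 ⟨γ, s, hs, hc, hγ, ⟨t, ht, rfl⟩, ⟨t₁, ht₁, rfl⟩⟩
  have hex : ∀ t, ∃ v : E, t ∈ s →
      scaleProj (F := F) L Λ D ρ p ⟨γ t, v⟩ = scaleProj L Λ D ρ p x := by
    intro t
    by_cases ht : t ∈ s
    · obtain ⟨v, hv⟩ := h.exists_scaleProj_eq (hpγ t ht)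
      exact ⟨v, fun _ => hv⟩
    · exact ⟨0, fun h' => absurd h' ht⟩
  choose v hv using hex
  set c : ℝ → TangentBundle 𝓘(ℝ, E) Q := fun t => ⟨γ t, v t⟩ with hcdef
  refine ⟨c, s, hs, hc, fun t ht => ?_, ⟨t₁, ht₁, ?_⟩, ⟨t₂, ht₂, ?_⟩⟩
  · have hγt := (hγ t ht).hasMFDerivAt (hs.mem_nhds ht)
    obtain ⟨g, hg, hgx, hgy⟩ := h.exists_inverse_scaleProj_rho (c t)
    have hr : MDifferentiableAt 𝓘(ℝ, ℝ) ((𝓘(ℝ, F).tangent.prod 𝓘(ℝ, ℝ)).prod 𝓘(ℝ, ℝ))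
        (fun t' => (scaleProj (F := F) L Λ D ρ p (c t), ρ (γ t'))) t :=
      mdifferentiableAt_const.prodMk
        ((h.smooth_rho.mdifferentiable (by simp) _).comp t hγt.mdifferentiableAt)
    -- The lift was chosen pointwise. Because π and `ρ` together are injective, it agrees near `t`
    -- with a smooth local inverse of `(π, ρ)` along `γ`, and is therefore differentiable.
    have hce : c =ᶠ[𝓝 t] fun t' => g (scaleProj L Λ D ρ p (c t), ρ (γ t')) := by
      have := (hr.continuousAt.tendsto).eventually hgy
      filter_upwards [this, hs.mem_nhds ht] with t' ht' hts
      refine h.eq_of_scaleProj_rho_eq ?_ ht'.2.symm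
      rw [ht'.1, hv t' hts, hv t ht]
    have hcd : MDifferentiableAt 𝓘(ℝ, ℝ) 𝓘(ℝ, E).tangent c t :=
      ((hg.mdifferentiableAt (by simp)).comp t hr).congr_of_eventuallyEq hce
    obtain ⟨a, ha⟩ := (h.ker_scaleProj (c t) (mfderiv 𝓘(ℝ, ℝ) 𝓘(ℝ, E).tangent c t (1 : ℝ))).1 (by
      have h1 := mfderiv_comp (I'' := 𝓘(ℝ, F).tangent.prod 𝓘(ℝ, ℝ)) t
        (h.contMDiff_scaleProj.mdifferentiable (by simp) (c t)) hcd
      have h2 : scaleProj (F := F) L Λ D ρ p ∘ c =ᶠ[𝓝 t]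
          fun _ => scaleProj (F := F) L Λ D ρ p x :=
        (hs.eventually_mem ht).mono fun t' ht' => hv t' ht'
      rw [h2.mfderiv_eq, mfderiv_const] at h1
      exact (DFunLike.congr_fun h1 (1 : ℝ)).symm)
    have ha1 : a = 1 := by
      have h1 := mfderiv_comp (I'' := 𝓘(ℝ, E)) (g := fun y : TangentBundle 𝓘(ℝ, E) Q => y.1) t
        (contMDiff_bundleProj.mdifferentiable (by simp) (c t)) hcd
      have h2 : projDeriv (c t) (mfderiv 𝓘(ℝ, ℝ) 𝓘(ℝ, E).tangent c t (1 : ℝ)) =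
          (1 : ℝ) • baseField D (γ t) :=
        (DFunLike.congr_fun (h1.symm.trans hγt.mfderiv) (1 : ℝ))
      rw [ha, map_smul, h.symm.projDeriv_eq h.smooth h.legendre] at h2
      exact smul_left_injective ℝ (h.baseField_ne (γ t)) h2
    have hfin := hcd.hasMFDerivAt
    rw [ha1, one_smul] at ha
    have he : mfderiv 𝓘(ℝ, ℝ) 𝓘(ℝ, E).tangent c t = (1 : ℝ →L[ℝ] ℝ).smulRight (D (c t)) := by
      ext
      refine ha.trans ?_
      exact (one_smul ℝ (D (c t))).symm
    rw [he] at hfin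
    exact hfin.hasMFDerivWithinAt
  · exact h.eq_of_scaleProj_rho_eq (hv t₁ ht₁) (congrArg ρ hx)
  · exact h.eq_of_scaleProj_rho_eq ((hv t₂ ht₂).trans hxy) (congrArg ρ hy)

theorem IsScalingSystem.isOrbitQuotient_scaleProj :
    IsOrbitQuotient 𝓘(ℝ, E).tangent (𝓘(ℝ, F).tangent.prod 𝓘(ℝ, ℝ)) D
      (scaleProj (F := F) L Λ D ρ p) where
  smooth := h.contMDiff_scaleProj
  surjective := h.surjective_scaleProj
  submersion := h.submersion_scaleProj
  ker_eq := h.ker_scaleProj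
  fibre_eq _ _ := ⟨h.sameOrbit_of_scaleProj_eq,
    h.eq_of_sameOrbit (h.contMDiff_scaleProj.mdifferentiable (by simp)) h.mfderiv_scaleProj_D⟩

end Quotient

/-! ### The reduced Lagrangian. -/

section ReducedLagrangian

variable {E : Type*} [NormedAddCommGroup E] [NormedSpace ℝ E] [FiniteDimensional ℝ E]
  {Q : Type*} [TopologicalSpace Q] [ChartedSpace E Q] [IsManifold 𝓘(ℝ, E) ∞ Q]
  {F : Type*} [NormedAddCommGroup F] [NormedSpace ℝ F] [FiniteDimensional ℝ F]
  {B : Type*} [TopologicalSpace B] [ChartedSpace F B] [IsManifold 𝓘(ℝ, F) ∞ B]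
  {L : TangentBundle 𝓘(ℝ, E) Q → ℝ} {Λ : ℝ}
  {D : ∀ x : TangentBundle 𝓘(ℝ, E) Q, TangentSpace 𝓘(ℝ, E).tangent x} {ρ : Q → ℝ} {p : Q → B}

/-- The function `-(L + ρ̇ S) / ρ^Λ` on `TQ`. -/
def scaledLagrangian (L : TangentBundle 𝓘(ℝ, E) Q → ℝ) (Λ : ℝ)
    (D : ∀ x : TangentBundle 𝓘(ℝ, E) Q, TangentSpace 𝓘(ℝ, E).tangent x) (ρ : Q → ℝ)
    (x : TangentBundle 𝓘(ℝ, E) Q) : ℝ :=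
  -(L x + rhoDot ρ x * scaleAction L D ρ x) / ρ x.1 ^ Λ

variable (h : IsScalingSystem F L Λ D ρ p)
include h

theorem IsScalingSystem.contMDiff_scaledLagrangian :
    ContMDiff 𝓘(ℝ, E).tangent 𝓘(ℝ, ℝ) ∞ (scaledLagrangian L Λ D ρ) := by
  have h1 := (h.smooth.add ((contMDiff_rhoDot h.smooth_rho).mul h.contMDiff_scaleAction)).neg
  have h2 : ContMDiff 𝓘(ℝ, E).tangent 𝓘(ℝ, ℝ) ∞
      (fun y : TangentBundle 𝓘(ℝ, E) Q => (ρ y.1 ^ Λ)⁻¹) :=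
    fun x => ContMDiffAt.comp (g := fun r : ℝ => r⁻¹) x
      (contDiffAt_inv ℝ (h.rho_rpow_ne x.1)).contMDiffAt
      ((h.contMDiff_rho_rpow Λ).comp contMDiff_bundleProj).contMDiffAt
  exact (h1.mul h2).congr fun x => div_eq_mul_inv _ _

/-- `L`, `ρ̇` and `ρ^Λ` have degree Λ and `S` has degree zero. -/
theorem IsScalingSystem.dirDeriv_scaledLagrangian (x : TangentBundle 𝓘(ℝ, E) Q) :
    dirDeriv 𝓘(ℝ, E).tangent (scaledLagrangian L Λ D ρ) x (D x) = 0 := by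
  have hL := h.smooth.mdifferentiable (by simp) x
  have hr : MDifferentiableAt 𝓘(ℝ, E).tangent 𝓘(ℝ, ℝ)
      (fun y : TangentBundle 𝓘(ℝ, E) Q => ρ y.1) x :=
    (h.smooth_rho.comp contMDiff_bundleProj).mdifferentiable (by simp) x
  have hrp : MDifferentiableAt 𝓘(ℝ, E).tangent 𝓘(ℝ, ℝ)
      (fun y : TangentBundle 𝓘(ℝ, E) Q => ρ y.1 ^ Λ) x :=
    ((h.contMDiff_rho_rpow Λ).comp contMDiff_bundleProj).mdifferentiable (by simp) x
  have hrd := (contMDiff_rhoDot (E := E) h.smooth_rho).mdifferentiable (by simp) x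
  have hS := h.contMDiff_scaleAction.mdifferentiable (by simp) x
  have hf := h.contMDiff_scaledLagrangian.mdifferentiable (by simp) x
  have h1 := dirDeriv_mul hf hrp (D x)
  have h2 : (fun y : TangentBundle 𝓘(ℝ, E) Q => scaledLagrangian L Λ D ρ y * ρ y.1 ^ Λ) =
      fun y => (-1 : ℝ) * (L y + rhoDot ρ y * scaleAction L D ρ y) := by
    funext y
    rw [scaledLagrangian, div_mul_cancel₀ _ (h.rho_rpow_ne y.1), neg_one_mul]
  have h3 : dirDeriv 𝓘(ℝ, E).tangent
      (fun y => (-1 : ℝ) * (L y + rhoDot ρ y * scaleAction L D ρ y)) x (D x) =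
      -1 * dirDeriv 𝓘(ℝ, E).tangent (fun y => L y + rhoDot ρ y * scaleAction L D ρ y) x (D x) :=
    dirDeriv_comp_real (φ := fun r => -1 * r) (by simpa using (hasDerivAt_id _).const_mul (-1 : ℝ))
      (hL.add (hrd.mul hS)) _
  have h4 := dirDeriv_comp_real (f := fun y : TangentBundle 𝓘(ℝ, E) Q => ρ y.1) (φ := fun r => r ^ Λ)
    (Real.hasDerivAt_rpow_const (Or.inl (h.rho_ne x.1))) hr (D x)
  rw [h.dirDeriv_rho, Real.rpow_sub_one (h.rho_ne x.1)] at h4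
  have h8 : MDifferentiableAt 𝓘(ℝ, E).tangent 𝓘(ℝ, ℝ)
      (fun y => rhoDot ρ y * scaleAction L D ρ y) x := hrd.mul hS
  rw [h2, h3, dirDeriv_add hL h8, dirDeriv_mul hrd hS, h.dirDeriv_rhoDot,
    h.dirDeriv_scaleAction, h.symm.lagrangian, h4] at h1
  have h5 : dirDeriv 𝓘(ℝ, E).tangent (scaledLagrangian L Λ D ρ) x (D x) * ρ x.1 ^ Λ = 0 := by
    have h6 := h.rho_ne x.1
    have h7 := h.rho_rpow_ne x.1
    rw [scaledLagrangian] at h1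
    field_simp at h1
    linarith
  exact (mul_eq_zero.1 h5).resolve_right (h.rho_rpow_ne x.1)

/-- The reduced Lagrangian: the function on `TB × ℝ` induced by `-(L + ρ̇ S) / ρ^Λ`. -/
def IsScalingSystem.reducedLagrangian (z : TangentBundle 𝓘(ℝ, F) B × ℝ) : ℝ :=
  scaledLagrangian L Λ D ρ (Function.surjInv h.surjective_scaleProj z)

theorem IsScalingSystem.reducedLagrangian_scaleProj (x : TangentBundle 𝓘(ℝ, E) Q) :
    h.reducedLagrangian (scaleProj L Λ D ρ p x) = scaledLagrangian L Λ D ρ x :=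
  h.eq_of_sameOrbit (h.contMDiff_scaledLagrangian.mdifferentiable (by simp))
    h.dirDeriv_scaledLagrangian
    (h.sameOrbit_of_scaleProj_eq (Function.surjInv_eq h.surjective_scaleProj _))

/-- Keeping `ρ` fixed in a local inverse of `(π, ρ)` gives a smooth local section of π. Invariance
lets ℒ be computed along it instead of along the arbitrary choice `surjInv`. -/
theorem IsScalingSystem.contMDiff_reducedLagrangian :
    ContMDiff (𝓘(ℝ, F).tangent.prod 𝓘(ℝ, ℝ)) 𝓘(ℝ, ℝ) ∞ h.reducedLagrangian := by
  intro z
  obtain ⟨x, rfl⟩ := h.surjective_scaleProj z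
  obtain ⟨g, hg, hgx, hgy⟩ := h.exists_inverse_scaleProj_rho x
  have h1 : ContMDiffAt (𝓘(ℝ, F).tangent.prod 𝓘(ℝ, ℝ))
      ((𝓘(ℝ, F).tangent.prod 𝓘(ℝ, ℝ)).prod 𝓘(ℝ, ℝ)) ∞
      (fun z : TangentBundle 𝓘(ℝ, F) B × ℝ => (z, ρ x.1)) (scaleProj L Λ D ρ p x) :=
    contMDiffAt_id.prodMk contMDiffAt_const
  have h2 := (h.contMDiff_scaledLagrangian _).comp (scaleProj (F := F) L Λ D ρ p x)
    (ContMDiffAt.comp (scaleProj (F := F) L Λ D ρ p x) hg h1)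
  refine h2.congr_of_eventuallyEq ?_
  filter_upwards [h1.continuousAt.tendsto.eventually hgy] with z hz
  refine Eq.trans ?_ (h.reducedLagrangian_scaleProj _)
  exact congrArg h.reducedLagrangian hz.1.symm

end ReducedLagrangian

/-! ### Parameter integrals, the fundamental lemma and changes of time. -/

section Calculus

open MeasureTheory

variable {a b : ℝ}

theorem continuousOn_slice {X : ℝ × ℝ → ℝ} {n : Set ℝ} {ε : ℝ}
    (hX : ∀ t ∈ n, ContinuousAt X (ε, t)) : ContinuousOn (fun t => X (ε, t)) n := fun t ht =>
  (ContinuousAt.comp (f := fun t => (ε, t)) (x := t) (hX t ht)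
    (by fun_prop)).continuousWithinAt

theorem continuousAt_fderiv_apply {V W : Type*} [NormedAddCommGroup V] [NormedSpace ℝ V]
    [NormedAddCommGroup W] [NormedSpace ℝ W] {X : V → W} {z : V} (hX : ContDiffAt ℝ 1 X z)
    (v : V) : ContinuousAt (fun z => fderiv ℝ X z v) z :=
  ((hX.fderiv_right (m := 0) (by simp)).continuousAt).clm_apply continuousAt_const

/-- Differentiation under the integral sign. -/
theorem hasDerivAt_integral_of_contDiffAt (hab : a ≤ b) {X : ℝ × ℝ → ℝ}
    (hX : ∀ t ∈ Icc a b, ContDiffAt ℝ 1 X (0, t)) :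
    HasDerivAt (fun ε => ∫ t in a..b, X (ε, t)) (∫ t in a..b, fderiv ℝ X (0, t) (1, 0)) 0 := by
  have hopen : IsOpen {z | ContDiffAt ℝ 1 X z} :=
    isOpen_iff_eventually.2 fun z (hz : ContDiffAt ℝ 1 X z) => hz.eventually (by simp)
  -- Being C¹ is an open condition, so by compactness of `[a, b]` it holds on a whole strip around ε
  -- = 0, where the ε-derivative is uniformly bounded.
  obtain ⟨u, v, hu, -, h0, hv, huv⟩ := generalized_tube_lemma (isCompact_singleton (x := (0 : ℝ)))
    (isCompact_Icc (a := a) (b := b)) hopen (by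
      rintro ⟨ε, t⟩ ⟨hε, ht⟩
      obtain rfl : ε = 0 := hε
      exact hX t ht)
  obtain ⟨δ, hδ, hball⟩ := Metric.isOpen_iff.1 hu 0 (h0 rfl)
  have hsm : ∀ ε ∈ Metric.closedBall (0 : ℝ) (δ / 2), ∀ t ∈ Icc a b, ContDiffAt ℝ 1 X (ε, t) :=
    fun ε hε t ht => huv ⟨hball (Metric.closedBall_subset_ball (half_lt_self hδ) hε), hv ht⟩
  have hs : Metric.closedBall (0 : ℝ) (δ / 2) ∈ 𝓝 (0 : ℝ) :=
    Metric.closedBall_mem_nhds _ (half_pos hδ)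
  have hK : IsCompact (Metric.closedBall (0 : ℝ) (δ / 2) ×ˢ Icc a b) :=
    (isCompact_closedBall _ _).prod isCompact_Icc
  obtain ⟨C, hC⟩ := hK.exists_bound_of_continuousOn (f := fun z => fderiv ℝ X z (1, 0))
    fun z hz => (continuousAt_fderiv_apply (hsm z.1 hz.1 z.2 hz.2)
      (1, 0)).continuousWithinAt
  have hsub : Set.uIoc a b ⊆ Icc a b := by
    rw [uIoc_of_le hab]
    exact Ioc_subset_Icc_self
  have hcont : ∀ ε ∈ Metric.closedBall (0 : ℝ) (δ / 2),
      ContinuousOn (fun t => X (ε, t)) (Icc a b) := fun ε hε =>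
    continuousOn_slice fun t ht => (hsm ε hε t ht).continuousAt
  have h00 : (0 : ℝ) ∈ Metric.closedBall (0 : ℝ) (δ / 2) := mem_of_mem_nhds hs
  refine (intervalIntegral.hasDerivAt_integral_of_dominated_loc_of_deriv_le
    (F := fun ε t => X (ε, t)) (F' := fun ε t => fderiv ℝ X (ε, t) (1, 0)) (bound := fun _ => C)
    hs ?_ ?_ ?_ ?_ ?_ ?_).2
  · filter_upwards [hs] with ε hε
    exact ((hcont ε hε).mono hsub).aestronglyMeasurable measurableSet_uIoc
  · exact ContinuousOn.intervalIntegrable (by rw [uIcc_of_le hab]; exact hcont 0 h00)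
  · exact ((continuousOn_slice fun t ht => continuousAt_fderiv_apply
      (hsm 0 h00 t ht) (1, 0)).mono hsub).aestronglyMeasurable measurableSet_uIoc
  · exact Eventually.of_forall fun t ht ε hε => hC (ε, t) ⟨hε, hsub ht⟩
  · exact intervalIntegrable_const
  · refine Eventually.of_forall fun t ht ε hε => ?_
    have h1 := ((hsm ε hε t (hsub ht)).differentiableAt (by simp)).hasFDerivAt
    exact h1.comp_hasDerivAt ε ((hasDerivAt_id ε).prodMk (hasDerivAt_const ε t))

/-- The fundamental lemma of the calculus of variations. -/
theorem eq_zero_of_integral_mul_eq_zero (hab : a < b) {f : ℝ → ℝ} (hf : ContinuousOn f (Icc a b))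
    (h : ∀ g : ℝ → ℝ, ContDiff ℝ ∞ g → tsupport g ⊆ Ioo a b → ∫ t in a..b, g t * f t = 0) :
    ∀ t ∈ Icc a b, f t = 0 := by
  have h1 := IsOpen.ae_eq_zero_of_integral_contDiff_smul_eq_zero (μ := volume)
    (isOpen_Ioo (a := a) (b := b))
    ((hf.mono Ioo_subset_Icc_self).locallyIntegrableOn measurableSet_Ioo) fun g hg _ hgs => by
      have h2 := h g hg hgs
      rw [intervalIntegral.integral_of_le hab.le] at h2
      rw [← h2, setIntegral_eq_integral_of_forall_compl_eq_zero]
      · rfl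
      · intro t ht
        have : g t = 0 := image_eq_zero_of_notMem_tsupport fun h' => ht (Ioo_subset_Ioc_self (hgs h'))
        rw [this, zero_mul]
  have h2 : f =ᵐ[volume.restrict (Icc a b)] fun _ => 0 := by
    rw [← Measure.restrict_congr_set Ioo_ae_eq_Icc]
    exact (ae_restrict_iff' measurableSet_Ioo).2 h1
  exact Measure.eqOn_Icc_of_ae_eq volume hab.ne h2 hf continuousOn_const

theorem exists_Ioo_of_eventually (hab : a ≤ b) {P : ℝ → Prop}
    (h : ∀ t ∈ Icc a b, ∀ᶠ t' in 𝓝 t, P t') :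
    ∃ l < a, ∃ u > b, ∀ t ∈ Ioo l u, P t := by
  obtain ⟨l, hl, hlP⟩ := exists_Ioc_subset_of_mem_nhds (h a ⟨le_rfl, hab⟩) (exists_lt a)
  obtain ⟨u, hu, huP⟩ := exists_Ico_subset_of_mem_nhds (h b ⟨hab, le_rfl⟩) (exists_gt b)
  refine ⟨l, hl, u, hu, fun t ht => ?_⟩
  rcases le_total t a with h1 | h1
  · exact hlP ⟨ht.1, h1⟩
  rcases le_total b t with h2 | h2
  · exact huP ⟨h2, ht.2⟩
  exact (h t ⟨h1, h2⟩).self_of_nhds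

theorem contDiffAt_of_hasDerivAt {f f' : ℝ → ℝ} {t : ℝ} (h : ∀ᶠ t' in 𝓝 t, HasDerivAt f (f' t') t')
    (hf' : ContDiffAt ℝ ∞ f' t) : ContDiffAt ℝ ∞ f t := by
  refine contDiffAt_infty.2 fun n => ?_
  refine ContDiffAt.of_le (m := n) (n := n + 1) ?_ (by norm_cast; omega)
  refine contDiffAt_succ_iff_hasFDerivAt.2
    ⟨fun t' => ContinuousLinearMap.toSpanSingleton ℝ (f' t'), ⟨_, h, fun t' ht' => ht'⟩, ?_⟩
  have h1 : ContDiffAt ℝ n f' t := hf'.of_le (by exact_mod_cast le_top)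
  exact ((ContinuousLinearMap.toSpanSingletonCLE (𝕜 := ℝ) (E := ℝ)).contDiff.contDiffAt).comp t h1

/-- Derivatives at the endpoints are two-sided, so the primitive lives on an open interval around
`[a, b]`; `P` is carried over to the same interval. -/
theorem exists_primitive (hab : a ≤ b) {s : ℝ → ℝ} (hs : ∀ t ∈ Icc a b, ContDiffAt ℝ ∞ s t)
    {P : ℝ → Prop} (hP : ∀ t ∈ Icc a b, ∀ᶠ t' in 𝓝 t, P t') :
    ∃ ψ : ℝ → ℝ, ∃ l < a, ∃ u > b, (∀ t ∈ Ioo l u, P t ∧ HasDerivAt ψ (s t) t) ∧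
      ∀ t ∈ Icc a b, ContDiffAt ℝ ∞ ψ t := by
  obtain ⟨l, hl, u, hu, hlu⟩ := exists_Ioo_of_eventually hab
    (P := fun t => ContinuousAt s t ∧ P t) fun t ht =>
      Eventually.and ((((hs t ht).of_le (m := 1) (by norm_num)).eventually (by simp)).mono
        fun t' ht' => ht'.continuousAt) (hP t ht)
  have hd : ∀ t ∈ Ioo l u, HasDerivAt (fun t => ∫ t' in a..t, s t') (s t) t := by
    intro t ht
    have hsub : Set.uIcc a t ⊆ Ioo l u :=
      (ordConnected_Ioo (a := l) (b := u)).uIcc_subset ⟨hl, hab.trans_lt hu⟩ ht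
    have hc : ContinuousOn s (Ioo l u) := fun t' ht' => (hlu t' ht').1.continuousWithinAt
    exact intervalIntegral.integral_hasDerivAt_right (hc.mono hsub).intervalIntegrable
      (hc.stronglyMeasurableAtFilter isOpen_Ioo t ht) (hlu t ht).1
  refine ⟨_, l, hl, u, hu, fun t ht => ⟨(hlu t ht).2, hd t ht⟩, fun t ht => ?_⟩
  refine contDiffAt_of_hasDerivAt ?_ (hs t ht)
  filter_upwards [isOpen_Ioo.mem_nhds (⟨hl.trans_le ht.1, ht.2.trans_lt hu⟩ : t ∈ Ioo l u)]
    with t' ht' using hd t' ht'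

/-- `φ` inverts a primitive `ψ` of `s`, which is injective by Rolle's theorem. As `s` may be
negative, `ψ` may decrease, so `[c, d]` is defined as the image of `[a, b]` rather than by the
values at the ends. -/
theorem exists_time_change (hab : a ≤ b) {s : ℝ → ℝ} (hs : ∀ t ∈ Icc a b, ContDiffAt ℝ ∞ s t)
    (hs0 : ∀ t ∈ Icc a b, s t ≠ 0) :
    ∃ (c d : ℝ) (φ : ℝ → ℝ), (∀ τ ∈ Icc c d, ContDiffAt ℝ ∞ φ τ ∧ HasDerivAt φ (s (φ τ))⁻¹ τ) ∧
      φ '' Icc c d = Icc a b := by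
  obtain ⟨ψ, l, hl, u, hu, hψ, hψs⟩ := exists_primitive hab hs (P := fun t => s t ≠ 0)
    fun t ht => (hs t ht).continuousAt.eventually_ne (hs0 t ht)
  have hsub : Icc a b ⊆ Ioo l u := Icc_subset_Ioo hl hu
  have hinj : InjOn ψ (Ioo l u) := by
    have key : ∀ x ∈ Ioo l u, ∀ y ∈ Ioo l u, x < y → ψ x ≠ ψ y := by
      intro x hx y hy hxy he
      have hxs : Icc x y ⊆ Ioo l u := Icc_subset_Ioo hx.1 hy.2
      obtain ⟨z, hz, hz0⟩ := exists_hasDerivAt_eq_zero hxy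
        (fun z hz => (hψ z (hxs hz)).2.continuousAt.continuousWithinAt) he
        (fun z hz => (hψ z (hxs (Ioo_subset_Icc_self hz))).2)
      exact (hψ z (hxs (Ioo_subset_Icc_self hz))).1 hz0
    intro x hx y hy he
    rcases lt_trichotomy x y with h | h | h
    · exact absurd he (key x hx y hy h)
    · exact h
    · exact absurd he.symm (key y hy x hx h)
  have hleft : LeftInvOn (Function.invFunOn ψ (Ioo l u)) ψ (Ioo l u) := hinj.leftInvOn_invFunOn
  have himg := ContinuousOn.image_Icc hab
    (fun t ht => (hψ t (hsub ht)).2.continuousAt.continuousWithinAt : ContinuousOn ψ (Icc a b))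
  refine ⟨sInf (ψ '' Icc a b), sSup (ψ '' Icc a b), Function.invFunOn ψ (Ioo l u), ?_, ?_⟩
  rotate_left
  · rw [← himg]
    exact (hleft.mono hsub).image_image
  · rw [← himg]
    rintro _ ⟨t, ht, rfl⟩
    rw [hleft (hsub ht)]
    obtain ⟨g, hg, hgt, hgr, -⟩ := exists_local_inverse (I := 𝓘(ℝ, ℝ)) (I' := 𝓘(ℝ, ℝ))
      (hψs t ht).contMDiffAt (by
        rw [mfderiv_eq_fderiv, (hψ t (hsub ht)).2.hasFDerivAt.fderiv]
        have h0 := (hψ t (hsub ht)).1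
        constructor
        · intro (x : ℝ) (y : ℝ) hxy
          have : x * s t = y * s t := hxy
          exact mul_right_cancel₀ (M₀ := ℝ) h0 this
        · intro (y : ℝ)
          refine ⟨(y / s t : ℝ), ?_⟩
          change y / s t * s t = y
          field_simp)
    have hgs := hg.contDiffAt
    have he : Function.invFunOn ψ (Ioo l u) =ᶠ[𝓝 (ψ t)] g := by
      have h1 : ∀ᶠ y in 𝓝 (ψ t), g y ∈ Ioo l u := by
        refine hgs.continuousAt.eventually_mem ?_
        rw [hgt]
        exact isOpen_Ioo.mem_nhds (hsub ht)
      filter_upwards [h1, hgr] with y hy1 hy2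
      rw [← hleft hy1, hy2]
    refine ⟨hgs.congr_of_eventuallyEq he, ?_⟩
    have h2 := (hgs.congr_of_eventuallyEq he).differentiableAt (by simp)
    exact HasDerivAt.of_local_left_inverse h2.continuousAt
      (by rw [hleft (hsub ht)]; exact (hψ t (hsub ht)).2) (hψ t (hsub ht)).1 (by
        filter_upwards [he, hgr] with y hy1 hy2
        rw [hy1, hy2])

/-- For a primitive `ψ` of `s`, the derivative of `ψ ∘ φ` is `s · s⁻¹ = 1`, so `ψ` inverts `φ` up to
an additive constant. An injective continuous `φ` is strictly monotone in one sense or the other,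
whence the two cases for the ends. -/
theorem exists_time_change_inverse (hab : a < b) {s : ℝ → ℝ}
    (hs : ∀ t ∈ Icc a b, ContDiffAt ℝ ∞ s t) (hs0 : ∀ t ∈ Icc a b, s t ≠ 0) {c d : ℝ} {φ : ℝ → ℝ}
    (hφ : ∀ τ ∈ Icc c d, HasDerivAt φ (s (φ τ))⁻¹ τ) (himg : φ '' Icc c d = Icc a b) :
    c < d ∧ ∃ ψ : ℝ → ℝ, (∀ t ∈ Icc a b, ContDiffAt ℝ ∞ ψ t ∧ HasDerivAt ψ (s t) t ∧
      ψ t ∈ Icc c d ∧ φ (ψ t) = t) ∧ (∀ τ ∈ Icc c d, ψ (φ τ) = τ) ∧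
      (ψ a = c ∧ ψ b = d ∨ ψ a = d ∧ ψ b = c) := by
  have hmem : ∀ τ ∈ Icc c d, φ τ ∈ Icc a b := fun τ hτ => himg ▸ mem_image_of_mem φ hτ
  obtain ⟨τa, hτa, hφa⟩ := himg.symm ▸ (left_mem_Icc.2 hab.le : a ∈ Icc a b)
  obtain ⟨τb, hτb, hφb⟩ := himg.symm ▸ (right_mem_Icc.2 hab.le : b ∈ Icc a b)
  have hcd : c < d := by
    rcases (hτa.1.trans hτa.2).lt_or_eq with h | h
    · exact h
    · exfalso
      have h1 : τa = τb := by
        rw [h] at hτa hτb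
        exact (le_antisymm hτa.2 hτa.1).trans (le_antisymm hτb.1 hτb.2)
      rw [h1, hφb] at hφa
      exact hab.ne' hφa
  obtain ⟨ψ, l, hl, u, hu, hψ, hψs⟩ := exists_primitive hab.le hs (P := fun _ => True)
    fun t ht => Eventually.of_forall fun _ => trivial
  have hψd : ∀ t ∈ Icc a b, HasDerivAt ψ (s t) t := fun t ht => (hψ t (Icc_subset_Ioo hl hu ht)).2
  have hconst : ∀ τ ∈ Icc c d, ψ (φ τ) - τ = ψ (φ c) - c := by
    have hd : ∀ τ ∈ Icc c d, HasDerivAt (fun τ => ψ (φ τ) - τ) 0 τ := by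
      intro τ hτ
      have h1 := ((hψd _ (hmem τ hτ)).comp τ (hφ τ hτ)).sub (hasDerivAt_id τ)
      refine h1.congr_deriv ?_
      rw [mul_inv_cancel₀ (hs0 _ (hmem τ hτ)), sub_self]
    exact constant_of_has_deriv_right_zero
      (fun τ hτ => (hd τ hτ).continuousAt.continuousWithinAt)
      fun τ hτ => (hd τ (Ico_subset_Icc_self hτ)).hasDerivWithinAt
  have hinv : ∀ τ ∈ Icc c d, ψ (φ τ) + (c - ψ (φ c)) = τ := fun τ hτ => by
    linarith [hconst τ hτ]
  have hinj : InjOn φ (Icc c d) := fun τ hτ τ' hτ' he => by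
    rw [← hinv τ hτ, he, hinv τ' hτ']
  refine ⟨hcd, fun t => ψ t + (c - ψ (φ c)), ?_, hinv, ?_⟩
  · intro t ht
    refine ⟨(hψs t ht).add contDiffAt_const, (hψd t ht).add_const _, ?_⟩
    obtain ⟨τ, hτ, rfl⟩ := himg.symm ▸ ht
    dsimp only
    rw [hinv τ hτ]
    exact ⟨hτ, rfl⟩
  · have hc := left_mem_Icc.2 hcd.le
    have hd := right_mem_Icc.2 hcd.le
    rcases ContinuousOn.strictMonoOn_of_injOn_Icc' hcd.le
      (fun τ hτ => (hφ τ hτ).continuousAt.continuousWithinAt) hinj with hm | hm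
    · left
      have h1 : φ c = a := le_antisymm (hφa ▸ hm.monotoneOn hc hτa hτa.1) (hmem c hc).1
      have h2 : φ d = b := le_antisymm (hmem d hd).2 (hφb ▸ hm.monotoneOn hτb hd hτb.2)
      exact ⟨by rw [← h1]; exact hinv c hc, by rw [← h2]; exact hinv d hd⟩
    · right
      have h1 : φ c = b := le_antisymm (hmem c hc).2 (hφb ▸ hm.antitoneOn hc hτb hτb.1)
      have h2 : φ d = a := le_antisymm (hφa ▸ hm.antitoneOn hτa hd hτa.2) (hmem d hd).1
      exact ⟨by rw [← h2]; exact hinv d hd, by rw [← h1]; exact hinv c hc⟩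

end Calculus

/-! ### `L` is stationary in the action variable. -/

section FrozenAction

variable {E : Type*} [NormedAddCommGroup E] [NormedSpace ℝ E] [FiniteDimensional ℝ E]
  {Q : Type*} [TopologicalSpace Q] [ChartedSpace E Q] [IsManifold 𝓘(ℝ, E) ∞ Q]
  {F : Type*} [NormedAddCommGroup F] [NormedSpace ℝ F] [FiniteDimensional ℝ F]
  {B : Type*} [TopologicalSpace B] [ChartedSpace F B] [IsManifold 𝓘(ℝ, F) ∞ B]
  {L : TangentBundle 𝓘(ℝ, E) Q → ℝ} {Λ : ℝ}
  {D : ∀ x : TangentBundle 𝓘(ℝ, E) Q, TangentSpace 𝓘(ℝ, E).tangent x} {ρ : Q → ℝ} {p : Q → B}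
  (h : IsScalingSystem F L Λ D ρ p)
include h

theorem IsScalingSystem.lagrangian_eq (x : TangentBundle 𝓘(ℝ, E) Q) :
    L x = -(ρ x.1 ^ Λ * h.reducedLagrangian ((scaleProj L Λ D ρ p x).1, scaleAction L D ρ x)) -
      rhoDot ρ x * scaleAction L D ρ x := by
  have h1 := h.reducedLagrangian_scaleProj x
  have h2 : h.reducedLagrangian ((scaleProj L Λ D ρ p x).1, scaleAction L D ρ x) =
      h.reducedLagrangian (scaleProj L Λ D ρ p x) := rfl
  have h3 := h.rho_rpow_ne x.1
  rw [h2, h1, scaledLagrangian]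
  field_simp
  ring

theorem IsScalingSystem.differentiableAt_reducedLagrangian_snd (y : TangentBundle 𝓘(ℝ, F) B)
    (s : ℝ) : DifferentiableAt ℝ (fun s => h.reducedLagrangian (y, s)) s := by
  have h1 : ContMDiff 𝓘(ℝ, ℝ) 𝓘(ℝ, ℝ) ∞ (fun s => h.reducedLagrangian (y, s)) :=
    h.contMDiff_reducedLagrangian.comp (contMDiff_const.prodMk contMDiff_id)
  exact (h1.contDiff.differentiable (by simp)) s

/-- The derivative of the reduced Lagrangian with respect to the action variable. -/
theorem IsScalingSystem.hasDerivAt_reducedLagrangian_snd (x : TangentBundle 𝓘(ℝ, E) Q) :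
    HasDerivAt (fun s => h.reducedLagrangian ((scaleProj L Λ D ρ p x).1, s))
      (-(rhoDot ρ x / ρ x.1 ^ Λ)) (scaleAction L D ρ x) := by
  obtain ⟨q, v⟩ := x
  change E at v
  set y := (scaleProj (F := F) L Λ D ρ p ⟨q, v⟩).1 with hy
  set A : E := baseField D q with hA
  -- Along this line `q` and the reduced velocity are fixed, `ρ̇` grows at rate `ρ`, `S` moves at a
  -- nonzero rate `σ'`, and `L` changes at rate `-ρ S`. Differentiating `L = -ρ^Λ ℒ - ρ̇ S`, the
  -- terms `-ρ S` cancel and `(ρ^Λ ∂ℒ/∂S + ρ̇) σ' = 0` is left.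
  have hline : HasDerivAt (fun s : ℝ => v + s • A) A 0 := by
    simpa using ((hasDerivAt_id (0 : ℝ)).smul_const A).const_add v
  have hline0 : v + (0 : ℝ) • A = v := by rw [zero_smul, add_zero]
  have hm := (h.differentiableAt_reducedLagrangian_snd y (scaleAction L D ρ ⟨q, v⟩)).hasDerivAt
  set m' := deriv (fun s => h.reducedLagrangian (y, s)) (scaleAction L D ρ ⟨q, v⟩)
  have hS := h.hasFDerivAt_scaleAction q v
  set σ' := fderiv ℝ (fun v : E => scaleAction L D ρ ⟨q, v⟩) v A with hσ'
  have hσ : HasDerivAt (fun s : ℝ => scaleAction L D ρ ⟨q, v + s • A⟩) σ' 0 := by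
    have h1 : HasFDerivAt (fun v : E => scaleAction L D ρ ⟨q, v⟩)
      (fderiv ℝ (fun v : E => scaleAction L D ρ ⟨q, v⟩) v) (v + (0 : ℝ) • A) := by
      rw [hline0]; exact hS.differentiableAt.hasFDerivAt
    exact h1.comp_hasDerivAt 0 hline
  have hσ0 : σ' ≠ 0 := fun h0 =>
    h.baseField_ne q (h.fibre_fderiv_injective q v (h.mfderiv_p_baseField q) h0)
  have hproj : ∀ s : ℝ, (scaleProj (F := F) L Λ D ρ p ⟨q, v + s • A⟩).1 = y := by
    intro s
    have h1 : (mfderiv 𝓘(ℝ, E) 𝓘(ℝ, F) p q (v + s • A : E) : F) =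
        mfderiv 𝓘(ℝ, E) 𝓘(ℝ, F) p q v := by
      refine (map_add (mfderiv 𝓘(ℝ, E) 𝓘(ℝ, F) p q) _ _).trans ?_
      refine (congrArg _ ((map_smul (mfderiv 𝓘(ℝ, E) 𝓘(ℝ, F) p q) s _).trans
        (congrArg _ (h.mfderiv_p_baseField q)))).trans ?_
      rw [smul_zero, add_zero]
    exact congrArg (fun w : F => (⟨p q, ρ q ^ (1 - Λ) • w⟩ : TangentBundle 𝓘(ℝ, F) B)) h1
  have hrd : ∀ s : ℝ, rhoDot ρ (⟨q, v + s • A⟩ : TangentBundle 𝓘(ℝ, E) Q) =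
      rhoDot ρ (⟨q, v⟩ : TangentBundle 𝓘(ℝ, E) Q) + s * ρ q := by
    intro s
    have h1 := h.rho_scaling q
    refine (map_add (mfderiv 𝓘(ℝ, E) 𝓘(ℝ, ℝ) ρ q) _ _).trans ?_
    exact congrArg _ ((map_smul (mfderiv 𝓘(ℝ, E) 𝓘(ℝ, ℝ) ρ q) s _).trans (congrArg (s * ·) h1))
  have hL : HasDerivAt (fun s : ℝ => L ⟨q, v + s • A⟩)
      (-(ρ q * scaleAction L D ρ ⟨q, v⟩)) 0 := by
    have h1 : HasFDerivAt (fibreLagrangian L q) (fderiv ℝ (fibreLagrangian L q) v)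
        (v + (0 : ℝ) • A) := by
      rw [hline0]; exact (h.differentiable_fibreLagrangian q v).hasFDerivAt
    refine (h1.comp_hasDerivAt 0 hline).congr_deriv ?_
    rw [h.scaleAction_eq]
    have h2 := h.rho_ne q
    change fderiv ℝ (fibreLagrangian L q) v A =
      -(ρ q * (-(fderiv ℝ (fibreLagrangian L q) v A) / ρ q))
    field_simp
  have hL2 : (fun s : ℝ => L ⟨q, v + s • A⟩) = fun s : ℝ =>
      -(ρ q ^ Λ * h.reducedLagrangian (y, scaleAction L D ρ ⟨q, v + s • A⟩)) -
        (rhoDot ρ (⟨q, v⟩ : TangentBundle 𝓘(ℝ, E) Q) + s * ρ q) *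
          scaleAction L D ρ ⟨q, v + s • A⟩ := by
    funext s
    rw [h.lagrangian_eq, hproj, hrd]
  have hm0 : HasDerivAt (fun s => h.reducedLagrangian (y, s)) m'
      (scaleAction L D ρ ⟨q, v + (0 : ℝ) • A⟩) := by rw [hline0]; exact hm
  have h3 := (((hm0.comp 0 hσ).const_mul (ρ q ^ Λ)).neg).sub
    ((((hasDerivAt_id (0 : ℝ)).mul_const (ρ q)).const_add
      (rhoDot ρ (⟨q, v⟩ : TangentBundle 𝓘(ℝ, E) Q))).mul hσ)
  rw [hL2] at hL
  have h4 := hL.unique h3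
  have h5 : (ρ q ^ Λ * m' + rhoDot ρ (⟨q, v⟩ : TangentBundle 𝓘(ℝ, E) Q)) * σ' = 0 := by
    simp only [hline0, id] at h4
    linarith
  have h6 := (mul_eq_zero.1 h5).resolve_right hσ0
  refine hm.congr_deriv ?_
  have h7 := h.rho_rpow_ne q
  change m' = -(rhoDot ρ (⟨q, v⟩ : TangentBundle 𝓘(ℝ, E) Q) / ρ q ^ Λ)
  field_simp
  linarith

/-- To first order, the action variable may be frozen in the Lagrangian. -/
theorem IsScalingSystem.deriv_lagrangian_comp {x : ℝ → TangentBundle 𝓘(ℝ, E) Q}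
    (hx : MDifferentiableAt 𝓘(ℝ, ℝ) 𝓘(ℝ, E).tangent x 0) :
    deriv (fun ε => L (x ε)) 0 = deriv (fun ε =>
      -(ρ (x ε).1 ^ Λ * h.reducedLagrangian ((scaleProj L Λ D ρ p (x ε)).1,
        scaleAction L D ρ (x 0))) - rhoDot ρ (x ε) * scaleAction L D ρ (x 0)) 0 := by
  have hα : DifferentiableAt ℝ (fun ε => ρ (x ε).1 ^ Λ) 0 :=
    ((((h.contMDiff_rho_rpow Λ).comp contMDiff_bundleProj).mdifferentiable (by simp)
      (x 0)).comp 0 hx).differentiableAt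
  have hβ : DifferentiableAt ℝ (fun ε => rhoDot ρ (x ε)) 0 :=
    (((contMDiff_rhoDot h.smooth_rho).mdifferentiable (by simp) (x 0)).comp 0 hx).differentiableAt
  have hσ : DifferentiableAt ℝ (fun ε => scaleAction L D ρ (x ε)) 0 :=
    ((h.contMDiff_scaleAction.mdifferentiable (by simp) (x 0)).comp 0 hx).differentiableAt
  set S := scaleAction L D ρ (x 0) with hS
  have hy : MDifferentiableAt 𝓘(ℝ, ℝ) 𝓘(ℝ, F).tangent
      (fun ε => (scaleProj (F := F) L Λ D ρ p (x ε)).1) 0 :=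
    (((contMDiff_scaledTangentMap (h.contMDiff_rho_rpow (1 - Λ))
      h.quot.smooth).mdifferentiable (by simp) (x 0))).comp 0 hx
  have hm : DifferentiableAt ℝ (fun y : ℝ × ℝ =>
      h.reducedLagrangian ((scaleProj L Λ D ρ p (x y.1)).1, y.2)) (0, S) := by
    have h1 : MDifferentiableAt 𝓘(ℝ, ℝ × ℝ) (𝓘(ℝ, F).tangent.prod 𝓘(ℝ, ℝ)) (fun y : ℝ × ℝ =>
        ((scaleProj (F := F) L Λ D ρ p (x y.1)).1, y.2)) (0, S) :=
      (MDifferentiableAt.comp (0, S) (f := (Prod.fst : ℝ × ℝ → ℝ)) hy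
        differentiableAt_fst.mdifferentiableAt).prodMk differentiableAt_snd.mdifferentiableAt
    exact (MDifferentiableAt.comp (0, S)
      (h.contMDiff_reducedLagrangian.mdifferentiable (by simp) _) h1).differentiableAt
  have hmd := hm.hasFDerivAt
  set m' := fderiv ℝ (fun y : ℝ × ℝ =>
      h.reducedLagrangian ((scaleProj L Λ D ρ p (x y.1)).1, y.2)) (0, S)
  have h1 : HasDerivAt (fun ε => h.reducedLagrangian ((scaleProj L Λ D ρ p (x ε)).1,
      scaleAction L D ρ (x ε))) (m' (1, deriv (fun ε => scaleAction L D ρ (x ε)) 0)) 0 :=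
    HasFDerivAt.comp_hasDerivAt (f := fun ε => (ε, scaleAction L D ρ (x ε))) 0 hmd
      ((hasDerivAt_id' (0 : ℝ)).prodMk hσ.hasDerivAt)
  have h2 : HasDerivAt (fun ε => h.reducedLagrangian ((scaleProj L Λ D ρ p (x ε)).1, S))
      (m' (1, 0)) 0 :=
    HasFDerivAt.comp_hasDerivAt (f := fun ε => (ε, S)) 0 hmd
      ((hasDerivAt_id' (0 : ℝ)).prodMk (hasDerivAt_const _ S))
  have h3 : HasDerivAt (fun s => h.reducedLagrangian ((scaleProj L Λ D ρ p (x 0)).1, s))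
      (m' (0, 1)) S :=
    HasFDerivAt.comp_hasDerivAt (f := fun s => ((0 : ℝ), s)) S hmd
      ((hasDerivAt_const S (0 : ℝ)).prodMk (hasDerivAt_id' S))
  have h4 := h3.unique (h.hasDerivAt_reducedLagrangian_snd (x 0))
  have h5 : (fun ε => L (x ε)) = fun ε =>
      -(ρ (x ε).1 ^ Λ * h.reducedLagrangian ((scaleProj L Λ D ρ p (x ε)).1,
        scaleAction L D ρ (x ε))) - rhoDot ρ (x ε) * scaleAction L D ρ (x ε) :=
    funext fun ε => h.lagrangian_eq (x ε)
  rw [h5, ((hα.hasDerivAt.fun_mul h1).fun_neg.fun_sub (hβ.hasDerivAt.fun_mul hσ.hasDerivAt)).deriv,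
    ((hα.hasDerivAt.fun_mul h2).fun_neg.fun_sub (hβ.hasDerivAt.mul_const S)).deriv]
  -- The two derivatives differ by `-(ρ^Λ ∂ℒ/∂S + ρ̇) δS`, which is zero by `h4`.
  have h6 : m' (1, deriv (fun ε => scaleAction L D ρ (x ε)) 0) =
      m' (1, 0) + deriv (fun ε => scaleAction L D ρ (x ε)) 0 * m' (0, 1) := by
    rw [← smul_eq_mul, ← map_smul, ← map_add]
    simp
  rw [h6, h4]
  have h7 := h.rho_rpow_ne (x 0).1
  simp only [← hS]
  field_simp
  ring

end FrozenAction

/-! ### Velocities of curves and of families of curves. -/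

section Velocities

variable {V : Type*} [NormedAddCommGroup V] [NormedSpace ℝ V]
  {E : Type*} [NormedAddCommGroup E] [NormedSpace ℝ E]
  {M : Type*} [TopologicalSpace M] [ChartedSpace E M]

/-- The tangent vector `dG_z(w)`, for `y = (z, w)`. -/
def pushVec (G : V → M) (y : V × V) : TangentBundle 𝓘(ℝ, E) M :=
  ⟨G y.1, mfderiv 𝓘(ℝ, V) 𝓘(ℝ, E) G y.1 y.2⟩

/-- Multiplication of tangent vectors by scalars. -/
def smulVec (c : ℝ) (x : TangentBundle 𝓘(ℝ, E) M) : TangentBundle 𝓘(ℝ, E) M := ⟨x.1, c • x.2⟩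

theorem smulVec_pushVec (c : ℝ) (G : V → M) (y : V × V) :
    smulVec (E := E) c (pushVec G y) = pushVec G (y.1, c • y.2) :=
  congrArg (fun w : E => (⟨G y.1, w⟩ : TangentBundle 𝓘(ℝ, E) M))
    (map_smul (mfderiv 𝓘(ℝ, V) 𝓘(ℝ, E) G y.1) c y.2).symm

theorem velocity_comp {G : V → M} {c : ℝ → V} {c' : V} {t : ℝ}
    (hG : MDifferentiableAt 𝓘(ℝ, V) 𝓘(ℝ, E) G (c t)) (hc : HasDerivAt c c' t) :
    velocity (E := E) (fun t => G (c t)) t = pushVec G (c t, c') := by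
  have h1 := (hG.hasMFDerivAt.comp t hc.hasFDerivAt.hasMFDerivAt).mfderiv
  have h2 : mfderiv 𝓘(ℝ, ℝ) 𝓘(ℝ, E) (fun t => G (c t)) t (1 : ℝ) =
      mfderiv 𝓘(ℝ, V) 𝓘(ℝ, E) G (c t) c' := by
    refine (DFunLike.congr_fun h1 (1 : ℝ)).trans ?_
    change mfderiv 𝓘(ℝ, V) 𝓘(ℝ, E) G (c t) ((1 : ℝ) • c') = _
    rw [one_smul]
  exact congrArg (fun w : E => (⟨G (c t), w⟩ : TangentBundle 𝓘(ℝ, E) M)) h2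

theorem velocity_slice {Γ : ℝ → ℝ → M} {ε t : ℝ}
    (hΓ : MDifferentiableAt 𝓘(ℝ, ℝ × ℝ) 𝓘(ℝ, E) (Function.uncurry Γ) (ε, t)) :
    velocity (E := E) (Γ ε) t = pushVec (Function.uncurry Γ) ((ε, t), (0, 1)) :=
  velocity_comp (c := fun t => (ε, t)) hΓ ((hasDerivAt_const t ε).prodMk (hasDerivAt_id' t))

theorem variationField_eq {Γ : ℝ → ℝ → M} {t : ℝ}
    (hΓ : MDifferentiableAt 𝓘(ℝ, ℝ × ℝ) 𝓘(ℝ, E) (Function.uncurry Γ) (0, t)) :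
    (variationField (E := E) Γ t : E) =
      mfderiv 𝓘(ℝ, ℝ × ℝ) 𝓘(ℝ, E) (Function.uncurry Γ) (0, t) ((1, 0) : ℝ × ℝ) := by
  have h1 := velocity_comp (c := fun ε : ℝ => (ε, t)) (t := 0) hΓ
    ((hasDerivAt_id' (0 : ℝ)).prodMk (hasDerivAt_const (0 : ℝ) t))
  exact eq_of_heq (Bundle.TotalSpace.mk.inj h1).2

theorem tangentBundle_mk_eq {x y : M} {v w : E} (hxy : x = y) (hvw : v = w) :
    (⟨x, v⟩ : TangentBundle 𝓘(ℝ, E) M) = ⟨y, w⟩ := by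
  subst hxy hvw
  rfl

theorem velocity_congr {γ γ' : ℝ → M} {t : ℝ} (h : γ =ᶠ[𝓝 t] γ') :
    velocity (E := E) γ t = velocity γ' t := by
  have h1 := DFunLike.congr_fun (h.mfderiv_eq (I := 𝓘(ℝ, ℝ)) (I' := 𝓘(ℝ, E))) (1 : ℝ)
  exact tangentBundle_mk_eq h.self_of_nhds h1

/-- At `a` and `b` the curves agree on one side only; since both are differentiable, the one-sided
derivative suffices. Variations are tied to their curve only on `[a, b]`. -/
theorem velocity_congr_Icc {γ γ' : ℝ → M} {a b t : ℝ} (hab : a < b) (ht : t ∈ Icc a b)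
    (hγ : MDifferentiableAt 𝓘(ℝ, ℝ) 𝓘(ℝ, E) γ t) (hγ' : MDifferentiableAt 𝓘(ℝ, ℝ) 𝓘(ℝ, E) γ' t)
    (h : ∀ t ∈ Icc a b, γ t = γ' t) : velocity (E := E) γ t = velocity γ' t := by
  have hu : UniqueMDiffWithinAt 𝓘(ℝ, ℝ) (Icc a b) t :=
    ((uniqueDiffOn_Icc hab) t ht).uniqueMDiffWithinAt
  have h1 : mfderiv 𝓘(ℝ, ℝ) 𝓘(ℝ, E) γ t = mfderiv 𝓘(ℝ, ℝ) 𝓘(ℝ, E) γ' t := by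
    rw [← mfderivWithin_eq_mfderiv hu hγ, ← mfderivWithin_eq_mfderiv hu hγ']
    exact mfderivWithin_congr h (h t ht)
  have h2 := DFunLike.congr_fun h1 (1 : ℝ)
  exact tangentBundle_mk_eq (h t ht) h2

theorem velocity_chain {γ : ℝ → M} {φ : ℝ → ℝ} {φ' τ : ℝ}
    (hγ : MDifferentiableAt 𝓘(ℝ, ℝ) 𝓘(ℝ, E) γ (φ τ)) (hφ : HasDerivAt φ φ' τ) :
    velocity (E := E) (fun τ => γ (φ τ)) τ = smulVec φ' (velocity γ (φ τ)) := by
  rw [velocity_comp hγ hφ]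
  have h1 := smulVec_pushVec (E := E) φ' γ (φ τ, 1)
  rw [smul_eq_mul, mul_one] at h1
  exact h1.symm

variable [IsManifold 𝓘(ℝ, E) ∞ M]

theorem contMDiffAt_pushVec {G : V → M} {z : V} (hG : ContMDiffAt 𝓘(ℝ, V) 𝓘(ℝ, E) ∞ G z) (w : V) :
    ContMDiffAt 𝓘(ℝ, V × V) 𝓘(ℝ, E).tangent ∞ (pushVec (E := E) G) (z, w) :=
  contMDiffAt_pushforward hG

theorem eventually_mdifferentiableAt {G : V → M} {z : V}
    (hG : ContMDiffAt 𝓘(ℝ, V) 𝓘(ℝ, E) ∞ G z) :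
    ∀ᶠ z' in 𝓝 z, MDifferentiableAt 𝓘(ℝ, V) 𝓘(ℝ, E) G z' := by
  have : IsManifold 𝓘(ℝ, E) 1 M := IsManifold.of_le (n := ∞) (by norm_num)
  exact ((contMDiffAt_iff_contMDiffAt_nhds (n := 1) (by simp)).1
    (hG.of_le (by norm_num))).mono fun z' hz' => hz'.mdifferentiableAt (by simp)

theorem contMDiffAt_velocity {q : ℝ → M} {t : ℝ} (hq : ContMDiffAt 𝓘(ℝ, ℝ) 𝓘(ℝ, E) ∞ q t) :
    ContMDiffAt 𝓘(ℝ, ℝ) 𝓘(ℝ, E).tangent ∞ (velocity (E := E) q) t :=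
  ContMDiffAt.comp (g := pushVec q) (f := fun t : ℝ => (t, (1 : ℝ))) t (contMDiffAt_pushVec hq 1)
    (contDiff_id.prodMk contDiff_const).contDiffAt.contMDiffAt

theorem velocity_slice_eventuallyEq {Γ : ℝ → ℝ → M} {z : ℝ × ℝ}
    (hΓ : ContMDiffAt 𝓘(ℝ, ℝ × ℝ) 𝓘(ℝ, E) ∞ (Function.uncurry Γ) z) :
    (fun y : ℝ × ℝ => velocity (E := E) (Γ y.1) y.2) =ᶠ[𝓝 z]
      fun y => pushVec (Function.uncurry Γ) (y, (0, 1)) :=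
  (eventually_mdifferentiableAt hΓ).mono fun _ hy => velocity_slice hy

theorem contMDiffAt_velocity_slice {Γ : ℝ → ℝ → M} {z : ℝ × ℝ}
    (hΓ : ContMDiffAt 𝓘(ℝ, ℝ × ℝ) 𝓘(ℝ, E) ∞ (Function.uncurry Γ) z) :
    ContMDiffAt 𝓘(ℝ, ℝ × ℝ) 𝓘(ℝ, E).tangent ∞
      (fun y : ℝ × ℝ => velocity (E := E) (Γ y.1) y.2) z :=
  (ContMDiffAt.comp (g := pushVec (Function.uncurry Γ)) (f := fun y : ℝ × ℝ => (y, ((0 : ℝ), (1 : ℝ))))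
    z (contMDiffAt_pushVec hΓ (0, 1))
    (contDiff_id.prodMk contDiff_const).contDiffAt.contMDiffAt).congr_of_eventuallyEq
    (velocity_slice_eventuallyEq hΓ)

/-- The first variation formula, before integration by parts. -/
theorem IsExtremal.integral_deriv_eq_zero {L : TangentBundle 𝓘(ℝ, E) M → ℝ}
    (hL : ContMDiff 𝓘(ℝ, E).tangent 𝓘(ℝ, ℝ) ∞ L) {q : ℝ → M} {a b : ℝ} (hab : a ≤ b)
    (hq : IsExtremal L q a b) {Γ : ℝ → ℝ → M} (hΓ : IsVariation E q a b Γ)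
    (hend : FixesEndpoints q a b Γ) :
    ∫ t in a..b, deriv (fun ε => L (velocity (Γ ε) t)) 0 = 0 := by
  have h1 : ∀ t ∈ Icc a b, ContDiffAt ℝ ∞ (fun y : ℝ × ℝ => L (velocity (Γ y.1) y.2)) (0, t) :=
    fun t ht => ((hL _).comp (0, t) (contMDiffAt_velocity_slice (hΓ.1 t ht))).contDiffAt
  have h2 := hasDerivAt_integral_of_contDiffAt hab fun t ht => (h1 t ht).of_le (by norm_num)
  refine Eq.trans ?_ ((hq.2 Γ hΓ hend).unique h2).symm
  refine intervalIntegral.integral_congr fun t ht => ?_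
  rw [uIcc_of_le hab] at ht
  have h3 := ((h1 t ht).differentiableAt (by simp)).hasFDerivAt
  exact (HasFDerivAt.comp_hasDerivAt (f := fun ε : ℝ => (ε, t)) 0 h3
    ((hasDerivAt_id' (0 : ℝ)).prodMk (hasDerivAt_const (0 : ℝ) t))).deriv

end Velocities

/-! ### The variational principle in terms of `p ∘ q` and `ρ ∘ q`. -/

section ReducedPrinciple

variable {E : Type*} [NormedAddCommGroup E] [NormedSpace ℝ E] [FiniteDimensional ℝ E]
  {Q : Type*} [TopologicalSpace Q] [ChartedSpace E Q] [IsManifold 𝓘(ℝ, E) ∞ Q]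
  {F : Type*} [NormedAddCommGroup F] [NormedSpace ℝ F] [FiniteDimensional ℝ F]
  {B : Type*} [TopologicalSpace B] [ChartedSpace F B] [IsManifold 𝓘(ℝ, F) ∞ B]
  {L : TangentBundle 𝓘(ℝ, E) Q → ℝ} {Λ : ℝ}
  {D : ∀ x : TangentBundle 𝓘(ℝ, E) Q, TangentSpace 𝓘(ℝ, E).tangent x} {ρ : Q → ℝ} {p : Q → B}

theorem rhoDot_velocity {γ : ℝ → Q} {t : ℝ} (hρ : MDifferentiableAt 𝓘(ℝ, E) 𝓘(ℝ, ℝ) ρ (γ t))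
    (hγ : MDifferentiableAt 𝓘(ℝ, ℝ) 𝓘(ℝ, E) γ t) :
    rhoDot ρ (velocity (E := E) γ t) = deriv (fun t => ρ (γ t)) t := by
  have h1 := mfderiv_comp t hρ hγ
  have h2 := DFunLike.congr_fun h1 (1 : ℝ)
  rw [mfderiv_eq_fderiv] at h2
  exact h2.symm

theorem scaleProj_velocity_fst {γ : ℝ → Q} {t : ℝ} (hp : MDifferentiableAt 𝓘(ℝ, E) 𝓘(ℝ, F) p (γ t))
    (hγ : MDifferentiableAt 𝓘(ℝ, ℝ) 𝓘(ℝ, E) γ t) :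
    (scaleProj (F := F) L Λ D ρ p (velocity γ t)).1 =
      smulVec (ρ (γ t) ^ (1 - Λ)) (velocity (fun t => p (γ t)) t) := by
  have h1 := DFunLike.congr_fun (mfderiv_comp t hp hγ) (1 : ℝ)
  exact congrArg (fun w : F => (⟨p (γ t), ρ (γ t) ^ (1 - Λ) • w⟩ : TangentBundle 𝓘(ℝ, F) B)) h1.symm

variable (h : IsScalingSystem F L Λ D ρ p)
include h

/-- The map `(p, ρ)` has a global left inverse which is smooth along its image. -/
theorem IsScalingSystem.exists_global_inverse :
    ∃ G : B × ℝ → Q, ∀ q, ContMDiffAt (𝓘(ℝ, F).prod 𝓘(ℝ, ℝ)) 𝓘(ℝ, E) ∞ G (p q, ρ q) ∧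
      G (p q, ρ q) = q ∧ ∀ᶠ y in 𝓝 (p q, ρ q), p (G y) = y.1 ∧ ρ (G y) = y.2 := by
  classical
  have hex : ∀ y : B × ℝ, ∃ q : Q, (∃ q', p q' = y.1 ∧ ρ q' = y.2) → p q = y.1 ∧ ρ q = y.2 := by
    intro y
    by_cases hy : ∃ q', p q' = y.1 ∧ ρ q' = y.2
    · exact ⟨hy.choose, fun _ => hy.choose_spec⟩
    · exact ⟨(h.quot.surjective y.1).choose, fun h' => absurd h' hy⟩
  choose G hG using hex
  refine ⟨G, fun q => ?_⟩
  obtain ⟨g, hg, hgq, hgy, -⟩ := h.exists_inverse_p_rho q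
  -- Injectivity of `(p, ρ)` leaves no freedom in the choice of `G` near a point of the image, so
  -- `G` inherits the smoothness of the local inverse.
  have he : G =ᶠ[𝓝 (p q, ρ q)] g := by
    filter_upwards [hgy] with y hy
    have h1 := hG y ⟨g y, hy⟩
    exact h.eq_of_p_rho_eq (h1.1.trans hy.1.symm) (h1.2.trans hy.2.symm)
  refine ⟨hg.congr_of_eventuallyEq he, he.self_of_nhds.trans hgq, ?_⟩
  filter_upwards [he, hgy] with y h1 h2
  rwa [h1]

/-- This makes `p ∘ q` and `ρ ∘ q` independent variables: arbitrary variations of the two are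
composed with the inverse of `(p, ρ)`. -/
theorem IsScalingSystem.exists_lift_variation {q : ℝ → Q} {a b : ℝ} {Γ : ℝ → ℝ → B}
    {R : ℝ → ℝ → ℝ} (hΓ : IsVariation F (fun t => p (q t)) a b Γ)
    (hR : IsVariation ℝ (fun t => ρ (q t)) a b R)
    (hΓe : FixesEndpoints (fun t => p (q t)) a b Γ) (hRe : FixesEndpoints (fun t => ρ (q t)) a b R) :
    ∃ γ : ℝ → ℝ → Q, IsVariation E q a b γ ∧ FixesEndpoints q a b γ ∧ ∀ t ∈ Icc a b,
      ∀ᶠ y in 𝓝 ((0 : ℝ), t), p (γ y.1 y.2) = Γ y.1 y.2 ∧ ρ (γ y.1 y.2) = R y.1 y.2 := by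
  obtain ⟨G, hG⟩ := h.exists_global_inverse
  have hmap : ∀ t ∈ Icc a b, ContMDiffAt 𝓘(ℝ, ℝ × ℝ) (𝓘(ℝ, F).prod 𝓘(ℝ, ℝ)) ∞
      (fun y : ℝ × ℝ => (Γ y.1 y.2, R y.1 y.2)) (0, t) := fun t ht =>
    (hΓ.1 t ht).prodMk (hR.1 t ht)
  have hmap0 : ∀ t ∈ Icc a b, (Γ 0 t, R 0 t) = (p (q t), ρ (q t)) := fun t ht => by
    rw [hΓ.2 t ht, hR.2 t ht]
  refine ⟨fun ε t => G (Γ ε t, R ε t), ⟨fun t ht => ?_, fun t ht => ?_⟩, ?_, fun t ht => ?_⟩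
  · refine ContMDiffAt.comp (0, t) (g := G) (f := fun y : ℝ × ℝ => (Γ y.1 y.2, R y.1 y.2)) ?_
      (hmap t ht)
    simp only [hmap0 t ht]
    exact (hG (q t)).1
  · simp only [hmap0 t ht]
    exact (hG (q t)).2.1
  · filter_upwards [hΓe, hRe] with ε h1 h2
    refine ⟨?_, ?_⟩
    · rw [h1.1, h2.1]; exact (hG (q a)).2.1
    · rw [h1.2, h2.2]; exact (hG (q b)).2.1
  · have h1 := (hG (q t)).2.2
    rw [← hmap0 t ht] at h1
    exact (hmap t ht).continuousAt.tendsto.eventually h1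

/-- The variational principle for `(p ∘ q, ρ ∘ q)`, with frozen action variable. -/
theorem IsScalingSystem.integral_deriv_reduced_eq_zero {q : ℝ → Q} {a b : ℝ} (hab : a < b)
    (hq : IsExtremal L q a b) {Γ : ℝ → ℝ → B} {R : ℝ → ℝ → ℝ}
    (hΓ : IsVariation F (fun t => p (q t)) a b Γ)
    (hR : IsVariation ℝ (fun t => ρ (q t)) a b R)
    (hΓe : FixesEndpoints (fun t => p (q t)) a b Γ) (hRe : FixesEndpoints (fun t => ρ (q t)) a b R) :
    ∫ t in a..b, deriv (fun ε => -(R ε t ^ Λ * h.reducedLagrangian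
      (smulVec (R ε t ^ (1 - Λ)) (velocity (Γ ε) t), scaleAction L D ρ (velocity q t))) -
      deriv (R ε) t * scaleAction L D ρ (velocity q t)) 0 = 0 := by
  obtain ⟨γ, hγ, hγe, hγp⟩ := h.exists_lift_variation hΓ hR hΓe hRe
  refine Eq.trans ?_ (hq.integral_deriv_eq_zero h.smooth hab.le hγ hγe)
  refine intervalIntegral.integral_congr fun t ht => ?_
  rw [uIcc_of_le hab.le] at ht
  have hγt := hγ.1 t ht
  have hvel := contMDiffAt_velocity_slice hγt
  have hslice : ContinuousAt (fun ε : ℝ => (ε, t)) 0 := by fun_prop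
  have hx : MDifferentiableAt 𝓘(ℝ, ℝ) 𝓘(ℝ, E).tangent (fun ε => velocity (E := E) (γ ε) t) 0 :=
    MDifferentiableAt.comp (f := fun ε : ℝ => (ε, t)) 0 (hvel.mdifferentiableAt (by simp))
      (differentiableAt_id.prodMk (differentiableAt_const t)).mdifferentiableAt
  have h0 : velocity (E := E) (γ 0) t = velocity q t := by
    refine velocity_congr_Icc hab ht ?_ ((hq.1 t ht).mdifferentiableAt (by simp)) hγ.2
    exact MDifferentiableAt.comp (f := fun t' : ℝ => ((0 : ℝ), t')) t
      (hγt.mdifferentiableAt (by simp))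
      ((differentiableAt_const _).prodMk differentiableAt_id).mdifferentiableAt
  have h1 := h.deriv_lagrangian_comp hx
  refine Eq.trans ?_ h1.symm
  rw [h0]
  refine Filter.EventuallyEq.deriv_eq ?_
  -- For each small ε the identities are needed on a neighbourhood of `t`, since their derivatives
  -- in `t` enter.
  have h2 := hslice.tendsto.eventually (hγp t ht).eventually_nhds
  have h3 := hslice.tendsto.eventually (eventually_mdifferentiableAt hγt)
  filter_upwards [h2, h3] with ε h2 h3
  have h4 : MDifferentiableAt 𝓘(ℝ, ℝ) 𝓘(ℝ, E) (γ ε) t :=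
    MDifferentiableAt.comp (f := fun t' : ℝ => (ε, t')) t h3
      ((differentiableAt_const _).prodMk differentiableAt_id).mdifferentiableAt
  have h5 : ∀ᶠ t' in 𝓝 t, p (γ ε t') = Γ ε t' ∧ ρ (γ ε t') = R ε t' := by
    have : ContinuousAt (fun t' : ℝ => (ε, t')) t := by fun_prop
    exact this.tendsto.eventually h2
  have h6 : ρ (γ ε t) = R ε t := h5.self_of_nhds.2
  rw [scaleProj_velocity_fst (h.quot.smooth.mdifferentiable (by simp) _) h4,
    rhoDot_velocity (h.smooth_rho.mdifferentiable (by simp) _) h4,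
    velocity_congr (h5.mono fun _ h' => h'.1), h6,
    Filter.EventuallyEq.deriv_eq (h5.mono fun _ h' => h'.2)]
  change _ = -(ρ (γ ε t) ^ Λ * _) - _
  rw [h6]

end ReducedPrinciple

/-! ### A Lagrangian pulled back along a map from a vector space. -/

section PushedLagrangian

variable {V : Type*} [NormedAddCommGroup V] [NormedSpace ℝ V]
  {F : Type*} [NormedAddCommGroup F] [NormedSpace ℝ F]
  {B : Type*} [TopologicalSpace B] [ChartedSpace F B] [IsManifold 𝓘(ℝ, F) ∞ B]
  {l : TangentBundle 𝓘(ℝ, F) B × ℝ → ℝ}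
  (hl : ContMDiff (𝓘(ℝ, F).tangent.prod 𝓘(ℝ, ℝ)) 𝓘(ℝ, ℝ) ∞ l)
include hl

/-- Pulling back along `G` and its differential replaces the tangent bundle by a vector space, so
that derivatives along variations become ordinary derivatives without charts of `B`. -/
theorem contDiffAt_pushLag {G : V → B} {z : V} (hG : ContMDiffAt 𝓘(ℝ, V) 𝓘(ℝ, F) ∞ G z) (w : V)
    (s : ℝ) : ContDiffAt ℝ ∞ (fun y : (V × V) × ℝ => l (pushVec G y.1, y.2)) ((z, w), s) := by
  have h1 : ContMDiffAt 𝓘(ℝ, (V × V) × ℝ) (𝓘(ℝ, F).tangent.prod 𝓘(ℝ, ℝ)) ∞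
      (fun y : (V × V) × ℝ => (pushVec (E := F) G y.1, y.2)) ((z, w), s) :=
    (ContMDiffAt.comp (f := (Prod.fst : (V × V) × ℝ → V × V)) ((z, w), s)
      (contMDiffAt_pushVec hG w) contDiffAt_fst.contMDiffAt).prodMk contDiffAt_snd.contMDiffAt
  exact (ContMDiffAt.comp ((z, w), s) (hl _) h1).contDiffAt

theorem contMDiff_lag_left (s : ℝ) : ContMDiff 𝓘(ℝ, F).tangent 𝓘(ℝ, ℝ) ∞ (fun x => l (x, s)) :=
  hl.comp (contMDiff_id.prodMk contMDiff_const)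

/-- The fibre derivative in terms of the pushed forward Lagrangian. -/
theorem fibreDeriv_pushVec {G : V → B} {z : V} (hG : ContMDiffAt 𝓘(ℝ, V) 𝓘(ℝ, F) ∞ G z) (w u : V)
    (s : ℝ) :
    fibreDeriv (fun x => l (x, s)) (pushVec G (z, w)) (mfderiv 𝓘(ℝ, V) 𝓘(ℝ, F) G z u) =
      fderiv ℝ (fun y : (V × V) × ℝ => l (pushVec G y.1, y.2)) ((z, w), s) ((0, u), 0) := by
  have h1 := ((contDiffAt_pushLag hl hG w s).differentiableAt (by simp)).hasFDerivAt
  have h2 : HasFDerivAt (fun w' : V => ((z, w'), s))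
      (((0 : V →L[ℝ] V).prod (ContinuousLinearMap.id ℝ V)).prod 0) w :=
    ((hasFDerivAt_const z w).prodMk (hasFDerivAt_id w)).prodMk (hasFDerivAt_const s w)
  have h3 := HasFDerivAt.comp (f := fun w' : V => ((z, w'), s)) w h1 h2
  have h4 := ((contDiff_fibreLagrangian (contMDiff_lag_left hl s) (G z)).differentiable (by simp)
    (show F from mfderiv 𝓘(ℝ, V) 𝓘(ℝ, F) G z w)).hasFDerivAt
  have h5 := HasFDerivAt.comp w h4
    (show V →L[ℝ] F from mfderiv 𝓘(ℝ, V) 𝓘(ℝ, F) G z).hasFDerivAt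
  exact DFunLike.congr_fun (h5.unique h3) u

end PushedLagrangian

/-! ### Partial derivatives of the Lagrangian along a variation. -/

section PartialDerivatives

variable {F : Type*} [NormedAddCommGroup F] [NormedSpace ℝ F]
  {B : Type*} [TopologicalSpace B] [ChartedSpace F B]

/-- The derivative of `l (∂Γ(z) w, s)` at `z = (0, τ)`, `w = (0, 1)`, `s = S τ`. -/
def partialLag (l : TangentBundle 𝓘(ℝ, F) B × ℝ → ℝ) (Γ : ℝ → ℝ → B) (S : ℝ → ℝ) (τ : ℝ) :
    (((ℝ × ℝ) × (ℝ × ℝ)) × ℝ) →L[ℝ] ℝ :=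
  fderiv ℝ (fun y => l (pushVec (Function.uncurry Γ) y.1, y.2)) (((0, τ), (0, 1)), S τ)

variable [IsManifold 𝓘(ℝ, F) ∞ B] {l : TangentBundle 𝓘(ℝ, F) B × ℝ → ℝ}
  (hl : ContMDiff (𝓘(ℝ, F).tangent.prod 𝓘(ℝ, ℝ)) 𝓘(ℝ, ℝ) ∞ l)
  {Γ : ℝ → ℝ → B} {τ : ℝ}
  (hΓ : ContMDiffAt 𝓘(ℝ, ℝ × ℝ) 𝓘(ℝ, F) ∞ (Function.uncurry Γ) (0, τ))
include hl hΓ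

theorem continuousAt_partialLag {S : ℝ → ℝ} (hS : ContinuousAt S τ) :
    ContinuousAt (partialLag l Γ S) τ := by
  have h1 := ((contDiffAt_pushLag hl hΓ (0, 1) (S τ)).fderiv_right (m := 0) (by simp)).continuousAt
  exact ContinuousAt.comp (f := fun τ => ((((0 : ℝ), τ), ((0 : ℝ), (1 : ℝ))), S τ)) h1
    (by fun_prop)

theorem contDiffAt_lag_velocity {T : ℝ → ℝ → ℝ}
    (hT : ContDiffAt ℝ ∞ (Function.uncurry T) (0, τ)) :
    ContDiffAt ℝ ∞ (fun y : ℝ × ℝ => l (velocity (Γ y.1) y.2, T y.1 y.2)) (0, τ) :=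
  (ContMDiffAt.comp (0, τ) (hl _)
    ((contMDiffAt_velocity_slice hΓ).prodMk hT.contMDiffAt)).contDiffAt

theorem fderiv_lag_velocity {T : ℝ → ℝ → ℝ}
    (hT : ContDiffAt ℝ ∞ (Function.uncurry T) (0, τ)) :
    fderiv ℝ (fun y : ℝ × ℝ => l (velocity (Γ y.1) y.2, T y.1 y.2)) (0, τ) (1, 0) =
      partialLag l Γ (T 0) τ (((1, 0), 0), fderiv ℝ (Function.uncurry T) (0, τ) (1, 0)) := by
  have h1 : (fun y : ℝ × ℝ => l (velocity (Γ y.1) y.2, T y.1 y.2)) =ᶠ[𝓝 (0, τ)]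
      fun y => l (pushVec (Function.uncurry Γ) (y, (0, 1)), Function.uncurry T y) :=
    (velocity_slice_eventuallyEq hΓ).mono fun y hy => congrArg (fun x => l (x, T y.1 y.2)) hy
  rw [h1.fderiv_eq]
  have h2 := ((contDiffAt_pushLag hl hΓ (0, 1) (T 0 τ)).differentiableAt (by simp)).hasFDerivAt
  have h3 : HasFDerivAt (fun y : ℝ × ℝ => ((y, ((0 : ℝ), (1 : ℝ))), Function.uncurry T y))
      (((ContinuousLinearMap.id ℝ (ℝ × ℝ)).prod 0).prod (fderiv ℝ (Function.uncurry T) (0, τ)))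
      (0, τ) :=
    ((hasFDerivAt_id _).prodMk (hasFDerivAt_const _ _)).prodMk
      (hT.differentiableAt (by simp)).hasFDerivAt
  have h4 := HasFDerivAt.comp
    (f := fun y : ℝ × ℝ => ((y, ((0 : ℝ), (1 : ℝ))), Function.uncurry T y)) (0, τ) h2 h3
  exact DFunLike.congr_fun h4.fderiv (1, 0)

end PartialDerivatives

/-! ### The equation for the action, from varying the scaling function. -/

section ReducedEquations

variable {E : Type*} [NormedAddCommGroup E] [NormedSpace ℝ E] [FiniteDimensional ℝ E]
  {Q : Type*} [TopologicalSpace Q] [ChartedSpace E Q] [IsManifold 𝓘(ℝ, E) ∞ Q]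
  {F : Type*} [NormedAddCommGroup F] [NormedSpace ℝ F] [FiniteDimensional ℝ F]
  {B : Type*} [TopologicalSpace B] [ChartedSpace F B] [IsManifold 𝓘(ℝ, F) ∞ B]
  {L : TangentBundle 𝓘(ℝ, E) Q → ℝ} {Λ : ℝ}
  {D : ∀ x : TangentBundle 𝓘(ℝ, E) Q, TangentSpace 𝓘(ℝ, E).tangent x} {ρ : Q → ℝ} {p : Q → B}
  (h : IsScalingSystem F L Λ D ρ p)
include h

theorem IsScalingSystem.smoothCurve_p {q : ℝ → Q} {t : ℝ}
    (hq : ContMDiffAt 𝓘(ℝ, ℝ) 𝓘(ℝ, E) ∞ q t) :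
    ContMDiffAt 𝓘(ℝ, ℝ) 𝓘(ℝ, F) ∞ (fun t => p (q t)) t :=
  (h.quot.smooth _).comp t hq

theorem IsScalingSystem.contDiffAt_rho {q : ℝ → Q} {t : ℝ}
    (hq : ContMDiffAt 𝓘(ℝ, ℝ) 𝓘(ℝ, E) ∞ q t) : ContDiffAt ℝ ∞ (fun t => ρ (q t)) t :=
  ((h.smooth_rho _).comp t hq).contDiffAt

theorem IsScalingSystem.contDiffAt_action {q : ℝ → Q} {t : ℝ}
    (hq : ContMDiffAt 𝓘(ℝ, ℝ) 𝓘(ℝ, E) ∞ q t) :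
    ContDiffAt ℝ ∞ (fun t => scaleAction L D ρ (velocity q t)) t :=
  ((h.contMDiff_scaleAction _).comp t (contMDiffAt_velocity hq)).contDiffAt

theorem IsScalingSystem.scaleProj_velocity {q : ℝ → Q} {t : ℝ}
    (hq : ContMDiffAt 𝓘(ℝ, ℝ) 𝓘(ℝ, E) ∞ q t) :
    scaleProj (F := F) L Λ D ρ p (velocity q t) =
      (pushVec (fun t => p (q t)) (t, ρ (q t) ^ (1 - Λ)), scaleAction L D ρ (velocity q t)) := by
  refine Prod.ext ?_ rfl
  rw [scaleProj_velocity_fst (h.quot.smooth.mdifferentiable (by simp) _)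
    (hq.mdifferentiableAt (by simp))]
  have h1 := smulVec_pushVec (E := F) (ρ (q t) ^ (1 - Λ)) (fun t => p (q t)) (t, 1)
  rw [smul_eq_mul, mul_one] at h1
  exact h1

/-- The equation of motion of the action variable, in the original time. -/
theorem IsScalingSystem.deriv_action {q : ℝ → Q} {a b : ℝ} (hab : a < b)
    (hq : IsExtremal L q a b) {t : ℝ} (ht : t ∈ Icc a b) :
    deriv (fun t => scaleAction L D ρ (velocity q t)) t = ρ (q t) ^ Λ / ρ (q t) *
      actionRate h.reducedLagrangian Λ (scaleProj L Λ D ρ p (velocity q t)) := by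
  set l := h.reducedLagrangian with hldef
  have hl := h.contMDiff_reducedLagrangian
  rw [← hldef] at hl
  set S : ℝ → ℝ := fun t => scaleAction L D ρ (velocity q t) with hSdef
  set r : ℝ → ℝ := fun t => ρ (q t) with hrdef
  set G : ℝ → B := fun t => p (q t) with hGdef
  have hrs : ∀ t ∈ Icc a b, ContDiffAt ℝ ∞ r t := fun t ht => h.contDiffAt_rho (hq.1 t ht)
  have hSs : ∀ t ∈ Icc a b, ContDiffAt ℝ ∞ S t := fun t ht => h.contDiffAt_action (hq.1 t ht)
  have hGs : ∀ t ∈ Icc a b, ContMDiffAt 𝓘(ℝ, ℝ) 𝓘(ℝ, F) ∞ G t := fun t ht =>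
    h.smoothCurve_p (hq.1 t ht)
  have hr0 : ∀ t, r t ≠ 0 := fun t => h.rho_ne _
  have hrp : ∀ t ∈ Icc a b, ∀ e : ℝ, ContDiffAt ℝ ∞ (fun t => r t ^ e) t := fun t ht e =>
    (hrs t ht).rpow_const_of_ne (hr0 t)
  let lf : (ℝ × ℝ) × ℝ → ℝ := fun y => l (pushVec G y.1, y.2)
  let P : ℝ → (ℝ × ℝ) × ℝ := fun t => ((t, r t ^ (1 - Λ)), S t)
  have hlf : ∀ t ∈ Icc a b, ContDiffAt ℝ ∞ lf (P t) := fun t ht =>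
    contDiffAt_pushLag hl (hGs t ht) _ _
  -- `W` is `∂ℒ/∂q̄'` applied to the `t`-velocity of `p ∘ q`, so `rate` is `ℒ + (1 - Λ) ℰ` with the
  -- two multiples of ℒ collected.
  let W : ℝ → ℝ := fun t => fderiv ℝ lf (P t) ((0, 1), 0)
  let rate : ℝ → ℝ := fun t => Λ * lf (P t) + (1 - Λ) * (r t ^ (1 - Λ) * W t)
  have hrate : ∀ t ∈ Icc a b, actionRate l Λ (scaleProj L Λ D ρ p (velocity q t)) = rate t := by
    intro t ht
    rw [h.scaleProj_velocity (hq.1 t ht)]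
    have h1 := fibreDeriv_pushVec hl (hGs t ht) (r t ^ (1 - Λ)) (r t ^ (1 - Λ)) (S t)
    have h2 : fderiv ℝ lf (P t) ((0, r t ^ (1 - Λ)), 0) = r t ^ (1 - Λ) * W t := by
      change _ = r t ^ (1 - Λ) • fderiv ℝ lf (P t) ((0, 1), 0)
      rw [← map_smul]
      simp
    have h3 := h1.trans h2
    change lf (P t) + (1 - Λ) * (fibreDeriv (fun x => l (x, S t))
      (pushVec G (t, r t ^ (1 - Λ))) (mfderiv 𝓘(ℝ, ℝ) 𝓘(ℝ, F) G t (r t ^ (1 - Λ))) - lf (P t)) = _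
    rw [h3]
    simp only [rate]
    ring
  have hPc : ∀ t ∈ Icc a b, ContinuousAt P t := fun t ht =>
    (continuousAt_id.prodMk (hrp t ht _).continuousAt).prodMk (hSs t ht).continuousAt
  have hratec : ∀ t ∈ Icc a b, ContinuousAt rate t := by
    intro t ht
    have h1 : ContinuousAt (fun t => lf (P t)) t :=
      ContinuousAt.comp (g := lf) (hlf t ht).continuousAt (hPc t ht)
    have h2 : ContinuousAt W t := ContinuousAt.comp (g := fun z => fderiv ℝ lf z ((0, 1), 0))
      (continuousAt_fderiv_apply ((hlf t ht).of_le (by norm_num)) _) (hPc t ht)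
    exact (continuousAt_const.mul h1).add
      (continuousAt_const.mul ((hrp t ht _).continuousAt.mul h2))
  have hdS : ∀ t ∈ Icc a b, ContinuousAt (deriv S) t := fun t ht => by
    have h1 := continuousAt_fderiv_apply ((hSs t ht).of_le (m := 1) (by norm_num)) (1 : ℝ)
    exact h1
  have hc : ContinuousOn (fun t => deriv S t - r t ^ Λ / r t * rate t) (Icc a b) := fun t ht =>
    ((hdS t ht).sub ((((hrp t ht _).continuousAt.div (hrs t ht).continuousAt (hr0 t))).mul
      (hratec t ht))).continuousWithinAt
  have key := eq_zero_of_integral_mul_eq_zero hab hc ?_ t ht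
  · rw [hrate t ht]
    linarith
  intro g hg hgs
  have hga : g a = 0 := image_eq_zero_of_notMem_tsupport fun h' => (hgs h').1.ne rfl
  have hgb : g b = 0 := image_eq_zero_of_notMem_tsupport fun h' => (hgs h').2.ne rfl
  -- Only the scaling function is varied, to `ρ + ε g`. The explicit power `ρ^Λ` contributes `Λ ℒ`
  -- and the factor `ρ^(1-Λ)` in the velocity contributes `(1 - Λ) ∂ℒ/∂q̄'·q̄'`, each times `-g
  -- ρ^(Λ-1)`. The last term gives `-ġ S`, to be integrated by parts.
  have hprin := h.integral_deriv_reduced_eq_zero hab hq (Γ := fun _ t => p (q t))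
    (R := fun ε t => ρ (q t) + ε * g t)
    ⟨fun t ht => ContMDiffAt.comp (f := (Prod.snd : ℝ × ℝ → ℝ)) (0, t) (hGs t ht)
      contDiffAt_snd.contMDiffAt, fun t ht => rfl⟩
    ⟨fun t ht => ((ContDiffAt.comp (f := (Prod.snd : ℝ × ℝ → ℝ)) (0, t) (hrs t ht)
      contDiffAt_snd).add (contDiffAt_fst.mul (hg.contDiffAt.comp (0, t)
      contDiffAt_snd))).contMDiffAt, fun t ht => by simp⟩
    (Eventually.of_forall fun ε => ⟨rfl, rfl⟩)
    (Eventually.of_forall fun ε => ⟨by simp [hga], by simp [hgb]⟩)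
  have hd : ∀ t ∈ Icc a b, deriv (fun ε => -((ρ (q t) + ε * g t) ^ Λ * l
      (smulVec ((ρ (q t) + ε * g t) ^ (1 - Λ)) (velocity (fun t => p (q t)) t), S t)) -
      deriv (fun t => ρ (q t) + ε * g t) t * S t) 0 =
      -(g t * (r t ^ Λ / r t * rate t)) - deriv g t * S t := by
    intro t ht
    have e1 : (fun ε : ℝ => -((ρ (q t) + ε * g t) ^ Λ * l
      (smulVec ((ρ (q t) + ε * g t) ^ (1 - Λ)) (velocity (fun t => p (q t)) t), S t)) -
      deriv (fun t => ρ (q t) + ε * g t) t * S t) = fun ε : ℝ =>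
        -((r t + ε * g t) ^ Λ * lf ((t, (r t + ε * g t) ^ (1 - Λ)), S t)) -
          (deriv r t + ε * deriv g t) * S t := by
      funext ε
      have e2 : deriv (fun t => ρ (q t) + ε * g t) t = deriv r t + ε * deriv g t :=
        (((hrs t ht).differentiableAt (by simp)).hasDerivAt.add
          ((hg.differentiable (by simp) t).hasDerivAt.const_mul ε)).deriv
      have e3 := smulVec_pushVec (E := F) ((r t + ε * g t) ^ (1 - Λ)) G (t, 1)
      rw [smul_eq_mul, mul_one] at e3
      rw [e2]
      exact congrArg (fun x => -((r t + ε * g t) ^ Λ * l (x, S t)) -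
        (deriv r t + ε * deriv g t) * S t) e3
    rw [e1]
    have hb : HasDerivAt (fun ε : ℝ => r t + ε * g t) (g t) 0 := by
      simpa using ((hasDerivAt_id' (0 : ℝ)).mul_const (g t)).const_add (r t)
    have hb0 : r t + 0 * g t = r t := by ring
    have hpow : ∀ e : ℝ, HasDerivAt (fun ε : ℝ => (r t + ε * g t) ^ e)
        (g t * e * (r t ^ e / r t)) 0 := by
      intro e
      have := hb.rpow_const (p := e) (Or.inl (by rw [hb0]; exact hr0 t))
      rwa [hb0, Real.rpow_sub_one (hr0 t)] at this
    have hlfd : HasFDerivAt lf (fderiv ℝ lf (P t)) ((t, (r t + 0 * g t) ^ (1 - Λ)), S t) := by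
      rw [hb0]
      exact ((hlf t ht).differentiableAt (by simp)).hasFDerivAt
    have hlfe : HasDerivAt (fun ε : ℝ => lf ((t, (r t + ε * g t) ^ (1 - Λ)), S t))
        (fderiv ℝ lf (P t) ((0, g t * (1 - Λ) * (r t ^ (1 - Λ) / r t)), 0)) 0 :=
      HasFDerivAt.comp_hasDerivAt (f := fun ε : ℝ => ((t, (r t + ε * g t) ^ (1 - Λ)), S t)) 0 hlfd
        (((hasDerivAt_const _ t).prodMk (hpow (1 - Λ))).prodMk (hasDerivAt_const _ (S t)))
    have hlin : fderiv ℝ lf (P t) ((0, g t * (1 - Λ) * (r t ^ (1 - Λ) / r t)), 0) =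
        g t * (1 - Λ) * (r t ^ (1 - Λ) / r t) * W t := by
      change _ = (g t * (1 - Λ) * (r t ^ (1 - Λ) / r t)) • fderiv ℝ lf (P t) ((0, 1), 0)
      rw [← map_smul]
      simp
    rw [hlin] at hlfe
    have hfin := ((((hpow Λ).fun_mul hlfe).fun_neg).fun_sub
      ((((hasDerivAt_id' (0 : ℝ)).mul_const (deriv g t)).const_add (deriv r t)).mul_const
        (S t))).deriv
    rw [hfin, hb0]
    have e5 : r t ^ (1 - Λ) = r t / r t ^ Λ := (h.rho_div_rpow (q t)).symm
    have e6 : r t ^ Λ ≠ 0 := h.rho_rpow_ne (q t)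
    have e7 := hr0 t
    simp only [rate, P]
    rw [e5]
    field_simp
  have hprin2 : ∫ t in a..b, (-(g t * (r t ^ Λ / r t * rate t)) - deriv g t * S t) = 0 := by
    refine Eq.trans (intervalIntegral.integral_congr fun t ht => ?_) hprin
    rw [uIcc_of_le hab.le] at ht
    exact (hd t ht).symm
  have hicc : ∀ {f : ℝ → ℝ}, (∀ t ∈ Icc a b, ContinuousAt f t) →
      IntervalIntegrable f MeasureTheory.volume a b := fun {f} hf => by
    apply ContinuousOn.intervalIntegrable
    rw [uIcc_of_le hab.le]
    exact fun t ht => (hf t ht).continuousWithinAt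
  have hgd : ∀ t, HasDerivAt g (deriv g t) t := fun t => (hg.differentiable (by simp) t).hasDerivAt
  have hgdc : Continuous (deriv g) := hg.continuous_deriv (by norm_num)
  have hSd : ∀ t ∈ Icc a b, HasDerivAt S (deriv S t) t := fun t ht =>
    ((hSs t ht).differentiableAt (by simp)).hasDerivAt
  have hibp : ∫ t in a..b, (deriv g t * S t + g t * deriv S t) = 0 := by
    rw [intervalIntegral.integral_deriv_mul_eq_sub (fun t _ => hgd t)
      (fun t ht => hSd t (by rwa [uIcc_of_le hab.le] at ht))
      (hicc fun t _ => hgdc.continuousAt) (hicc hdS), hga, hgb]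
    ring
  have hcr : ∀ t ∈ Icc a b, ContinuousAt (fun t => r t ^ Λ / r t * rate t) t := fun t ht =>
    ((hrp t ht _).continuousAt.div (hrs t ht).continuousAt (hr0 t)).mul (hratec t ht)
  have hsum := intervalIntegral.integral_add
    (hicc (f := fun t => -(g t * (r t ^ Λ / r t * rate t)) - deriv g t * S t) fun t ht =>
      ((hg.continuous.continuousAt.mul (hcr t ht)).neg.sub
        (hgdc.continuousAt.mul (hSs t ht).continuousAt)))
    (hicc (f := fun t => deriv g t * S t + g t * deriv S t) fun t ht =>
      ((hgdc.continuousAt.mul (hSs t ht).continuousAt).add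
        (hg.continuous.continuousAt.mul (hdS t ht))))
  rw [hprin2, hibp, add_zero] at hsum
  rw [← hsum]
  refine intervalIntegral.integral_congr fun t _ => ?_
  ring

end ReducedEquations

/-! ### The reduced curve in the new time. -/

section ReducedTime

/-- `ψ` is inverse to the change of parameter `t = φ(τ)` along the smooth curve `q`, where
`dt = ρ^(1 - Λ) dτ`. -/
structure IsInverseTime (E : Type*) [NormedAddCommGroup E] [NormedSpace ℝ E]
    {Q : Type*} [TopologicalSpace Q] [ChartedSpace E Q] (Λ : ℝ) (ρ : Q → ℝ) (q : ℝ → Q)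
    (a b c d : ℝ) (φ ψ : ℝ → ℝ) : Prop where
  lt : a < b
  lt' : c < d
  smooth : SmoothCurve E q a b
  smooth_time : ∀ τ ∈ Icc c d, ContDiffAt ℝ ∞ φ τ
  hasDerivAt : ∀ τ ∈ Icc c d, HasDerivAt φ (ρ (q (φ τ)) ^ (1 - Λ)) τ
  mem : ∀ τ ∈ Icc c d, φ τ ∈ Icc a b
  smooth_inv : ∀ t ∈ Icc a b, ContDiffAt ℝ ∞ ψ t
  hasDerivAt_inv : ∀ t ∈ Icc a b, HasDerivAt ψ (ρ (q t) ^ (1 - Λ))⁻¹ t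
  mem_inv : ∀ t ∈ Icc a b, ψ t ∈ Icc c d
  right_inv : ∀ t ∈ Icc a b, φ (ψ t) = t
  -- `ρ^(1-Λ)` is negative when `ρ < 0` and Λ is even; the new time then runs backwards.
  ends : ψ a = c ∧ ψ b = d ∨ ψ a = d ∧ ψ b = c

variable {E : Type*} [NormedAddCommGroup E] [NormedSpace ℝ E] [FiniteDimensional ℝ E]
  {Q : Type*} [TopologicalSpace Q] [ChartedSpace E Q] [IsManifold 𝓘(ℝ, E) ∞ Q]
  {F : Type*} [NormedAddCommGroup F] [NormedSpace ℝ F] [FiniteDimensional ℝ F]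
  {B : Type*} [TopologicalSpace B] [ChartedSpace F B] [IsManifold 𝓘(ℝ, F) ∞ B]
  {L : TangentBundle 𝓘(ℝ, E) Q → ℝ} {Λ : ℝ}
  {D : ∀ x : TangentBundle 𝓘(ℝ, E) Q, TangentSpace 𝓘(ℝ, E).tangent x} {ρ : Q → ℝ} {p : Q → B}
  (h : IsScalingSystem F L Λ D ρ p)
include h

theorem IsScalingSystem.contDiffAt_rho_rpow {q : ℝ → Q} {t : ℝ}
    (hq : ContMDiffAt 𝓘(ℝ, ℝ) 𝓘(ℝ, E) ∞ q t) (e : ℝ) : ContDiffAt ℝ ∞ (fun t => ρ (q t) ^ e) t :=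
  (h.contDiffAt_rho hq).rpow_const_of_ne (h.rho_ne _)

theorem IsScalingSystem.exists_scaleTime {q : ℝ → Q} {a b : ℝ} (hab : a ≤ b)
    (hq : SmoothCurve E q a b) : ∃ c d φ, IsScaleTime Λ ρ q a b c d φ := by
  obtain ⟨c, d, φ, h1, h2⟩ := exists_time_change hab (s := fun t => (ρ (q t) ^ (1 - Λ))⁻¹)
    (fun t ht => (h.contDiffAt_rho_rpow (hq t ht) _).inv (h.rho_rpow_one_sub_ne _))
    fun t _ => inv_ne_zero (h.rho_rpow_one_sub_ne _)
  refine ⟨c, d, φ, fun τ hτ => ⟨(h1 τ hτ).1, ?_⟩, h2⟩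
  simpa only [inv_inv] using (h1 τ hτ).2

theorem IsScalingSystem.exists_inverseTime {q : ℝ → Q} {a b c d : ℝ} {φ : ℝ → ℝ} (hab : a < b)
    (hq : SmoothCurve E q a b) (hφ : IsScaleTime Λ ρ q a b c d φ) :
    ∃ ψ, IsInverseTime E Λ ρ q a b c d φ ψ := by
  obtain ⟨hcd, ψ, h1, -, h3⟩ := exists_time_change_inverse hab
    (s := fun t => (ρ (q t) ^ (1 - Λ))⁻¹)
    (fun t ht => (h.contDiffAt_rho_rpow (hq t ht) _).inv (h.rho_rpow_one_sub_ne _))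
    (fun t _ => inv_ne_zero (h.rho_rpow_one_sub_ne _)) (c := c) (d := d) (φ := φ)
    (fun τ hτ => by simpa only [inv_inv] using (hφ.1 τ hτ).2) hφ.2
  exact ⟨ψ, hab, hcd, hq, fun τ hτ => (hφ.1 τ hτ).1, fun τ hτ => (hφ.1 τ hτ).2,
    fun τ hτ => hφ.2 ▸ mem_image_of_mem φ hτ, fun t ht => (h1 t ht).1, fun t ht => (h1 t ht).2.1,
    fun t ht => (h1 t ht).2.2.1, fun t ht => (h1 t ht).2.2.2, h3⟩

variable {q : ℝ → Q} {a b c d : ℝ} {φ ψ : ℝ → ℝ} (hT : IsInverseTime E Λ ρ q a b c d φ ψ)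
include hT

theorem IsScalingSystem.contMDiffAt_reduced {τ : ℝ} (hτ : τ ∈ Icc c d) :
    ContMDiffAt 𝓘(ℝ, ℝ) 𝓘(ℝ, F) ∞ (fun τ => p (q (φ τ))) τ :=
  ContMDiffAt.comp (g := fun t => p (q t)) τ (h.smoothCurve_p (hT.smooth _ (hT.mem τ hτ)))
    (hT.smooth_time τ hτ).contMDiffAt

theorem IsScalingSystem.contDiffAt_reduced_action {τ : ℝ} (hτ : τ ∈ Icc c d) :
    ContDiffAt ℝ ∞ (fun τ => scaleAction L D ρ (velocity q (φ τ))) τ :=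
  ContDiffAt.comp (g := fun t => scaleAction L D ρ (velocity q t)) τ
    (h.contDiffAt_action (hT.smooth _ (hT.mem τ hτ))) (hT.smooth_time τ hτ)

theorem IsScalingSystem.velocity_reduced {τ : ℝ} (hτ : τ ∈ Icc c d) :
    velocity (E := F) (fun τ => p (q (φ τ))) τ =
      (scaleProj (F := F) L Λ D ρ p (velocity q (φ τ))).1 := by
  have hq := hT.smooth _ (hT.mem τ hτ)
  rw [scaleProj_velocity_fst (h.quot.smooth.mdifferentiable (by simp) _)
    (hq.mdifferentiableAt (by simp))]
  exact velocity_chain (γ := fun t => p (q t)) ((h.smoothCurve_p hq).mdifferentiableAt (by simp))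
    (hT.hasDerivAt τ hτ)

theorem IsScalingSystem.hasDerivAt_reduced_action (hq : IsExtremal L q a b) {τ : ℝ}
    (hτ : τ ∈ Icc c d) : HasDerivAt (fun τ => scaleAction L D ρ (velocity q (φ τ)))
      (actionRate h.reducedLagrangian Λ (velocity (fun τ => p (q (φ τ))) τ,
        scaleAction L D ρ (velocity q (φ τ)))) τ := by
  have ht := hT.mem τ hτ
  have h1 := ((h.contDiffAt_action (hT.smooth _ ht)).differentiableAt (by simp)).hasDerivAt
  rw [h.deriv_action hT.lt hq ht] at h1
  refine (HasDerivAt.comp τ h1 (hT.hasDerivAt τ hτ)).congr_deriv ?_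
  rw [h.velocity_reduced hT hτ, ← h.rho_div_rpow]
  have h2 := h.rho_ne (q (φ τ))
  have h3 := h.rho_rpow_ne (q (φ τ))
  have h4 : ∀ y r m : ℝ, r ≠ 0 → m ≠ 0 → m / r * y * (r / m) = y := by
    intro y r m hr hm
    field_simp
  exact h4 _ _ _ h2 h3

/-- The scaling function along the curve, in the new time. -/
theorem IsScalingSystem.hasDerivAt_reduced_rho {τ : ℝ} (hτ : τ ∈ Icc c d) :
    HasDerivAt (fun τ => ρ (q (φ τ)))
      -- The double sign displays the derivative as `-ρ ∂ℒ/∂S`, in the form of `partialLag_action`.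
      (-(ρ (q (φ τ)) * -(rhoDot ρ (velocity (E := E) q (φ τ)) / ρ (q (φ τ)) ^ Λ))) τ := by
  have hq := hT.smooth _ (hT.mem τ hτ)
  have h1 := ((h.contDiffAt_rho hq).differentiableAt (by simp)).hasDerivAt
  refine (HasDerivAt.comp τ h1 (hT.hasDerivAt τ hτ)).congr_deriv ?_
  rw [rhoDot_velocity (h.smooth_rho.mdifferentiable (by simp) _) (hq.mdifferentiableAt (by simp)),
    ← h.rho_div_rpow]
  ring

variable {Γ : ℝ → ℝ → B} (hΓ : IsVariation F (fun τ => p (q (φ τ))) c d Γ)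
include hΓ

theorem IsScalingSystem.pushVec_variation {τ : ℝ} (hτ : τ ∈ Icc c d) :
    pushVec (E := F) (Function.uncurry Γ) ((0, τ), (0, 1)) =
      (scaleProj (F := F) L Λ D ρ p (velocity q (φ τ))).1 := by
  have h1 := (hΓ.1 τ hτ).mdifferentiableAt (by simp)
  rw [← h.velocity_reduced hT hτ, ← velocity_slice h1]
  refine velocity_congr_Icc hT.lt' hτ ?_
    ((h.contMDiffAt_reduced hT hτ).mdifferentiableAt (by simp)) hΓ.2
  exact MDifferentiableAt.comp (f := fun t' : ℝ => ((0 : ℝ), t')) τ h1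
    ((differentiableAt_const _).prodMk differentiableAt_id).mdifferentiableAt

theorem IsScalingSystem.partialLag_action {S : ℝ → ℝ} {τ : ℝ} (hτ : τ ∈ Icc c d)
    (hS : S τ = scaleAction L D ρ (velocity q (φ τ))) :
    partialLag h.reducedLagrangian Γ S τ (0, 1) =
      -(rhoDot ρ (velocity (E := E) q (φ τ)) / ρ (q (φ τ)) ^ Λ) := by
  have h1 := ((contDiffAt_pushLag h.contMDiff_reducedLagrangian (hΓ.1 τ hτ) (0, 1)
    (S τ)).differentiableAt (by simp)).hasFDerivAt
  have h2 := HasFDerivAt.comp_hasDerivAt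
    (f := fun s : ℝ => ((((0 : ℝ), τ), ((0 : ℝ), (1 : ℝ))), s)) (S τ) h1
    ((hasDerivAt_const _ _).prodMk (hasDerivAt_id' (S τ)))
  have h3 := h.hasDerivAt_reducedLagrangian_snd (velocity q (φ τ))
  rw [← h.pushVec_variation hT hΓ hτ, ← hS] at h3
  exact h2.unique h3

/-- The variational principle for the reduced curve; the variation may be rescaled by `k`. -/
theorem IsScalingSystem.integral_partialLag_eq_zero (hq : IsExtremal L q a b)
    (hΓe : FixesEndpoints (fun τ => p (q (φ τ))) c d Γ) {k : ℝ → ℝ}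
    (hk : ∀ t ∈ Icc a b, ContDiffAt ℝ ∞ k t) :
    ∫ t in a..b, ρ (q t) ^ Λ * partialLag h.reducedLagrangian Γ
      (fun τ => scaleAction L D ρ (velocity q (φ τ))) (ψ t)
      (((k t, 0), (ρ (q t) ^ (1 - Λ) * deriv k t, 0)), 0) = 0 := by
  set l := h.reducedLagrangian with hldef
  have hl := h.contMDiff_reducedLagrangian
  rw [← hldef] at hl
  have hab := hT.lt
  have ha := left_mem_Icc.2 hab.le
  have hb := right_mem_Icc.2 hab.le
  have hχ : ∀ t ∈ Icc a b, ContDiffAt ℝ ∞ (fun y : ℝ × ℝ => (y.1 * k y.2, ψ y.2)) (0, t) :=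
    fun t ht => (contDiffAt_fst.mul (ContDiffAt.comp (f := (Prod.snd : ℝ × ℝ → ℝ)) (0, t) (hk t ht)
      contDiffAt_snd)).prodMk (ContDiffAt.comp (f := (Prod.snd : ℝ × ℝ → ℝ)) (0, t)
      (hT.smooth_inv t ht) contDiffAt_snd)
  have hends : ∀ t ∈ Icc a b, (ψ t = c ∨ ψ t = d) → ∀ᶠ ε in 𝓝 (0 : ℝ),
      Γ (ε * k t) (ψ t) = p (q t) := by
    intro t ht hte
    have h1 : Tendsto (fun ε : ℝ => ε * k t) (𝓝 0) (𝓝 0) := by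
      have : ContinuousAt (fun ε : ℝ => ε * k t) 0 := by fun_prop
      simpa using this.tendsto
    filter_upwards [h1.eventually hΓe] with ε hε
    rcases hte with h2 | h2
    · rw [h2, hε.1, ← h2, hT.right_inv t ht]
    · rw [h2, hε.2, ← h2, hT.right_inv t ht]
  -- Running through `Γ` at speed `k(t)` multiplies the variation field by `k` and avoids scaling
  -- tangent vectors of `B` over a manifold; `ρ` is not varied.
  have hprin := h.integral_deriv_reduced_eq_zero hab hq (Γ := fun ε t => Γ (ε * k t) (ψ t))
    (R := fun _ t => ρ (q t))
    ⟨fun t ht => by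
      refine ContMDiffAt.comp (0, t) (g := Function.uncurry Γ)
        (f := fun y : ℝ × ℝ => (y.1 * k y.2, ψ y.2)) ?_ (hχ t ht).contMDiffAt
      dsimp only
      rw [zero_mul]
      exact hΓ.1 _ (hT.mem_inv t ht), fun t ht => by
      dsimp only
      rw [zero_mul, hΓ.2 _ (hT.mem_inv t ht)]
      dsimp only
      rw [hT.right_inv t ht]⟩
    ⟨fun t ht => (ContDiffAt.comp (f := (Prod.snd : ℝ × ℝ → ℝ)) (0, t)
      (h.contDiffAt_rho (hq.1 t ht)) contDiffAt_snd).contMDiffAt, fun t ht => rfl⟩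
    ((hends a ha (hT.ends.imp And.left And.left)).and
      (hends b hb (hT.ends.symm.imp And.right And.right)))
    (Eventually.of_forall fun ε => ⟨rfl, rfl⟩)
  rw [← neg_eq_zero, ← intervalIntegral.integral_neg]
  refine Eq.trans (intervalIntegral.integral_congr fun t ht => ?_) hprin
  rw [uIcc_of_le hab.le] at ht
  have hmem := hT.mem_inv t ht
  set S0 := scaleAction L D ρ (velocity q t) with hS0
  set w := ρ (q t) ^ (1 - Λ) with hw
  have hw0 : w ≠ 0 := h.rho_rpow_one_sub_ne (q t)
  let lf : ((ℝ × ℝ) × (ℝ × ℝ)) × ℝ → ℝ := fun y => l (pushVec (Function.uncurry Γ) y.1, y.2)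
  -- The factor `w = ρ^(1-Λ)` cancels the derivative `w⁻¹` of `ψ`, leaving velocity 1 in the new
  -- time, and turns the `t`-derivative of `k` into its τ-derivative.
  have hev : (fun ε => -(ρ (q t) ^ Λ * l (smulVec w
      (velocity (fun t => Γ (ε * k t) (ψ t)) t), S0)) - deriv (fun t => ρ (q t)) t * S0) =ᶠ[𝓝 0]
      fun ε => -(ρ (q t) ^ Λ * lf (((ε * k t, ψ t), (ε * (w * deriv k t), 1)), S0)) -
        deriv (fun t => ρ (q t)) t * S0 := by
    have h1 : Tendsto (fun ε : ℝ => (ε * k t, ψ t)) (𝓝 0) (𝓝 (0, ψ t)) := by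
      have : ContinuousAt (fun ε : ℝ => (ε * k t, ψ t)) 0 := by fun_prop
      simpa using this.tendsto
    filter_upwards [h1.eventually (eventually_mdifferentiableAt (hΓ.1 _ hmem))] with ε hε
    have h2 := velocity_comp (E := F) (c := fun t => (ε * k t, ψ t)) (t := t) hε
      ((((hk t ht).differentiableAt (by simp)).hasDerivAt.const_mul ε).prodMk
        (hT.hasDerivAt_inv t ht))
    have h3 : smulVec (E := F) w (velocity (fun t => Γ (ε * k t) (ψ t)) t) =
        pushVec (Function.uncurry Γ) ((ε * k t, ψ t), (ε * (w * deriv k t), 1)) := by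
      refine (congrArg (smulVec w) h2).trans ((smulVec_pushVec _ _ _).trans ?_)
      rw [Prod.smul_mk, smul_eq_mul, smul_eq_mul, ← hw, mul_inv_cancel₀ hw0,
        show w * (ε * deriv k t) = ε * (w * deriv k t) by ring]
    exact congrArg (fun x => -(ρ (q t) ^ Λ * l (x, S0)) - deriv (fun t => ρ (q t)) t * S0) h3
  refine Eq.trans ?_ hev.deriv_eq.symm
  have hS : scaleAction L D ρ (velocity q (φ (ψ t))) = S0 := by rw [hT.right_inv t ht]
  have hlf : HasFDerivAt lf (partialLag l Γ (fun τ => scaleAction L D ρ (velocity q (φ τ))) (ψ t))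
      (((0 * k t, ψ t), (0 * (w * deriv k t), 1)), S0) := by
    have h1 := ((contDiffAt_pushLag hl (hΓ.1 _ hmem) (0, 1) S0).differentiableAt
      (by simp)).hasFDerivAt
    rw [zero_mul, zero_mul]
    unfold partialLag
    dsimp only
    rw [hS]
    exact h1
  have hc : HasDerivAt (fun ε : ℝ => (((ε * k t, ψ t), (ε * (w * deriv k t), (1 : ℝ))), S0))
      (((k t, 0), (w * deriv k t, 0)), 0) 0 := by
    have h1 := ((((hasDerivAt_id' (0 : ℝ)).mul_const (k t)).prodMk
      (hasDerivAt_const (0 : ℝ) (ψ t))).prodMk (((hasDerivAt_id' (0 : ℝ)).mul_const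
      (w * deriv k t)).prodMk (hasDerivAt_const (0 : ℝ) (1 : ℝ)))).prodMk
      (hasDerivAt_const (0 : ℝ) S0)
    simpa using h1
  have h4 := (HasFDerivAt.comp_hasDerivAt
    (f := fun ε : ℝ => (((ε * k t, ψ t), (ε * (w * deriv k t), (1 : ℝ))), S0)) 0 hlf hc)
  have h5 := (((h4.const_mul (ρ (q t) ^ Λ)).fun_neg).sub_const
    (deriv (fun t => ρ (q t)) t * S0)).deriv
  exact h5.symm

end ReducedTime

/-! ### First-order expansions along families of curves. -/

theorem map_variation (A : (((ℝ × ℝ) × (ℝ × ℝ)) × ℝ) →L[ℝ] ℝ) (x y s : ℝ) :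
    A (((x, 0), (y, 0)), s) = x * A (((1, 0), 0), 0) + y * A ((0, (1, 0)), 0) + s * A (0, 1) := by
  have h1 : ((((x, 0), (y, 0)), s) : ((ℝ × ℝ) × (ℝ × ℝ)) × ℝ) =
      x • (((1, 0), 0), 0) + y • ((0, (1, 0)), 0) + s • (0, 1) := by simp
  rw [h1, map_add, map_add, map_smul, map_smul, map_smul]
  rfl

section Families

variable {F : Type*} [NormedAddCommGroup F] [NormedSpace ℝ F]
  {B : Type*} [TopologicalSpace B] [ChartedSpace F B] [IsManifold 𝓘(ℝ, F) ∞ B]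
  {l : TangentBundle 𝓘(ℝ, F) B × ℝ → ℝ}
  (hl : ContMDiff (𝓘(ℝ, F).tangent.prod 𝓘(ℝ, ℝ)) 𝓘(ℝ, ℝ) ∞ l)

/-- Differentiation of a smooth family of functions in the parameter. -/
theorem hasDerivAt_family {T : ℝ → ℝ → ℝ} {τ : ℝ}
    (hT : ContDiffAt ℝ ∞ (Function.uncurry T) (0, τ)) :
    HasDerivAt (fun ε => T ε τ) (fderiv ℝ (Function.uncurry T) (0, τ) (1, 0)) 0 :=
  HasFDerivAt.comp_hasDerivAt (f := fun ε : ℝ => (ε, τ)) 0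
    (hT.differentiableAt (by simp)).hasFDerivAt
    ((hasDerivAt_id' (0 : ℝ)).prodMk (hasDerivAt_const (0 : ℝ) τ))

include hl

/-- Derivative of the Herglotz action along a smooth family. -/
theorem hasDerivAt_herglotzAction {q : ℝ → B} {S : ℝ → ℝ} {c d : ℝ} (hcd : c ≤ d) {Γ : ℝ → ℝ → B}
    {T : ℝ → ℝ → ℝ} (hΓ : IsVariation F q c d Γ) (hT : IsVariation ℝ S c d T) :
    HasDerivAt (fun ε => herglotzAction l (Γ ε) (T ε) c d)
      (∫ τ in c..d, partialLag l Γ S τ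
        (((1, 0), 0), fderiv ℝ (Function.uncurry T) (0, τ) (1, 0))) 0 := by
  refine (hasDerivAt_integral_of_contDiffAt hcd
    (X := fun y => l (velocity (Γ y.1) y.2, T y.1 y.2)) fun τ hτ =>
    (contDiffAt_lag_velocity hl (hΓ.1 τ hτ) (hT.1 τ hτ).contDiffAt).of_le
      (by norm_num)).congr_deriv (intervalIntegral.integral_congr fun τ hτ => ?_)
  rw [uIcc_of_le hcd] at hτ
  refine (fderiv_lag_velocity hl (hΓ.1 τ hτ) (hT.1 τ hτ).contDiffAt).trans ?_
  unfold partialLag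
  rw [hT.2 τ hτ]

/-- The linearization along a variation of the equation `S' = ℒ(q, q', S)`. -/
theorem hasDerivAt_linearized {q : ℝ → B} {S : ℝ → ℝ} {c d : ℝ} {Γ : ℝ → ℝ → B}
    {T : ℝ → ℝ → ℝ} (hΓ : IsVariation F q c d Γ) (hT : IsVariation ℝ S c d T) {τ : ℝ}
    (hτ : τ ∈ Icc c d)
    (hS : ∀ᶠ ε in 𝓝 (0 : ℝ), HasDerivAt (T ε) (l (velocity (Γ ε) τ, T ε τ)) τ) :
    HasDerivAt (fun τ => fderiv ℝ (Function.uncurry T) (0, τ) (1, 0))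
      (partialLag l Γ S τ (((1, 0), 0), fderiv ℝ (Function.uncurry T) (0, τ) (1, 0))) τ := by
  set u := Function.uncurry T with hu
  have hus : ContDiffAt ℝ ∞ u (0, τ) := (hT.1 τ hτ).contDiffAt
  have hus2 : ContDiffAt ℝ 2 u (0, τ) := contDiffAt_infty.1 hus 2
  have h1 : DifferentiableAt ℝ (fderiv ℝ u) (0, τ) :=
    (hus2.fderiv_right (m := 1) (by norm_num)).differentiableAt (by simp)
  have h2 : HasDerivAt (fun τ => fderiv ℝ u (0, τ)) (fderiv ℝ (fderiv ℝ u) (0, τ) (0, 1)) τ :=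
    HasFDerivAt.comp_hasDerivAt (f := fun τ : ℝ => ((0 : ℝ), τ)) τ h1.hasFDerivAt
      ((hasDerivAt_const τ (0 : ℝ)).prodMk (hasDerivAt_id' τ))
  have h3 := h2.clm_apply (hasDerivAt_const τ ((1, 0) : ℝ × ℝ))
  rw [map_zero, add_zero] at h3
  refine h3.congr_deriv ?_
  -- After exchanging the order of differentiation, the inner derivative is that of `T ε` in τ,
  -- which the equation replaces by ℒ for all small ε.
  have hsymm : IsSymmSndFDerivAt ℝ u (0, τ) :=
    hus2.isSymmSndFDerivAt (by simp)
  rw [hsymm.eq]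
  have h4 : HasDerivAt (fun ε => fderiv ℝ u (ε, τ) (0, 1))
      (fderiv ℝ (fderiv ℝ u) (0, τ) (1, 0) (0, 1)) 0 := by
    have h5 : HasDerivAt (fun ε => fderiv ℝ u (ε, τ)) (fderiv ℝ (fderiv ℝ u) (0, τ) (1, 0)) 0 :=
      HasFDerivAt.comp_hasDerivAt (f := fun ε : ℝ => (ε, τ)) 0 h1.hasFDerivAt
        ((hasDerivAt_id' (0 : ℝ)).prodMk (hasDerivAt_const (0 : ℝ) τ))
    have h6 := h5.clm_apply (hasDerivAt_const (0 : ℝ) ((0, 1) : ℝ × ℝ))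
    rwa [map_zero, add_zero] at h6
  have hX := contDiffAt_lag_velocity hl (hΓ.1 τ hτ) hus
  have h7 : HasDerivAt (fun ε => l (velocity (Γ ε) τ, T ε τ))
      (fderiv ℝ (fun y : ℝ × ℝ => l (velocity (Γ y.1) y.2, T y.1 y.2)) (0, τ) (1, 0)) 0 :=
    HasFDerivAt.comp_hasDerivAt (f := fun ε : ℝ => (ε, τ)) 0
      (hX.differentiableAt (by simp)).hasFDerivAt
      ((hasDerivAt_id' (0 : ℝ)).prodMk (hasDerivAt_const (0 : ℝ) τ))
  have h8 : (fun ε => l (velocity (Γ ε) τ, T ε τ)) =ᶠ[𝓝 0] fun ε => fderiv ℝ u (ε, τ) (0, 1) := by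
    have h9 : ∀ᶠ y in 𝓝 ((0 : ℝ), τ), DifferentiableAt ℝ u y :=
      ((hus.of_le (n := ∞) (m := 1) (by norm_num)).eventually (by simp)).mono fun y hy =>
        hy.differentiableAt (by simp)
    have h10 : ContinuousAt (fun ε : ℝ => (ε, τ)) 0 := by fun_prop
    filter_upwards [hS, h10.tendsto.eventually h9] with ε h11 h12
    exact h11.unique (HasFDerivAt.comp_hasDerivAt (f := fun τ : ℝ => (ε, τ)) τ h12.hasFDerivAt
      ((hasDerivAt_const τ ε).prodMk (hasDerivAt_id' τ)))
  refine (h4.unique (h7.congr_of_eventuallyEq h8.symm)).trans ?_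
  refine (fderiv_lag_velocity hl (hΓ.1 τ hτ) hus).trans ?_
  unfold partialLag
  rw [hT.2 τ hτ]

/-- The fibre derivative of `ℒ` on the variation field. -/
theorem fibreDeriv_variationField {Γ : ℝ → ℝ → B} {τ : ℝ}
    (hΓ : ContMDiffAt 𝓘(ℝ, ℝ × ℝ) 𝓘(ℝ, F) ∞ (Function.uncurry Γ) (0, τ)) (S : ℝ → ℝ) :
    fibreDeriv (fun x => l (x, S τ)) (velocity (Γ 0) τ) (variationField Γ τ) =
      partialLag l Γ S τ ((0, (1, 0)), 0) := by
  have h1 := hΓ.mdifferentiableAt (by simp)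
  refine Eq.trans ?_ (fibreDeriv_pushVec hl hΓ (0, 1) (1, 0) (S τ))
  have h2 : ∀ x : TangentBundle 𝓘(ℝ, F) B, ∀ v : F,
      x = pushVec (Function.uncurry Γ) ((0, τ), (0, 1)) →
      (fibreDeriv (fun x => l (x, S τ)) x : F →L[ℝ] ℝ) v =
        (fibreDeriv (fun x => l (x, S τ)) (pushVec (Function.uncurry Γ) ((0, τ), (0, 1))) :
          F →L[ℝ] ℝ) v := by
    rintro x v rfl
    rfl
  refine (h2 _ _ (velocity_slice h1)).trans ?_
  exact congrArg (fibreDeriv (fun x => l (x, S τ))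
    (pushVec (Function.uncurry Γ) ((0, τ), (0, 1))) : F →L[ℝ] ℝ) (variationField_eq h1)

end Families

/-! ### Projected curves are Herglotz extremals. -/

section ReducedExtremals

variable {E : Type*} [NormedAddCommGroup E] [NormedSpace ℝ E] [FiniteDimensional ℝ E]
  {Q : Type*} [TopologicalSpace Q] [ChartedSpace E Q] [IsManifold 𝓘(ℝ, E) ∞ Q]
  {F : Type*} [NormedAddCommGroup F] [NormedSpace ℝ F] [FiniteDimensional ℝ F]
  {B : Type*} [TopologicalSpace B] [ChartedSpace F B] [IsManifold 𝓘(ℝ, F) ∞ B]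
  {L : TangentBundle 𝓘(ℝ, E) Q → ℝ} {Λ : ℝ}
  {D : ∀ x : TangentBundle 𝓘(ℝ, E) Q, TangentSpace 𝓘(ℝ, E).tangent x} {ρ : Q → ℝ} {p : Q → B}
  (h : IsScalingSystem F L Λ D ρ p)
  {q : ℝ → Q} {a b c d : ℝ} {φ ψ : ℝ → ℝ} (hT : IsInverseTime E Λ ρ q a b c d φ ψ)
include h hT

/-- Substitution `τ = ψ(t)`. If the new time runs backwards the integral changes sign, which does
not affect its vanishing. -/
theorem IsScalingSystem.integral_eq_zero_of_comp {X : ℝ → ℝ} (hX : ContinuousOn X (Icc c d))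
    (h0 : ∫ t in a..b, X (ψ t) * (ρ (q t) ^ (1 - Λ))⁻¹ = 0) : ∫ τ in c..d, X τ = 0 := by
  have h1 := intervalIntegral.integral_comp_mul_deriv' (a := a) (b := b) (f := ψ)
    (f' := fun t => (ρ (q t) ^ (1 - Λ))⁻¹) (g := X)
    (fun t ht => hT.hasDerivAt_inv t (by rwa [uIcc_of_le hT.lt.le] at ht))
    (fun t ht => by
      rw [uIcc_of_le hT.lt.le] at ht
      exact ((h.contDiffAt_rho_rpow (hT.smooth t ht) _).continuousAt.inv₀
        (h.rho_rpow_one_sub_ne _)).continuousWithinAt)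
    (hX.mono (by
      rw [uIcc_of_le hT.lt.le]
      rintro _ ⟨t, ht, rfl⟩
      exact hT.mem_inv t ht))
  have h2 := h1.symm.trans h0
  rcases hT.ends with ⟨ha, hb⟩ | ⟨ha, hb⟩
  · rwa [ha, hb] at h2
  · rw [ha, hb, intervalIntegral.integral_symm] at h2
    exact neg_eq_zero.1 h2

variable {Γ : ℝ → ℝ → B} (hq : IsExtremal L q a b)
  (hΓ : IsVariation F (fun τ => p (q (φ τ))) c d Γ)
  (hΓe : FixesEndpoints (fun τ => p (q (φ τ))) c d Γ)
include hq hΓ hΓe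

omit hq hΓe in
theorem IsScalingSystem.continuousAt_partialLag {τ : ℝ} (hτ : τ ∈ Icc c d) :
    ContinuousAt (partialLag h.reducedLagrangian Γ
      (fun τ => scaleAction L D ρ (velocity q (φ τ)))) τ :=
  ScaleReduction.continuousAt_partialLag h.contMDiff_reducedLagrangian (hΓ.1 τ hτ)
    (h.contDiffAt_reduced_action hT hτ).continuousAt

/-- First variation formula weighted by the scaling function. -/
theorem IsScalingSystem.integral_rho_mul_partialLag :
    ∫ τ in c..d, ρ (q (φ τ)) * partialLag h.reducedLagrangian Γ
      (fun τ => scaleAction L D ρ (velocity q (φ τ))) τ (((1, 0), 0), 0) = 0 := by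
  refine h.integral_eq_zero_of_comp hT (X := fun τ => ρ (q (φ τ)) *
    partialLag h.reducedLagrangian Γ (fun τ => scaleAction L D ρ (velocity q (φ τ))) τ
      (((1, 0), 0), 0)) (fun τ hτ => ?_) ?_
  · exact ((h.hasDerivAt_reduced_rho hT hτ).continuousAt.mul
      ((h.continuousAt_partialLag hT hΓ hτ).clm_apply
        continuousAt_const)).continuousWithinAt
  -- With `k = 1` the term in the derivative of `k` disappears and the weight is `ρ^Λ ρ^(1-Λ) = ρ`.
  refine Eq.trans (intervalIntegral.integral_congr fun t ht => ?_)
    (h.integral_partialLag_eq_zero hT hΓ hq hΓe (k := fun _ => 1) fun t _ => contDiffAt_const)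
  rw [uIcc_of_le hT.lt.le] at ht
  rw [map_variation, deriv_const, hT.right_inv t ht, ← h.rho_div_rpow]
  have h1 := h.rho_ne (q t)
  have h2 := h.rho_rpow_ne (q t)
  field_simp
  ring

/-- First variation formula for variations satisfying the contact condition. -/
theorem IsScalingSystem.integral_partialLag_contact :
    ∫ τ in c..d, partialLag h.reducedLagrangian Γ
      (fun τ => scaleAction L D ρ (velocity q (φ τ))) τ (((1, 0), 0),
        partialLag h.reducedLagrangian Γ (fun τ => scaleAction L D ρ (velocity q (φ τ))) τ
          ((0, (1, 0)), 0)) = 0 := by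
  refine h.integral_eq_zero_of_comp hT (X := fun τ => partialLag h.reducedLagrangian Γ
      (fun τ => scaleAction L D ρ (velocity q (φ τ))) τ (((1, 0), 0),
        partialLag h.reducedLagrangian Γ (fun τ => scaleAction L D ρ (velocity q (φ τ))) τ
          ((0, (1, 0)), 0))) (fun τ hτ => ?_) ?_
  · have h1 := h.continuousAt_partialLag hT hΓ hτ
    exact (h1.clm_apply (continuousAt_const.prodMk
      (h1.clm_apply continuousAt_const))).continuousWithinAt
  have hr : ∀ t ∈ Icc a b, ContDiffAt ℝ ∞ (fun t => ρ (q t)) t := fun t ht =>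
    h.contDiffAt_rho (hT.smooth t ht)
  -- The choice `k = 1/ρ` cancels the weight `ρ`, while `ρ k' = -ρ'/ρ = ∂ℒ/∂S` becomes the
  -- coefficient of `∂ℒ/∂q̄'·δq̄`. The integrand is then the variation of ℒ with `δS = ∂ℒ/∂q̄'·δq̄`.
  refine Eq.trans (intervalIntegral.integral_congr fun t ht => ?_)
    (h.integral_partialLag_eq_zero hT hΓ hq hΓe (k := fun t => (ρ (q t))⁻¹) fun t ht =>
      (hr t ht).inv (h.rho_ne _))
  rw [uIcc_of_le hT.lt.le] at ht
  have h1 := h.rho_ne (q t)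
  have h2 := h.rho_rpow_ne (q t)
  have h3 : deriv (fun t => ρ (q t))⁻¹ t = _ :=
    (((hr t ht).differentiableAt (by simp)).hasDerivAt.inv h1).deriv
  have h3' : deriv (fun t => (ρ (q t))⁻¹) t = _ := h3
  have h4 := h.partialLag_action hT hΓ (S := fun τ => scaleAction L D ρ (velocity q (φ τ)))
    (hT.mem_inv t ht) rfl
  rw [hT.right_inv t ht, rhoDot_velocity (h.smooth_rho.mdifferentiable (by simp) _)
    ((hT.smooth t ht).mdifferentiableAt (by simp))] at h4
  rw [map_variation _ _ (ρ (q t) ^ (1 - Λ) * _), h3', ← h.rho_div_rpow]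
  have h5 := map_variation (partialLag h.reducedLagrangian Γ
    (fun τ => scaleAction L D ρ (velocity q (φ τ))) (ψ t)) 1 0
    (partialLag h.reducedLagrangian Γ (fun τ => scaleAction L D ρ (velocity q (φ τ))) (ψ t)
          ((0, (1, 0)), 0))
  rw [h4] at h5
  refine (congrArg (· * (ρ (q t) / ρ (q t) ^ Λ)⁻¹) h5).trans ?_
  field_simp
  ring

omit hΓ hΓe in
/-- Extremals project to extremals of the reduced `Λ`-Herglotz system. -/
theorem IsScalingSystem.isLambdaHerglotzExtremal :
    IsLambdaHerglotzExtremal h.reducedLagrangian Λ (fun τ => p (q (φ τ)))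
      (fun τ => scaleAction L D ρ (velocity q (φ τ))) c d := by
  refine ⟨fun τ hτ => h.contMDiffAt_reduced hT hτ, fun τ hτ =>
    (h.contDiffAt_reduced_action hT hτ).contMDiffAt, fun τ hτ =>
    h.hasDerivAt_reduced_action hT hq hτ, fun Γ T hΓ hT' hΓe hcon => ?_⟩
  refine (hasDerivAt_herglotzAction h.contMDiff_reducedLagrangian hT.lt'.le hΓ hT').congr_deriv ?_
  refine Eq.trans (intervalIntegral.integral_congr fun τ hτ => ?_)
    (h.integral_partialLag_contact hT hq hΓ hΓe)
  rw [uIcc_of_le hT.lt'.le] at hτ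
  -- The contact condition fixes the `S`-component of the variation to be the one in
  -- `integral_partialLag_contact`.
  have h1 := (hasDerivAt_family (hT'.1 τ hτ).contDiffAt).unique (hcon τ hτ)
  have h2 := h1.trans (fibreDeriv_variationField h.contMDiff_reducedLagrangian (hΓ.1 τ hτ) (T 0))
  have h3 : partialLag h.reducedLagrangian Γ (T 0) τ = partialLag h.reducedLagrangian Γ
      (fun τ => scaleAction L D ρ (velocity q (φ τ))) τ := by
    unfold partialLag
    rw [hT'.2 τ hτ]
  rw [h3] at h2
  rw [h2]

omit hΓ hΓe in
/-- In degree one, extremals project to extremals of the reduced Herglotz system. -/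
theorem IsScalingSystem.isHerglotzExtremal (hΛ : Λ = 1) :
    IsHerglotzExtremal h.reducedLagrangian (fun τ => p (q (φ τ)))
      (fun τ => scaleAction L D ρ (velocity q (φ τ))) c d := by
  refine ⟨fun τ hτ => h.contMDiffAt_reduced hT hτ, fun τ hτ =>
    (h.contDiffAt_reduced_action hT hτ).contMDiffAt, fun τ hτ =>
    (h.hasDerivAt_reduced_action hT hq hτ).congr_deriv ?_, fun Γ T hΓ hT' hΓe hS => ?_⟩
  · unfold actionRate
    rw [sub_eq_zero.2 hΛ.symm, zero_mul, add_zero]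
  have hl := h.contMDiff_reducedLagrangian
  have hcd := hT.lt'.le
  refine (hasDerivAt_herglotzAction hl hcd hΓ hT').congr_deriv ?_
  set θ : ℝ → ℝ := fun τ => fderiv ℝ (Function.uncurry T) (0, τ) (1, 0) with hθ
  set A := partialLag h.reducedLagrangian Γ
    (fun τ => scaleAction L D ρ (velocity q (φ τ))) with hA
  have hAc : ∀ τ ∈ Icc c d, ContinuousAt A τ := fun τ hτ =>
    h.continuousAt_partialLag hT hΓ hτ
  have hθ' : ∀ τ ∈ Icc c d, HasDerivAt θ (A τ (((1, 0), 0), θ τ)) τ := fun τ hτ =>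
    hasDerivAt_linearized hl hΓ hT' hτ (hS.mono fun ε hε => hε.2 τ hτ)
  have hθc : θ c = 0 := by
    have h1 := hasDerivAt_family (hT'.1 c (left_mem_Icc.2 hcd)).contDiffAt
    exact h1.unique ((hasDerivAt_const (0 : ℝ) (scaleAction L D ρ
      (velocity q (φ c)))).congr_of_eventuallyEq (hS.mono fun ε hε => hε.1))
  have hint : ∀ {f : ℝ → ℝ}, (∀ t ∈ Icc c d, ContinuousAt f t) →
      IntervalIntegrable f MeasureTheory.volume c d := fun {f} hf => by
    apply ContinuousOn.intervalIntegrable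
    rw [uIcc_of_le hcd]
    exact fun t ht => (hf t ht).continuousWithinAt
  -- Here θ is δS, and its equation is `θ' = δℒ + (∂ℒ/∂S) θ`, with δℒ taken at fixed `S`. Since `ρ'
  -- = -ρ ∂ℒ/∂S`, the scaling function is an integrating factor: `(ρ θ)' = ρ δℒ`, whose integral is
  -- zero.
  have hθd : ρ (q (φ d)) * θ d - ρ (q (φ c)) * θ c = 0 := by
    refine Eq.trans ?_ (h.integral_rho_mul_partialLag hT hq hΓ hΓe)
    symm
    refine intervalIntegral.integral_eq_sub_of_hasDerivAt (f := fun τ => ρ (q (φ τ)) * θ τ)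
      (fun τ hτ => ?_) (hint fun τ hτ => ?_)
    · rw [uIcc_of_le hcd] at hτ
      refine ((h.hasDerivAt_reduced_rho hT hτ).fun_mul (hθ' τ hτ)).congr_deriv ?_
      have h1 := map_variation (A τ) 1 0 (θ τ)
      rw [h.partialLag_action hT hΓ hτ rfl] at h1
      refine (congrArg (fun x => -(ρ (q (φ τ)) * -(rhoDot ρ (velocity (E := E) q (φ τ)) /
        ρ (q (φ τ)) ^ Λ)) * θ τ + ρ (q (φ τ)) * x) h1).trans ?_
      ring
    · exact (h.hasDerivAt_reduced_rho hT hτ).continuousAt.mul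
        ((hAc τ hτ).clm_apply continuousAt_const)
  rw [hθc, mul_zero, sub_zero] at hθd
  have hθd' : θ d = 0 := (mul_eq_zero.1 hθd).resolve_left (h.rho_ne _)
  -- The variation of the integrand is θ', because ℒ equals the derivative of `S` along the family;
  -- the variation of the action is therefore `θ d - θ c`.
  rw [intervalIntegral.integral_eq_sub_of_hasDerivAt (f := θ)
    (fun τ hτ => hθ' τ (by rwa [uIcc_of_le hcd] at hτ))
    (hint fun τ hτ => (hAc τ hτ).clm_apply (continuousAt_const.prodMk (hθ' τ hτ).continuousAt)),
    hθc, hθd', sub_zero]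

end ReducedExtremals

end ScaleReduction

end

/-! ### The scale reduction theorem. -/

theorem mainTheorem9
    {E : Type*} [NormedAddCommGroup E] [NormedSpace ℝ E] [FiniteDimensional ℝ E]
    {F : Type*} [NormedAddCommGroup F] [NormedSpace ℝ F] [FiniteDimensional ℝ F]
    {Q : Type*} [TopologicalSpace Q] [ChartedSpace E Q] [IsManifold 𝓘(ℝ, E) ∞ Q]
    [T2Space Q] [SecondCountableTopology Q]
    {B : Type*} [TopologicalSpace B] [ChartedSpace F B] [IsManifold 𝓘(ℝ, F) ∞ B]
    [T2Space B] [SecondCountableTopology B]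
    -- the Lagrangian system `(Q, L)`, with Legendre transform a diffeomorphism
    (L : TangentBundle 𝓘(ℝ, E) Q → ℝ)
    (hL : ContMDiff 𝓘(ℝ, E).tangent 𝓘(ℝ, ℝ) ∞ L)
    (hLeg : ∀ q : Q, ScaleReduction.HasLegendreDiffeo (ScaleReduction.fibreLagrangian L q))
    -- the basic scaling symmetry `D` of degree `Λ`
    (Λ : ℝ)
    (D : ∀ x : TangentBundle 𝓘(ℝ, E) Q, TangentSpace 𝓘(ℝ, E).tangent x)
    (hD : ScaleReduction.IsBasicScalingSymmetry L Λ D)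
    -- the scaling function `ρ : Q → ℝˣ`, with `ρ ^ Λ` making sense
    (ρ : Q → ℝ) (hρ : ContMDiff 𝓘(ℝ, E) 𝓘(ℝ, ℝ) ∞ ρ) (hρ0 : ∀ q, ρ q ≠ 0)
    (hρD : ∀ q, ScaleReduction.dirDeriv 𝓘(ℝ, E) ρ q (ScaleReduction.baseField D q) = ρ q)
    (hpow : (∀ q, 0 < ρ q) ∨ ∃ n : ℤ, Λ = n)
    -- the quotient manifold `B` of `Q` by the projection of `D` to `Q`
    (p : Q → B)
    (hp : ScaleReduction.IsOrbitQuotient 𝓘(ℝ, E) 𝓘(ℝ, F) (ScaleReduction.baseField D) p)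
    -- the Legendre transform of the reduced system is a diffeomorphism
    (hLegRed : ∀ (q : Q) (S : ℝ),
      ScaleReduction.HasLegendreDiffeo
        (ScaleReduction.reducedHamiltonian (F := F) L Λ ρ p q S)) :
    -- `D` projects to a vector field on `Q`
    (∀ x, ScaleReduction.projDeriv x (D x) = ScaleReduction.baseField D x.1) ∧
    -- `(TQ)/D ≅ TB × ℝ`
    ScaleReduction.IsOrbitQuotient 𝓘(ℝ, E).tangent (𝓘(ℝ, F).tangent.prod 𝓘(ℝ, ℝ)) D
      (ScaleReduction.scaleProj (F := F) L Λ D ρ p) ∧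
    ∃ ℒ : TangentBundle 𝓘(ℝ, F) B × ℝ → ℝ,
      ContMDiff (𝓘(ℝ, F).tangent.prod 𝓘(ℝ, ℝ)) 𝓘(ℝ, ℝ) ∞ ℒ ∧
      (∀ x, ℒ (ScaleReduction.scaleProj L Λ D ρ p x) =
        -(L x + ScaleReduction.rhoDot ρ x * ScaleReduction.scaleAction L D ρ x) / ρ x.1 ^ Λ) ∧
      -- extremals project, after reparametrization, to extremals
      ∀ (a b : ℝ) (q : ℝ → Q), a < b → ScaleReduction.IsExtremal L q a b →
        (∃ c d φ, ScaleReduction.IsScaleTime Λ ρ q a b c d φ) ∧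
        ∀ (c d : ℝ) (φ : ℝ → ℝ) (z : ℝ → TangentBundle 𝓘(ℝ, F) B × ℝ),
          ScaleReduction.IsScaleTime Λ ρ q a b c d φ →
          z = (fun τ => ScaleReduction.scaleProj L Λ D ρ p
            (ScaleReduction.velocity q (φ τ))) →
          (∀ τ ∈ Icc c d, (z τ).1 = ScaleReduction.velocity (fun τ => (z τ).1.1) τ) ∧
          ScaleReduction.IsLambdaHerglotzExtremal ℒ Λ (fun τ => (z τ).1.1) (fun τ => (z τ).2) c d ∧
          (Λ = 1 →
            ScaleReduction.IsHerglotzExtremal ℒ (fun τ => (z τ).1.1) (fun τ => (z τ).2) c d) := by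
  have h : ScaleReduction.IsScalingSystem F L Λ D ρ p :=
    ⟨hL, hLeg, hD, hρ, hρ0, hρD, hpow, hp, hLegRed⟩
  refine ⟨fun x => h.symm.projDeriv_eq h.smooth h.legendre x, h.isOrbitQuotient_scaleProj,
    h.reducedLagrangian, h.contMDiff_reducedLagrangian, fun x => h.reducedLagrangian_scaleProj x,
    fun a b q hab hq => ⟨h.exists_scaleTime hab.le hq.1, ?_⟩⟩
  rintro c d φ _ hφ rfl
  obtain ⟨ψ, hT⟩ := h.exists_inverseTime hab hq.1 hφ
  exact ⟨fun τ hτ => (h.velocity_reduced hT hτ).symm, h.isLambdaHerglotzExtremal hT hq,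
    h.isHerglotzExtremal hT hq⟩
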